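/- **Setting.** Let $S$ be a spherical surface of revolution: the surface obtained by rotating about the $z$-axis a simple, smooth, unit-speed profile curve $r\mapsto (f(r),0,g(r))$, $r\in[r_N,r_S]$, with $f\ge 0$ and $f(r)=0$ exactly for $r=r_N,r_S$. Assume that $S$ has constant Gaussian curvature $-f''/f=K>0$, and let $\beta$ be a real number with $-ff''+(f')^2=\beta^2$. Let $\gamma>0$, let $\Theta=-f'/(\beta^2 f)$ (an antiderivative of $1/f^2$), and consider the Kepler problem with potential $\gamma\Theta$, in coordinates $(r,v,\theta,u)$ with $\theta$ taken modulo $2\pi$, with the rescaled equations of motion $$\dot r=vf,\quad \dot v=u^2f'-\frac{v^2}{2f\Theta}-\frac{\gamma}{f|\Theta|},\quad \dot\theta=u,\quad \dot u=-uv\Big(f'+\frac1{2f\Theta}\Big)\qquad(\ast)$$ (where $f\Theta=-f'/\beta^2$ is extended to $r=r_N$). For $h\in\mathbb R$ let $\mathbf M(h)$ be the set of points with $r\in[r_N,r_S]$, $f'(r)\ne0$, satisfying the energy relation $\operatorname{sgn}(\Theta)\frac{u^2+v^2}{2}+\gamma=\frac h\Theta$ (with $1/\Theta=-\beta^2 f/f'$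 extended to the poles by $0$ and $\operatorname{sgn}\Theta=-\operatorname{sgn} f'$), let $\mathbf N=\{x\in \mathbf M(h): r=r_N\}$ be the collision manifold, and let $\mathbf B(h,\delta)=\{x\in\mathbf M(h): 1/|\Theta(r)|\le\delta\}$. Let $\psi$ be the (local) flow of $(\ast)$ on $\mathbf M(h)$. A compact invariant set $\mathbf N$ is isolated if it has an open neighbourhood $\mathbf U$ (an isolating neighbourhood) such that every point whose full orbit exists and stays in $\mathbf U$ lies in $\mathbf N$. For a compact $\mathbf B\subset \mathbf M(h)$ with non-empty interior, whose boundary $\mathbf b$ is a smooth hypersurface of $\mathbf M(h)$, let $\mathbf b^{+}$ (resp. $\mathbf b^-$) be the set of points of $\mathbf b$ whose orbit is outside $\mathbf B$ for all small negative (resp. positive) times, and $\mathbf t$ the set of points of $\mathbf b$ at which the vector field is tangent to $\mathbf b$. $\mathbf B$ is an isolating block if $\mathbf t=\mathbf b^+\cap\mathbf b^-$ and $\mathbf t$ is a smooth submanifold of $\mathbf b$ of codimension $1$; it isolates $\mathbf N$ if its interior is an isolating neighbourhood of $\mathbf N$. With $\mathbf a^+=\{x\in\mathbf b^+:\psi(x,[0,\infty))\subset\mathbf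 B\}$, the map across the block is $\Psi(x)=\psi(x,T(x))$ for $x\in\mathbf b^+\setminus\mathbf a^+$, where $T(x)=\inf\{t>0:\psi(x,t)\notin\mathbf B\}$. The block is trivializable if $\Psi$ extends uniquely to a diffeomorphism $\mathbf b^+\to\mathbf b^-$, and $\mathbf N$ is trivializable if it is isolated by a trivializable isolating block. **Theorem 4.** If $|\beta|=2/m$ with $m$ a positive integer, then for every $h$ the set $\mathbf N$ is a trivializable isolated invariant set for $(\ast)$. More precisely, there is $\delta_0>0$ such that for every $0<\delta\le\delta_0$ the set $\mathbf B(h,\delta)$ is a trivializable isolating block that isolates $\mathbf N$, the coordinate $r$ is constant on $\mathbf b$, equal to some $r_0\in(r_N,r_S)$ with $\Theta(r_0)<0$ and $1/|\Theta(r_0)|=\delta$, and the map across the block is $$\Psi(r,v,\theta,u)=(r,-v,\theta+\tilde\Gamma(u),u),\qquad (r,v,\theta,u)\in\mathbf b^+\setminus\mathbf a^+,$$ $$\tilde\Gamma(u)=\begin{cases}-2\zeta(u)-\dfrac{\pi}{|\beta|}, & u\le 0,\\[2mm] -2\zeta(u)-\dfrac{\pi}{|\beta|}+\dfrac{4\pi}{|\beta|},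 & u>0.\end{cases}$$ Here, with $k_1=|\Theta(r_0)|f(r_0)$ and $$s(u)=\frac{\gamma/|\beta|-|\beta|k_1^2u^2}{\sqrt{k_1^2(2\gamma+2h\delta-u^2)u^2+(\gamma/|\beta|-|\beta|k_1^2u^2)^2}},$$ $\zeta(u)=\frac1{|\beta|}\arcsin s(u)$ for $u\le0$ and $\zeta(u)=\frac1{|\beta|}(\pi-\arcsin s(u))$ for $u>0$. This $\zeta$ is the phase of the generalized Runge–Lenz integrals $$I_1=\sin(\beta\theta)|\Theta|fuv-\beta\cos(\beta\theta)\Theta|\Theta|f^2u^2-\tfrac\gamma\beta\cos(\beta\theta),\qquad I_2=-\cos(\beta\theta)|\Theta|fuv-\beta\sin(\beta\theta)\Theta|\Theta|f^2u^2-\tfrac\gamma\beta\sin(\beta\theta):$$ on $\mathbf b^+$ one has $I:=\sqrt{I_1^2+I_2^2}>0$, $I_1=I\sin[\beta(\theta-\zeta(u))]$ and $I_2=-I\cos[\beta(\theta-\zeta(u))]$. Moreover the formula $(r,v,\theta,u)\mapsto(r,-v,\theta+\tilde\Gamma(u),u)$ defines a diffeomorphism $\mathbf b^+\to\mathbf b^-$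 extending $\Psi$. -/

import Mathlib

open Set Filter Topology
open scoped ContDiff

namespace KeplerBlock

noncomputable section

/-! ## Local flows on subsets of a normed space, isolated invariant sets, isolating blocks

`M` is a (sub)manifold of the normed space `E`, carrying the flow `ψ` of a vector field `X`.
The flow is allowed to be local: `FlowsTo X M x t y` says that `ψ(x, t)` is defined and is `y`. -/

section Flow

variable {E : Type*} [NormedAddCommGroup E] [NormedSpace ℝ E]

/-- `ψ(x, t)` is defined and equals `y`: there is a solution of `ċ = X(c)`, staying in `M`, on the
interval between `0` and `t`, with `c(0) = x` and `c(t) = y`. -/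
def FlowsTo (X : E → E) (M : Set E) (x : E) (t : ℝ) (y : E) : Prop :=
  ∃ c : ℝ → E, IsIntegralCurveOn c (fun _ => X) (uIcc 0 t) ∧ (∀ s ∈ uIcc 0 t, c s ∈ M) ∧
    c 0 = x ∧ c t = y

/-- `ψ(N, ℝ) = N` (in particular the flow is defined for all times on `N`). -/
def IsInvariantSet (X : E → E) (M N : Set E) : Prop :=
  (∀ x ∈ N, ∀ t : ℝ, ∃ y, FlowsTo X M x t y) ∧ {y | ∃ x ∈ N, ∃ t : ℝ, FlowsTo X M x t y} = N

/-- `U` is a (relatively) open subset of `M` containing `N`, and every point whose whole orbit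
stays in `U` belongs to `N`. -/
def IsIsolatingNeighborhood (X : E → E) (M N U : Set E) : Prop :=
  (∃ O : Set E, IsOpen O ∧ U = M ∩ O) ∧ N ⊆ U ∧
    ∀ x ∈ M, (∀ t : ℝ, ∃ y ∈ U, FlowsTo X M x t y) → x ∈ N

/-- A compact invariant subset of `M` that has an isolating neighbourhood. -/
def IsIsolatedInvariantSet (X : E → E) (M N : Set E) : Prop :=
  N ⊆ M ∧ IsCompact N ∧ IsInvariantSet X M N ∧ ∃ U, IsIsolatingNeighborhood X M N U

/-- Interior of `B` in the topology of `M`. -/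
def relInterior (M B : Set E) : Set E :=
  ((↑) : M → E) '' interior (((↑) : M → E) ⁻¹' B)

/-- Boundary of `B` in the topology of `M`. -/
def relBoundary (M B : Set E) : Set E :=
  ((↑) : M → E) '' frontier (((↑) : M → E) ⁻¹' B)

/-- The set `b⁺` of ingress points. -/
def ingress (X : E → E) (M B : Set E) : Set E :=
  {x ∈ relBoundary M B | ∃ ε > 0, ∀ t ∈ Ioo (-ε) 0, ∃ y, FlowsTo X M x t y ∧ y ∉ B}

/-- The set `b⁻` of egress points. -/
def egress (X : E → E) (M B : Set E) : Set E :=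
  {x ∈ relBoundary M B | ∃ ε > 0, ∀ t ∈ Ioo 0 ε, ∃ y, FlowsTo X M x t y ∧ y ∉ B}

/-- `w` is tangent to `S` at `x`: it is the velocity of a curve in `S` through `x`. -/
def IsTangentTo (S : Set E) (x w : E) : Prop :=
  ∃ c : ℝ → E, c 0 = x ∧ (∀ᶠ t in 𝓝 0, c t ∈ S) ∧ HasDerivAt c w 0

/-- The set `t` of tangency points. -/
def tangency (X : E → E) (M B : Set E) : Set E :=
  {x ∈ relBoundary M B | IsTangentTo (relBoundary M B) x (X x)}

/-- `S` is a smooth embedded submanifold of `E` (without boundary) of codimension `k`. -/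
def IsSmoothSubmanifold (k : ℕ) (S : Set E) : Prop :=
  ∀ x ∈ S, ∃ U : Set E, IsOpen U ∧ x ∈ U ∧ ∃ g : E → (Fin k → ℝ),
    ContDiffOn ℝ ∞ g U ∧ (∀ y ∈ U, Function.Surjective (fderiv ℝ g y)) ∧
    S ∩ U = {y ∈ U | g y = 0}

/-- `B` is an isolating block, where `k` is the codimension of `M` in `E`: `B ⊆ M` is compact with
nonempty interior, its boundary `b` is a smooth hypersurface of `M`, `t = b⁺ ∩ b⁻`, and `t` is a
smooth submanifold of `b` of codimension one. -/
structure IsIsolatingBlock (X : E → E) (M : Set E) (k : ℕ) (B : Set E) : Prop where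
  subset : B ⊆ M
  isCompact : IsCompact B
  nonempty_interior : (relInterior M B).Nonempty
  boundary_smooth : IsSmoothSubmanifold (k + 1) (relBoundary M B)
  tangency_eq : tangency X M B = ingress X M B ∩ egress X M B
  tangency_smooth : IsSmoothSubmanifold (k + 2) (tangency X M B)

/-- The isolating block `B` isolates the isolated invariant set `N`. -/
def Isolates (X : E → E) (M : Set E) (k : ℕ) (B N : Set E) : Prop :=
  IsIsolatedInvariantSet X M N ∧ IsIsolatingBlock X M k B ∧
    IsIsolatingNeighborhood X M N (relInterior M B)

/-- The set `a⁺` of ingress points whose forward orbit stays in `B`. -/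
def asympPlus (X : E → E) (M B : Set E) : Set E :=
  {x ∈ ingress X M B | ∀ t : ℝ, 0 ≤ t → ∃ y ∈ B, FlowsTo X M x t y}

/-- The time `T(x) = inf {t > 0 | ψ(x, t) ∉ B}` spent in the block. -/
def transitTime (X : E → E) (M B : Set E) (x : E) : ℝ :=
  sInf {t : ℝ | 0 < t ∧ ∃ y, FlowsTo X M x t y ∧ y ∉ B}

/-- The graph of the map across the block: `y = Ψ(x) = ψ(x, T(x))`
(of interest for `x ∈ b⁺ \ a⁺`). -/
def CrossesTo (X : E → E) (M B : Set E) (x y : E) : Prop :=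
  FlowsTo X M x (transitTime X M B x) y

/-- A map between subsets of normed spaces is smooth if it is locally the restriction of smooth
maps defined on open sets. -/
def IsSmoothMap {F : Type*} [NormedAddCommGroup F] [NormedSpace ℝ F] {A : Set E} {A' : Set F}
    (φ : A → A') : Prop :=
  ∀ x : A, ∃ U : Set E, IsOpen U ∧ (x : E) ∈ U ∧ ∃ G : E → F, ContDiffOn ℝ ∞ G U ∧
    ∀ y : A, (y : E) ∈ U → (φ y : F) = G y

/-- A bijection between subsets of normed spaces that is smooth with smooth inverse. -/
def IsDiffeo {F : Type*} [NormedAddCommGroup F] [NormedSpace ℝ F] {A : Set E} {A' : Set F}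
    (e : A ≃ A') : Prop :=
  IsSmoothMap (e : A → A') ∧ IsSmoothMap (e.symm : A' → A)

/-- The diffeomorphism `e : b⁺ → b⁻` extends the map across the block `Ψ : b⁺ \ a⁺ → b⁻`. -/
def IsDiffeoExtension (X : E → E) (M B : Set E) (e : ingress X M B ≃ egress X M B) : Prop :=
  IsDiffeo e ∧ ∀ x : ingress X M B, (x : E) ∉ asympPlus X M B →
    ∀ y : E, CrossesTo X M B x y ↔ y = e x

/-- The map across the block extends uniquely to a diffeomorphism `b⁺ → b⁻`. -/
def IsTrivializableBlock (X : E → E) (M B : Set E) : Prop :=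
  ∃! e : ingress X M B ≃ egress X M B, IsDiffeoExtension X M B e

/-- `N` is a trivializable isolated invariant set (`k` is the codimension of `M` in `E`):
an isolated invariant set isolated by a trivializable isolating block. -/
def IsTrivializableInvariantSet (X : E → E) (M : Set E) (k : ℕ) (N : Set E) : Prop :=
  IsIsolatedInvariantSet X M N ∧ ∃ B, Isolates X M k B N ∧ IsTrivializableBlock X M B

end Flow

/-! ## Spherical surfaces of revolution -/

/-- The data of a spherical surface of revolution: the surface obtained by rotating about the
`z`-axis the simple smooth unit speed profile curve `r ↦ (f r, 0, g r)`, `r ∈ [rN, rS]`, where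
`f ≥ 0` vanishes exactly at the two endpoints. -/
structure SphericalSurface where
  rN : ℝ
  rS : ℝ
  lt : rN < rS
  f : ℝ → ℝ
  g : ℝ → ℝ
  smooth_f : ContDiffOn ℝ ∞ f (Icc rN rS)
  smooth_g : ContDiffOn ℝ ∞ g (Icc rN rS)
  nonneg : ∀ r ∈ Icc rN rS, 0 ≤ f r
  zero_iff : ∀ r ∈ Icc rN rS, f r = 0 ↔ r = rN ∨ r = rS
  simple : InjOn (fun r => (f r, g r)) (Icc rN rS)
  unit_speed : ∀ r ∈ Icc rN rS,
    derivWithin f (Icc rN rS) r ^ 2 + derivWithin g (Icc rN rS) r ^ 2 = 1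

namespace SphericalSurface

variable (S : SphericalSurface)

/-- `f'` (one-sided at the poles). -/
def df (r : ℝ) : ℝ := derivWithin S.f (Icc S.rN S.rS) r

/-- `f''` (one-sided at the poles). -/
def ddf (r : ℝ) : ℝ := derivWithin S.df (Icc S.rN S.rS) r

/-- The Gaussian curvature `-f''/f` is constant, equal to `K`, away from the poles. -/
def HasConstantCurvature (K : ℝ) : Prop :=
  ∀ r ∈ Ioo S.rN S.rS, -(S.ddf r / S.f r) = K

/-- The relation `-f f'' + f'² = β²`, which defines `|β|`. -/
def HasParameter (β : ℝ) : Prop :=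
  ∀ r ∈ Ioo S.rN S.rS, -(S.f r * S.ddf r) + S.df r ^ 2 = β ^ 2

/-- `Θ = -f'/(β² f)`, the antiderivative of `1/f²` with `f'/f = -β² Θ`; the potential is `γ Θ`.
Meaningful away from the poles. -/
def Theta (β r : ℝ) : ℝ := -(S.df r) / (β ^ 2 * S.f r)

/-- The product `f Θ = -f'/β²`, smoothly extended to the poles. -/
def fTheta (β r : ℝ) : ℝ := -(S.df r) / β ^ 2

/-- The function `1/Θ = -β² f/f'`, smoothly extended to the poles. -/
def invTheta (β r : ℝ) : ℝ := -(β ^ 2 * S.f r) / S.df r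

theorem f_ne_zero {r : ℝ} (hr : r ∈ Ioo S.rN S.rS) : S.f r ≠ 0 := by
  intro h
  rcases (S.zero_iff r ⟨hr.1.le, hr.2.le⟩).1 h with h | h
  · exact hr.1.ne' h
  · exact hr.2.ne h

theorem fTheta_eq {β r : ℝ} (hr : r ∈ Ioo S.rN S.rS) :
    S.fTheta β r = S.f r * S.Theta β r := by
  have h := S.f_ne_zero hr
  unfold fTheta Theta
  rw [mul_comm (β ^ 2), ← mul_div_assoc, mul_div_mul_left _ _ h]

theorem invTheta_eq (β r : ℝ) : S.invTheta β r = (S.Theta β r)⁻¹ := by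
  unfold invTheta Theta
  rw [inv_div, div_neg, neg_div]

theorem sign_fTheta {β r : ℝ} (hr : r ∈ Ioo S.rN S.rS) :
    SignType.sign (S.fTheta β r) = SignType.sign (S.Theta β r) := by
  have h : 0 < S.f r := lt_of_le_of_ne (S.nonneg r ⟨hr.1.le, hr.2.le⟩) (S.f_ne_zero hr).symm
  rw [S.fTheta_eq hr, sign_mul, sign_pos h, one_mul]

end SphericalSurface

/-! ## The generalized Kepler problem -/

/-- Phase space with coordinates `(r, v, z, u)`, the angle `θ` (modulo `2π`) being represented by
the unit complex number `z = exp(iθ)`. -/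
abbrev Phase : Type := ℝ × ℝ × ℂ × ℝ

namespace SphericalSurface

variable (S : SphericalSurface)

/-- The rescaled equations of motion
`ṙ = v f`, `v̇ = u² f' - v²/(2fΘ) - γ/(f|Θ|)`, `θ̇ = u` (that is `ż = i u z`),
`u̇ = -u v (f' + 1/(2fΘ))`. -/
def vectorField (γ β : ℝ) (x : Phase) : Phase :=
  let (r, v, z, u) := x
  (v * S.f r,
    u ^ 2 * S.df r - v ^ 2 / (2 * S.fTheta β r) - γ / |S.fTheta β r|,
    Complex.I * (u : ℂ) * z,
    -(u * v * (S.df r + 1 / (2 * S.fTheta β r))))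

/-- The energy manifold `M(h)`: `r ∈ [rN, rS]` and `sgn(Θ)(u² + v²)/2 + γ = h/Θ`. The relation makes
sense for `Θ ≠ 0`, i.e. `f'(r) ≠ 0`, and extends to the poles, where `1/Θ = 0`; the sign of `Θ` is
that of `fΘ`. -/
def energyManifold (γ β h : ℝ) : Set Phase :=
  {(r, v, z, u) : Phase | r ∈ Icc S.rN S.rS ∧ S.df r ≠ 0 ∧ ‖z‖ = 1 ∧
    (SignType.sign (S.fTheta β r) : ℝ) * ((u ^ 2 + v ^ 2) / 2) + γ = h * S.invTheta β r}

/-- The collision manifold `N`. -/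
def collisionManifold (γ β h : ℝ) : Set Phase :=
  {x ∈ S.energyManifold γ β h | x.1 = S.rN}

/-- The set `B(h, δ) = {x ∈ M(h) | 1/|Θ(r)| ≤ δ}`. -/
def block (γ β h δ : ℝ) : Set Phase :=
  {x ∈ S.energyManifold γ β h | |S.invTheta β x.1| ≤ δ}

/-- First generalized Runge–Lenz integral, in the coordinates `(r, v, θ, u)`. -/
def rungeLenz₁ (γ β r v θ u : ℝ) : ℝ :=
  Real.sin (β * θ) * |S.Theta β r| * S.f r * u * v
    - β * Real.cos (β * θ) * S.Theta β r * |S.Theta β r| * S.f r ^ 2 * u ^ 2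
    - γ / β * Real.cos (β * θ)

/-- Second generalized Runge–Lenz integral, in the coordinates `(r, v, θ, u)`. -/
def rungeLenz₂ (γ β r v θ u : ℝ) : ℝ :=
  -Real.cos (β * θ) * |S.Theta β r| * S.f r * u * v
    - β * Real.sin (β * θ) * S.Theta β r * |S.Theta β r| * S.f r ^ 2 * u ^ 2
    - γ / β * Real.sin (β * θ)

/-- The norm `√(I₁² + I₂²)` of the Runge–Lenz vector. -/
def rungeLenzNorm (γ β r v θ u : ℝ) : ℝ :=
  √(S.rungeLenz₁ γ β r v θ u ^ 2 + S.rungeLenz₂ γ β r v θ u ^ 2)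

end SphericalSurface

/-- With `c² = 2γ + 2hδ` and `k₁ = |Θ| f` on the boundary of the block, the quotient
`(γ/|β| - |β| k₁² u²) / √(k₁² (c² - u²) u² + (γ/|β| - |β| k₁² u²)²)`,
which is the sine of the phase `|β| ζ(u)`. -/
def sinPhase (γ β h δ k₁ u : ℝ) : ℝ :=
  (γ / |β| - |β| * k₁ ^ 2 * u ^ 2) /
    √(k₁ ^ 2 * (2 * γ + 2 * h * δ - u ^ 2) * u ^ 2 + (γ / |β| - |β| * k₁ ^ 2 * u ^ 2) ^ 2)

/-- The phase `ζ(u)` of the Runge–Lenz vector on `b⁺`: the continuous branch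
with `|β| ζ ∈ [-π/2, π/2]` for `u ≤ 0` and `|β| ζ ∈ [π/2, 3π/2]` for `u > 0`. -/
def zeta (γ β h δ k₁ u : ℝ) : ℝ :=
  if u ≤ 0 then Real.arcsin (sinPhase γ β h δ k₁ u) / |β|
  else (Real.pi - Real.arcsin (sinPhase γ β h δ k₁ u)) / |β|

/-- The angle `Γ̃(u)` by which `θ` increases across the block. -/
def GammaTilde (γ β h δ k₁ u : ℝ) : ℝ :=
  if u ≤ 0 then -2 * zeta γ β h δ k₁ u - Real.pi / |β|
  else -2 * zeta γ β h δ k₁ u - Real.pi / |β| + 4 * Real.pi / |β|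

/-- The map `(r, v, θ, u) ↦ (r, -v, θ + Γ(u), u)`, where `z = exp(iθ)`. -/
def reflectRotate (Γ : ℝ → ℝ) (x : Phase) : Phase :=
  let (r, v, z, u) := x
  (r, -v, z * Complex.exp ((Γ u : ℂ) * Complex.I), u)

end

end KeplerBlock

open KeplerBlock

/-! Constant curvature forces f = (b/a) sin(a(r - rN)) with a = √K and b = |β|
(`isRound_of_constantCurvature`). On the half f' > 0 the coordinate E = tan(a(r - rN)) satisfies 1/Θ
= -(b²/a)E, so the collision pole is E = 0 and, for small δ, the block is E ≤ E₀ and does not meet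
f' < 0.

The problem is then integrated as Kepler's is. An orbit with u ≠ 0 obeys a conic equation L²/E = γ -
D cos η, where L is the absolute angular momentum, D is b times the length of the Runge–Lenz vector,
and the phase η advances like sign(u)·bθ (`hasDerivAt_orbit`). Membership in the block is an
inequality on cos η, so a passage is a phase interval symmetric about the pericentre η = π
(`exists_transit`). An orbit entering at phase η leaves at 2π - η, with u restored, v reversed and θ
turned by sign(u)(2π - 2η)/b. Orbits with u = 0 approach the pole in one time direction and leave
the block in the other (`exists_radial`), and the pole carries an explicit invariant flow
(`exists_collision_curve`). Hence only the collision manifold stays in the block for all times, and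
a⁺ is the set u = 0 in b⁺. The inequality `tangency_pos` makes tangent orbits touch the block from
outside and keeps the Runge–Lenz vector nonzero on the boundary (`lenz_pos`).

It remains to cross u = 0. There η tends to 0 and the turning angle jumps by 4π/b, which is a
multiple of 2π when b = 2/m. More precisely, with X = γ - u²/(1 + E₀²) and Y = uv/√(1 + E₀²), the
rotation equals (-(X + iY)/D)^m on b⁺ (`reflectRotate_eq_blockMap`), which is smooth because D =
√(X² + Y²) does not vanish. The resulting map is an involution up to exchanging b⁺ and b⁻
(`blockMap_blockMap`), hence a diffeomorphism, and it is the only extension because u ≠ 0 is dense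
in b⁺ (`isDiffeoExtension_unique`). -/

namespace KeplerBlock

/-! ### Profiles of constant curvature are sines. -/

namespace SphericalSurface

/-- The profile of a surface with constant curvature `a²` and parameter `b`. -/
structure IsRound (S : SphericalSurface) (a b : ℝ) : Prop where
  a_pos : 0 < a
  b_pos : 0 < b
  f_eq : ∀ r ∈ Icc S.rN S.rS, S.f r = b / a * Real.sin (a * (r - S.rN))
  df_eq : ∀ r ∈ Icc S.rN S.rS, S.df r = b * Real.cos (a * (r - S.rN))
  length : S.rS = S.rN + Real.pi / a

/-- The equation f'' = -a²f says that (f', af), turned by the angle a(r - rN), is constant. The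
parameter relation gives the value at the pole up to sign, positivity of f gives the sign, and the
second zero of f gives the length. -/
theorem isRound_of_constantCurvature {S : SphericalSurface} {K β : ℝ} (hK : 0 < K)
    (hcurv : S.HasConstantCurvature K) (hpar : S.HasParameter β) (hβ : β ≠ 0) :
    S.IsRound (√K) |β| := by
  set a := √K with ha
  have ha0 : 0 < a := Real.sqrt_pos.2 hK
  have haa : a ^ 2 = K := Real.sq_sqrt hK.le
  have hlt := S.lt
  have hud : UniqueDiffOn ℝ (Icc S.rN S.rS) := uniqueDiffOn_Icc hlt
  have hdf : ContDiffOn ℝ ∞ S.df (Icc S.rN S.rS) :=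
    S.smooth_f.derivWithin hud (by simp)
  have hf' : ∀ r ∈ Icc S.rN S.rS, HasDerivWithinAt S.f (S.df r) (Icc S.rN S.rS) r :=
    fun r hr => ((S.smooth_f.differentiableOn (by simp)) r hr).hasDerivWithinAt
  have hdf' : ∀ r ∈ Icc S.rN S.rS, HasDerivWithinAt S.df (S.ddf r) (Icc S.rN S.rS) r :=
    fun r hr => ((hdf.differentiableOn (by simp)) r hr).hasDerivWithinAt
  have hdd : ∀ r ∈ Ioo S.rN S.rS, S.ddf r = -(a ^ 2 * S.f r) := by
    intro r hr
    have h1 := hcurv r hr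
    have h2 := S.f_ne_zero hr
    rw [haa, ← h1]
    field_simp
  have hfa : ∀ r ∈ Ioo S.rN S.rS, HasDerivAt S.f (S.df r) r := fun r hr =>
    (hf' r (Ioo_subset_Icc_self hr)).hasDerivAt (Icc_mem_nhds hr.1 hr.2)
  have hdfa : ∀ r ∈ Ioo S.rN S.rS, HasDerivAt S.df (-(a ^ 2 * S.f r)) r := fun r hr => by
    rw [← hdd r hr]
    exact (hdf' r (Ioo_subset_Icc_self hr)).hasDerivAt (Icc_mem_nhds hr.1 hr.2)
  have hfc : ContinuousOn S.f (Icc S.rN S.rS) := S.smooth_f.continuousOn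
  have hdfc : ContinuousOn S.df (Icc S.rN S.rS) := hdf.continuousOn
  have hN : S.rN ∈ Icc S.rN S.rS := left_mem_Icc.2 hlt.le
  have hfN : S.f S.rN = 0 := (S.zero_iff _ hN).2 (Or.inl rfl)
  have hfS : S.f S.rS = 0 := (S.zero_iff _ (right_mem_Icc.2 hlt.le)).2 (Or.inr rfl)
  have hlin : ∀ r : ℝ, HasDerivAt (fun r => a * (r - S.rN)) a r := fun r => by
    simpa using ((hasDerivAt_id r).sub_const S.rN).const_mul a
  have hsin : ∀ r : ℝ, HasDerivAt (fun r => Real.sin (a * (r - S.rN)))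
      (Real.cos (a * (r - S.rN)) * a) r := fun r => (hlin r).sin
  have hcos : ∀ r : ℝ, HasDerivAt (fun r => Real.cos (a * (r - S.rN)))
      (-Real.sin (a * (r - S.rN)) * a) r := fun r => (hlin r).cos
  have hconst : ∀ F : ℝ → ℝ, ContinuousOn F (Icc S.rN S.rS) →
      (∀ r ∈ Ioo S.rN S.rS, HasDerivAt F 0 r) → ∀ r ∈ Icc S.rN S.rS, F r = F S.rN := by
    intro F hF hF' r hr
    rcases hr.1.eq_or_lt with h | h
    · rw [← h]
    obtain ⟨x, hx, h1⟩ := exists_hasDerivAt_eq_slope F (fun _ => 0) h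
      (hF.mono (Icc_subset_Icc_right hr.2)) (fun x hx => hF' x ⟨hx.1, hx.2.trans_le hr.2⟩)
    have h2 : F r - F S.rN = 0 := by
      rw [eq_comm, div_eq_zero_iff] at h1
      exact h1.resolve_right (by linarith)
    linarith
  have hsc : Continuous fun r => Real.sin (a * (r - S.rN)) := by fun_prop
  have hcc : Continuous fun r => Real.cos (a * (r - S.rN)) := by fun_prop
  have hP := hconst (fun r => S.df r * Real.cos (a * (r - S.rN)) +
      a * S.f r * Real.sin (a * (r - S.rN)))
    ((hdfc.mul hcc.continuousOn).add ((continuousOn_const.mul hfc).mul hsc.continuousOn))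
    (fun r hr => by
      refine (((hdfa r hr).mul (hcos r)).add (((hfa r hr).const_mul a).mul (hsin r))).congr_deriv ?_
      ring)
  have hQ := hconst (fun r => S.df r * Real.sin (a * (r - S.rN)) -
      a * S.f r * Real.cos (a * (r - S.rN)))
    ((hdfc.mul hsc.continuousOn).sub ((continuousOn_const.mul hfc).mul hcc.continuousOn))
    (fun r hr => by
      refine (((hdfa r hr).mul (hsin r)).sub (((hfa r hr).const_mul a).mul (hcos r))).congr_deriv ?_
      ring)
  set p := S.df S.rN with hp
  simp only [hfN, sub_self, mul_zero, Real.cos_zero, Real.sin_zero, mul_one, add_zero]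
    at hP hQ
  have hdfe : ∀ r ∈ Icc S.rN S.rS, S.df r = p * Real.cos (a * (r - S.rN)) := by
    intro r hr
    linear_combination Real.cos (a * (r - S.rN)) * hP r hr + Real.sin (a * (r - S.rN)) * hQ r hr -
      S.df r * Real.sin_sq_add_cos_sq (a * (r - S.rN))
  have hfe : ∀ r ∈ Icc S.rN S.rS, a * S.f r = p * Real.sin (a * (r - S.rN)) := by
    intro r hr
    linear_combination Real.sin (a * (r - S.rN)) * hP r hr - Real.cos (a * (r - S.rN)) * hQ r hr -
      a * S.f r * Real.sin_sq_add_cos_sq (a * (r - S.rN))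
  have hfpos : ∀ r ∈ Ioo S.rN S.rS, 0 < S.f r := fun r hr =>
    lt_of_le_of_ne (S.nonneg r (Ioo_subset_Icc_self hr)) (S.f_ne_zero hr).symm
  have hpp : p ^ 2 = β ^ 2 := by
    have hm : (S.rN + S.rS) / 2 ∈ Ioo S.rN S.rS := ⟨by linarith, by linarith⟩
    have h1 := hpar _ hm
    rw [hdd _ hm] at h1
    have h2 := hfe _ (Ioo_subset_Icc_self hm)
    have h3 := hdfe _ (Ioo_subset_Icc_self hm)
    have h4 := Real.sin_sq_add_cos_sq (a * ((S.rN + S.rS) / 2 - S.rN))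
    calc p ^ 2 = (p * Real.sin (a * ((S.rN + S.rS) / 2 - S.rN))) ^ 2 +
          (p * Real.cos (a * ((S.rN + S.rS) / 2 - S.rN))) ^ 2 := by
            linear_combination -p ^ 2 * h4
      _ = β ^ 2 := by rw [← h2, ← h3, ← h1]; ring
  -- A point close enough to rN has a(r - rN) in (0, π), where f and the sine are both positive.
  have hp0 : 0 < p := by
    set s := min ((S.rN + S.rS) / 2) (S.rN + 1 / a) with hs
    have h1a : 0 < 1 / a := by positivity
    have hs1 : S.rN < s := lt_min (by linarith) (by linarith)
    have hs2 : s < S.rS := (min_le_left _ _).trans_lt (by linarith)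
    have hs3 : a * (s - S.rN) ≤ 1 := by
      have : s ≤ S.rN + 1 / a := min_le_right _ _
      calc a * (s - S.rN) ≤ a * (1 / a) := by gcongr; linarith
        _ = 1 := by field_simp
    have h1 := hfe s ⟨hs1.le, hs2.le⟩
    have h2 := hfpos s ⟨hs1, hs2⟩
    have h3 : 0 < Real.sin (a * (s - S.rN)) :=
      Real.sin_pos_of_pos_of_lt_pi (mul_pos ha0 (by linarith))
        (hs3.trans_lt (by linarith [Real.pi_gt_three]))
    have h4 : 0 < p * Real.sin (a * (s - S.rN)) := h1 ▸ mul_pos ha0 h2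
    exact pos_of_mul_pos_left h4 h3.le
  have hpb : p = |β| := by
    rw [← abs_of_pos hp0]; exact (sq_eq_sq_iff_abs_eq_abs _ _).1 hpp
  refine ⟨ha0, abs_pos.2 hβ, fun r hr => ?_, fun r hr => ?_, ?_⟩
  · rw [← hpb]
    have := hfe r hr
    field_simp
    linarith
  · rw [← hpb]; exact hdfe r hr
  · have h1 := hfe _ (right_mem_Icc.2 hlt.le)
    rw [hfS, mul_zero, eq_comm, mul_eq_zero, or_iff_right hp0.ne'] at h1
    have hpi := Real.pi_pos
    have h2 : ¬ Real.pi < a * (S.rS - S.rN) := by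
      intro hh
      have h3 : S.rN + Real.pi / a ∈ Ioo S.rN S.rS := by
        refine ⟨by have : 0 < Real.pi / a := by positivity
                   linarith, ?_⟩
        have : Real.pi / a < S.rS - S.rN := by rw [div_lt_iff₀ ha0]; linarith
        linarith
      have h4 := hfe _ (Ioo_subset_Icc_self h3)
      have h5 : a * (S.rN + Real.pi / a - S.rN) = Real.pi := by field_simp; ring
      rw [h5, Real.sin_pi, mul_zero] at h4
      exact (mul_pos ha0 (hfpos _ h3)).ne' h4
    have h3 : ¬ a * (S.rS - S.rN) < Real.pi := fun hh =>
      (Real.sin_pos_of_pos_of_lt_pi (mul_pos ha0 (by linarith)) hh).ne' h1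
    have h4 : a * (S.rS - S.rN) = Real.pi := le_antisymm (not_lt.1 h2) (not_lt.1 h3)
    rw [← h4]; field_simp; ring

/-! ### The coordinate E = tan(a(r - rN)) on the half f' > 0. -/

/-- The radius at which `tan (a (r - rN))` equals `E`. -/
noncomputable def radius (S : SphericalSurface) (a E : ℝ) : ℝ := S.rN + Real.arctan E / a

namespace IsRound

variable {S : SphericalSurface} {a b : ℝ}

theorem radius_zero : S.radius a 0 = S.rN := by simp [radius]

theorem angle_radius (hS : S.IsRound a b) (E : ℝ) :
    a * (S.radius a E - S.rN) = Real.arctan E := by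
  have := hS.a_pos
  unfold radius
  field_simp
  ring

theorem radius_strictMono (hS : S.IsRound a b) : StrictMono (S.radius a) := fun x y h => by
  have := hS.a_pos
  have := Real.arctan_strictMono h
  unfold radius
  gcongr

theorem continuous_radius : Continuous (S.radius a) := by
  unfold radius
  exact continuous_const.add (Real.continuous_arctan.div_const a)

theorem radius_lt_rS (hS : S.IsRound a b) (E : ℝ) : S.radius a E < S.rS := by
  have ha := hS.a_pos
  rw [hS.length, radius]
  have := Real.arctan_lt_pi_div_two E
  have := Real.pi_pos
  gcongr
  linarith

theorem radius_mem (hS : S.IsRound a b) {E : ℝ} (hE : 0 ≤ E) :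
    S.radius a E ∈ Icc S.rN S.rS := by
  refine ⟨?_, (hS.radius_lt_rS E).le⟩
  rw [← radius_zero (S := S) (a := a)]
  exact hS.radius_strictMono.monotone hE

theorem radius_mem_Ioo (hS : S.IsRound a b) {E : ℝ} (hE : 0 < E) :
    S.radius a E ∈ Ioo S.rN S.rS := by
  refine ⟨?_, hS.radius_lt_rS E⟩
  conv_lhs => rw [← radius_zero (S := S) (a := a)]
  exact hS.radius_strictMono hE

theorem f_radius (hS : S.IsRound a b) {E : ℝ} (hE : 0 ≤ E) :
    S.f (S.radius a E) = b / a * (E / √(1 + E ^ 2)) := by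
  rw [hS.f_eq _ (hS.radius_mem hE), hS.angle_radius, Real.sin_arctan]

theorem df_radius (hS : S.IsRound a b) {E : ℝ} (hE : 0 ≤ E) :
    S.df (S.radius a E) = b / √(1 + E ^ 2) := by
  rw [hS.df_eq _ (hS.radius_mem hE), hS.angle_radius, Real.cos_arctan]
  ring

theorem df_radius_pos (hS : S.IsRound a b) {E : ℝ} (hE : 0 ≤ E) :
    0 < S.df (S.radius a E) := by
  have := hS.b_pos
  rw [hS.df_radius hE]; positivity

theorem fTheta_radius (hS : S.IsRound a b) {β : ℝ} (hβ : β ^ 2 = b ^ 2) {E : ℝ} (hE : 0 ≤ E) :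
    S.fTheta β (S.radius a E) = -(1 / (b * √(1 + E ^ 2))) := by
  have := hS.b_pos
  rw [fTheta, hS.df_radius hE, hβ]
  field_simp

theorem invTheta_radius (hS : S.IsRound a b) {β : ℝ} (hβ : β ^ 2 = b ^ 2) {E : ℝ} (hE : 0 ≤ E) :
    S.invTheta β (S.radius a E) = -(b ^ 2 / a * E) := by
  have := hS.b_pos
  have := hS.a_pos
  rw [invTheta, hS.df_radius hE, hS.f_radius hE, hβ]
  field_simp

theorem exists_radius (hS : S.IsRound a b) {r : ℝ} (hr : r ∈ Icc S.rN S.rS) (hd : 0 < S.df r) :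
    ∃ E, 0 ≤ E ∧ r = S.radius a E := by
  have ha := hS.a_pos
  rw [hS.df_eq r hr] at hd
  have hc : 0 < Real.cos (a * (r - S.rN)) := pos_of_mul_pos_right hd hS.b_pos.le
  have h0 : 0 ≤ a * (r - S.rN) := mul_nonneg ha.le (by linarith [hr.1])
  have h1 : a * (r - S.rN) ≤ Real.pi := by
    have h2 : r - S.rN ≤ Real.pi / a := by linarith [hr.2, hS.length]
    calc a * (r - S.rN) ≤ a * (Real.pi / a) := by gcongr
      _ = Real.pi := by field_simp
  have h2 : a * (r - S.rN) < Real.pi / 2 := by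
    by_contra hh
    exact (Real.cos_nonpos_of_pi_div_two_le_of_le (not_lt.1 hh) (by linarith)).not_gt hc
  refine ⟨Real.tan (a * (r - S.rN)), Real.tan_nonneg_of_nonneg_of_le_pi_div_two h0 h2.le, ?_⟩
  rw [radius, Real.arctan_tan (by linarith [Real.pi_pos]) h2]
  field_simp
  ring

theorem vectorField_radius (hS : S.IsRound a b) {β : ℝ} (hβ : β ^ 2 = b ^ 2) (γ : ℝ) {E : ℝ}
    (hE : 0 ≤ E) (v : ℝ) (z : ℂ) (u : ℝ) :
    S.vectorField γ β (S.radius a E, v, z, u) =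
      (v * (b / a * (E / √(1 + E ^ 2))),
        u ^ 2 * (b / √(1 + E ^ 2)) + (v ^ 2 / 2 - γ) * (b * √(1 + E ^ 2)),
        Complex.I * (u : ℂ) * z,
        -(u * v * (b / √(1 + E ^ 2) - b * √(1 + E ^ 2) / 2))) := by
  have hb := hS.b_pos
  have hq : 0 < √(1 + E ^ 2) := by positivity
  have h3 : |S.fTheta β (S.radius a E)| = 1 / (b * √(1 + E ^ 2)) := by
    rw [hS.fTheta_radius hβ hE, abs_neg, abs_of_pos (by positivity)]
  simp only [vectorField]
  rw [h3, hS.fTheta_radius hβ hE, hS.f_radius hE, hS.df_radius hE]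
  congr 1
  congr 1
  · generalize √(1 + E ^ 2) = q at *
    field_simp
    ring
  congr 1
  generalize √(1 + E ^ 2) = q at *
  field_simp
  ring

/-- The sign of Θ is -1 on this half, so the energy relation becomes a circle in (u, v) whose
squared radius is affine in E and equals 2γ at the pole. -/
theorem mem_energyManifold_radius (hS : S.IsRound a b) {β : ℝ} (hβ : β ^ 2 = b ^ 2) {γ h : ℝ}
    {E : ℝ} (hE : 0 ≤ E) {v : ℝ} {z : ℂ} {u : ℝ} :
    (S.radius a E, v, z, u) ∈ S.energyManifold γ β h ↔
      ‖z‖ = 1 ∧ u ^ 2 + v ^ 2 = 2 * γ + 2 * h * (b ^ 2 / a * E) := by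
  have hb := hS.b_pos
  have hs : SignType.sign (S.fTheta β (S.radius a E)) = -1 := by
    rw [hS.fTheta_radius hβ hE]; exact sign_neg (neg_neg_of_pos (by positivity))
  simp only [energyManifold, mem_ofPred_eq, hS.radius_mem hE, (hS.df_radius_pos hE).ne', hs,
    hS.invTheta_radius hβ hE, ne_eq, not_false_iff, true_and,
    SignType.coe_neg, SignType.coe_one]
  refine and_congr_right fun _ => ⟨fun h => by linarith, fun h => by linarith⟩

theorem mem_block_radius (hS : S.IsRound a b) {β : ℝ} (hβ : β ^ 2 = b ^ 2) {γ h δ : ℝ}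
    {E : ℝ} (hE : 0 ≤ E) {v : ℝ} {z : ℂ} {u : ℝ} :
    (S.radius a E, v, z, u) ∈ S.block γ β h δ ↔
      (‖z‖ = 1 ∧ u ^ 2 + v ^ 2 = 2 * γ + 2 * h * (b ^ 2 / a * E)) ∧ b ^ 2 / a * E ≤ δ := by
  have hb := hS.b_pos
  have ha := hS.a_pos
  simp only [block, mem_ofPred_eq, hS.mem_energyManifold_radius hβ hE, hS.invTheta_radius hβ hE,
    abs_neg, abs_of_nonneg (show 0 ≤ b ^ 2 / a * E by positivity)]

/-- Points of the block have `f' > 0` when `δ` is small. -/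
theorem exists_radius_of_mem_block (hS : S.IsRound a b) {β : ℝ} {γ h δ : ℝ} (hβ : β ≠ 0)
    (hδ : |h| * δ < γ) {x : Phase} (hx : x ∈ S.block γ β h δ) :
    ∃ E v z u, 0 ≤ E ∧ x = (S.radius a E, v, z, u) := by
  obtain ⟨r, v, z, u⟩ := x
  obtain ⟨⟨hr, hd, hz, he⟩, hle⟩ := hx
  rcases hd.lt_or_gt with hd | hd
  -- Where f' < 0 the energy relation gives γ ≤ h/Θ ≤ |h|δ < γ.
  · exfalso
    have hs : SignType.sign (S.fTheta β r) = 1 := by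
      refine sign_pos ?_
      have : 0 < -S.df r := by linarith
      unfold fTheta; positivity
    rw [hs] at he
    simp only [SignType.coe_one, one_mul] at he
    have h1 : h * S.invTheta β r ≤ |h| * δ := by
      calc h * S.invTheta β r ≤ |h * S.invTheta β r| := le_abs_self _
        _ = |h| * |S.invTheta β r| := abs_mul _ _
        _ ≤ |h| * δ := by gcongr
    nlinarith [sq_nonneg u, sq_nonneg v]
  · obtain ⟨E, hE, rfl⟩ := hS.exists_radius hr hd
    exact ⟨E, v, z, u, hE, rfl⟩

end IsRound

end SphericalSurface

/-! ### Uniqueness of solutions. -/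

section Flow

variable {E : Type*} [NormedAddCommGroup E] [NormedSpace ℝ E] {X : E → E} {M B : Set E}

theorem FlowsTo.of_isIntegralCurveOn {c : ℝ → E} {I : Set ℝ} (hI : I.OrdConnected)
    (hc : IsIntegralCurveOn c (fun _ => X) I) (hM : ∀ s ∈ I, c s ∈ M) {t : ℝ} (h0 : 0 ∈ I)
    (ht : t ∈ I) : FlowsTo X M (c 0) t (c t) :=
  have h := hI.uIcc_subset h0 ht
  ⟨c, hc.mono h, fun s hs => hM s (h hs), rfl, rfl⟩

/-- Grönwall's argument needs a Lipschitz bound only along the two trajectories, and their images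
are compact, connected and share `x`. Asking for no more suits a field that is only locally
Lipschitz. -/
theorem FlowsTo.unique_of_locallyLipschitz
    (hX : ∀ s ⊆ M, IsCompact s → IsPreconnected s → ∀ x ∈ s, ∀ K ⊆ M, IsCompact K →
      IsPreconnected K → x ∈ K → ∃ L, LipschitzOnWith L X (s ∪ K))
    {x y y' : E} {t : ℝ} (h : FlowsTo X M x t y) (h' : FlowsTo X M x t y') : y = y' := by
  obtain ⟨c, hc, hcM, hc0, rfl⟩ := h
  obtain ⟨d, hd, hdM, hd0, rfl⟩ := h'
  have hmem : (0 : ℝ) ∈ uIcc 0 t := left_mem_uIcc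
  obtain ⟨L, hL⟩ := hX (c '' uIcc 0 t) (image_subset_iff.2 hcM)
    (isCompact_uIcc.image_of_continuousOn hc.continuousOn)
    (isPreconnected_uIcc.image _ hc.continuousOn) x ⟨0, hmem, hc0⟩
    (d '' uIcc 0 t) (image_subset_iff.2 hdM)
    (isCompact_uIcc.image_of_continuousOn hd.continuousOn)
    (isPreconnected_uIcc.image _ hd.continuousOn) ⟨0, hmem, hd0⟩
  have hcs : ∀ s ∈ uIcc 0 t, c s ∈ c '' uIcc 0 t ∪ d '' uIcc 0 t :=
    fun s hs => Or.inl (mem_image_of_mem c hs)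
  have hds : ∀ s ∈ uIcc 0 t, d s ∈ c '' uIcc 0 t ∪ d '' uIcc 0 t :=
    fun s hs => Or.inr (mem_image_of_mem d hs)
  rcases le_total 0 t with ht | ht
  · rw [uIcc_of_le ht] at *
    have hr : ∀ {c : ℝ → E}, IsIntegralCurveOn c (fun _ => X) (Icc 0 t) →
        ∀ s ∈ Ico 0 t, HasDerivWithinAt c (X (c s)) (Ici s) s := fun hc s hs =>
      (hc s (Ico_subset_Icc_self hs)).mono_of_mem_nhdsWithin
        (mem_of_superset (Icc_mem_nhdsGE hs.2) (Icc_subset_Icc_left hs.1))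
    exact ODE_solution_unique_of_mem_Icc_right (v := fun _ => X)
      (s := fun _ => c '' Icc 0 t ∪ d '' Icc 0 t)
      (fun _ _ => hL) hc.continuousOn (hr hc)
      (fun s hs => hcs s (Ico_subset_Icc_self hs)) hd.continuousOn (hr hd)
      (fun s hs => hds s (Ico_subset_Icc_self hs)) (hc0.trans hd0.symm) (right_mem_Icc.2 ht)
  · rw [uIcc_of_ge ht] at *
    have hr : ∀ {c : ℝ → E}, IsIntegralCurveOn c (fun _ => X) (Icc t 0) →
        ∀ s ∈ Ioc t 0, HasDerivWithinAt c (X (c s)) (Iic s) s := fun hc s hs =>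
      (hc s (Ioc_subset_Icc_self hs)).mono_of_mem_nhdsWithin
        (mem_of_superset (Icc_mem_nhdsLE hs.1) (Icc_subset_Icc_right hs.2))
    exact ODE_solution_unique_of_mem_Icc_left (v := fun _ => X)
      (s := fun _ => c '' Icc t 0 ∪ d '' Icc t 0)
      (fun _ _ => hL) hc.continuousOn (hr hc)
      (fun s hs => hcs s (Ioc_subset_Icc_self hs)) hd.continuousOn (hr hd)
      (fun s hs => hds s (Ioc_subset_Icc_self hs)) (hc0.trans hd0.symm) (left_mem_Icc.2 ht)

end Flow

namespace SphericalSurface.IsRound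

variable {S : SphericalSurface} {a b : ℝ}

/-- A smooth extension of the vector field across the pole. -/
noncomputable def roundField (rN a b γ : ℝ) (x : Phase) : Phase :=
  (x.2.1 * (b / a * Real.sin (a * (x.1 - rN))),
    x.2.2.2 ^ 2 * (b * Real.cos (a * (x.1 - rN))) +
      (x.2.1 ^ 2 / 2 - γ) * (b / Real.cos (a * (x.1 - rN))),
    Complex.I * (x.2.2.2 : ℂ) * x.2.2.1,
    -(x.2.2.2 * x.2.1 * (b * Real.cos (a * (x.1 - rN)) - b / (2 * Real.cos (a * (x.1 - rN))))))

theorem contDiffAt_roundField (rN a b γ : ℝ) {x : Phase} (hx : Real.cos (a * (x.1 - rN)) ≠ 0) :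
    ContDiffAt ℝ ∞ (roundField rN a b γ) x := by
  have hv : ContDiffAt ℝ ∞ (fun x : Phase => x.2.1) x := by fun_prop
  have hu : ContDiffAt ℝ ∞ (fun x : Phase => x.2.2.2) x := by fun_prop
  have hz : ContDiffAt ℝ ∞ (fun x : Phase => x.2.2.1) x := by fun_prop
  have hl : ContDiffAt ℝ ∞ (fun x : Phase => a * (x.1 - rN)) x := by fun_prop
  have hs := hl.sin
  have hc := hl.cos
  have huc : ContDiffAt ℝ ∞ (fun x : Phase => (x.2.2.2 : ℂ)) x :=
    Complex.ofRealCLM.contDiff.contDiffAt.comp x hu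
  unfold roundField
  refine (hv.mul (contDiffAt_const.mul hs)).prodMk (ContDiffAt.prodMk ?_ (ContDiffAt.prodMk ?_ ?_))
  · exact ((hu.pow 2).mul (contDiffAt_const.mul hc)).add
      ((((hv.pow 2).div_const 2).sub contDiffAt_const).mul (contDiffAt_const.div hc hx))
  · exact (contDiffAt_const.mul huc).mul hz
  · exact ((hu.mul hv).mul ((contDiffAt_const.mul hc).sub
      (contDiffAt_const.div (contDiffAt_const.mul hc) (mul_ne_zero two_ne_zero hx)))).neg

/-- For f' > 0 the absolute value |fΘ| is cos(a(r - rN))/b, which is smooth on both sides of the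
pole. Regularity at the boundary point rN thus comes from an open neighbourhood. -/
theorem vectorField_eq_roundField (hS : S.IsRound a b) {β : ℝ} (hβ : β ^ 2 = b ^ 2) (γ : ℝ)
    {x : Phase} (hr : x.1 ∈ Icc S.rN S.rS) (hd : 0 < S.df x.1) :
    S.vectorField γ β x = roundField S.rN a b γ x := by
  obtain ⟨r, v, z, u⟩ := x
  have hb := hS.b_pos
  have h1 := hS.df_eq r hr
  have h2 := hS.f_eq r hr
  have hc : 0 < Real.cos (a * (r - S.rN)) := by
    change 0 < S.df r at hd
    rw [h1] at hd
    exact pos_of_mul_pos_right hd hb.le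
  have h3 : S.fTheta β r = -(Real.cos (a * (r - S.rN)) / b) := by
    rw [fTheta, h1, hβ]; field_simp
  have h4 : |S.fTheta β r| = Real.cos (a * (r - S.rN)) / b := by
    rw [h3, abs_neg, abs_of_pos (by positivity)]
  simp only [vectorField, roundField]
  rw [h4, h3, h1, h2]
  congr 1
  congr 1
  · generalize Real.cos (a * (r - S.rN)) = q at *
    field_simp
    ring
  congr 1
  generalize Real.cos (a * (r - S.rN)) = q at *
  field_simp
  ring

/-- On M(h) the function f' is continuous and never zero, so by the intermediate value theorem a
connected set cannot pass between its two signs. -/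
theorem df_pos_of_isPreconnected (hS : S.IsRound a b) {γ β h : ℝ} {s : Set Phase}
    (hs : s ⊆ S.energyManifold γ β h) (hc : IsPreconnected s) {x y : Phase} (hx : x ∈ s)
    (hy : y ∈ s) (hd : 0 < S.df x.1) : 0 < S.df y.1 := by
  by_contra hn
  have hcont : ContinuousOn (fun x : Phase => b * Real.cos (a * (x.1 - S.rN))) s := by fun_prop
  have hm : ∀ z ∈ s, S.df z.1 = b * Real.cos (a * (z.1 - S.rN)) := fun z hz =>
    hS.df_eq _ (hs hz).1
  rw [hm y hy] at hn
  rw [hm x hx] at hd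
  obtain ⟨z, hz, hz0⟩ := hc.intermediate_value hy hx hcont ⟨not_lt.1 hn, hd.le⟩
  exact (hs hz).2.1 ((hm z hz).trans hz0)

/-- Solutions starting where `f' > 0` are unique. -/
theorem flowsTo_unique (hS : S.IsRound a b) {β : ℝ} (hβ : β ^ 2 = b ^ 2) {γ h : ℝ}
    {x y y' : Phase} {t : ℝ} (hd : 0 < S.df x.1)
    (h₁ : FlowsTo (S.vectorField γ β) (S.energyManifold γ β h) x t y)
    (h₂ : FlowsTo (S.vectorField γ β) (S.energyManifold γ β h) x t y') : y = y' := by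
  set M := S.energyManifold γ β h ∩ {x | 0 < S.df x.1}
  have hup : ∀ {y}, FlowsTo (S.vectorField γ β) (S.energyManifold γ β h) x t y →
      FlowsTo (S.vectorField γ β) M x t y := by
    rintro y ⟨c, hc, hcM, hc0, hct⟩
    refine ⟨c, hc, fun s hs => ⟨hcM s hs, ?_⟩, hc0, hct⟩
    refine hS.df_pos_of_isPreconnected (s := c '' uIcc 0 t) (image_subset_iff.2 hcM)
      (isPreconnected_uIcc.image _ hc.continuousOn) ⟨0, left_mem_uIcc, hc0⟩
      (mem_image_of_mem c hs) hd
  refine FlowsTo.unique_of_locallyLipschitz ?_ (hup h₁) (hup h₂)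
  intro s hs hsc _ x _ s' hs' hsc' _ _
  have hM : s ∪ s' ⊆ M := union_subset hs hs'
  have hloc : LocallyLipschitzOn (s ∪ s') (roundField S.rN a b γ) := by
    intro x hx
    have hc : Real.cos (a * (x.1 - S.rN)) ≠ 0 := by
      have h1 : S.df x.1 ≠ 0 := (hM hx).1.2.1
      rw [hS.df_eq _ (hM hx).1.1] at h1
      exact right_ne_zero_of_mul h1
    obtain ⟨L, t, ht, hL⟩ := ((contDiffAt_roundField S.rN a b γ hc).of_le
      (by simp : (1 : WithTop ℕ∞) ≤ ∞)).exists_lipschitzOnWith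
    exact ⟨L, t, mem_nhdsWithin_of_mem_nhds ht, hL⟩
  obtain ⟨L, hL⟩ := hloc.exists_lipschitzOnWith_of_compact (hsc.union hsc')
  refine ⟨L, fun x hx y hy => ?_⟩
  rw [hS.vectorField_eq_roundField hβ γ (hM hx).1.1 (hM hx).2,
    hS.vectorField_eq_roundField hβ γ (hM hy).1.1 (hM hy).2]
  exact hL hx hy

end SphericalSurface.IsRound

/-! ### Time parametrizations and the conic orbits. -/

/-- A scalar autonomous equation with a bounded positive right hand side has global solutions, and
these are increasing bijections of the line. -/
theorem exists_orderIso_hasDerivAt {G : ℝ → ℝ} (hG : Continuous G) (hpos : ∀ x, 0 < G x) {C : ℝ}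
    (hC : ∀ x, G x ≤ C) (x₀ : ℝ) :
    ∃ y : ℝ ≃o ℝ, y 0 = x₀ ∧ ∀ t, HasDerivAt y (G (y t)) t := by
  have hC0 : 0 < C := (hpos 0).trans_le (hC 0)
  have hGi : Continuous fun x => (G x)⁻¹ := hG.inv₀ fun x => (hpos x).ne'
  -- T is the time needed to reach x from x₀; the solution is its inverse.
  set T : ℝ → ℝ := fun x => ∫ s in x₀..x, (G s)⁻¹ with hT
  have hT' : ∀ x, HasDerivAt T (G x)⁻¹ x := fun x => hGi.integral_hasStrictDerivAt x₀ x |>.hasDerivAt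
  have hTc : Continuous T := continuous_iff_continuousAt.2 fun x => (hT' x).continuousAt
  have hmono : StrictMono T := strictMono_of_deriv_pos fun x => by
    rw [(hT' x).deriv]; exact inv_pos.2 (hpos x)
  -- The bound G ≤ C keeps the slope of T at least 1/C, so T is onto and the solution does not blow
  -- up.
  have hm : Monotone fun x => T x - x / C := by
    have hd : ∀ x, HasDerivAt (fun x => T x - x / C) ((G x)⁻¹ - 1 / C) x := fun x =>
      (hT' x).sub ((hasDerivAt_id x).div_const C)
    refine monotone_of_deriv_nonneg (fun x => (hd x).differentiableAt) fun x => ?_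
    rw [(hd x).deriv, one_div, sub_nonneg]
    exact inv_anti₀ (hpos x) (hC x)
  have hlin : Tendsto (fun x : ℝ => x / C) atTop atTop := tendsto_id.atTop_div_const hC0
  have hlin' : Tendsto (fun x : ℝ => x / C) atBot atBot := tendsto_id.atBot_div_const hC0
  have htop : Tendsto T atTop atTop := by
    refine tendsto_atTop_mono' _ ?_ (tendsto_atTop_add_const_left _ (T 0 - 0 / C) hlin)
    filter_upwards [eventually_ge_atTop 0] with x hx
    have := hm hx
    simp only at this
    linarith
  have hbot : Tendsto T atBot atBot := by
    refine tendsto_atBot_mono' _ ?_ (tendsto_atBot_add_const_left _ (T 0 - 0 / C) hlin')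
    filter_upwards [eventually_le_atBot 0] with x hx
    have := hm hx
    simp only at this
    linarith
  have hsurj : Function.Surjective T := hTc.surjective htop hbot
  set e := hmono.orderIsoOfSurjective T hsurj with he
  have heT : ∀ x, e x = T x := fun x => rfl
  refine ⟨e.symm, ?_, fun t => ?_⟩
  · rw [OrderIso.symm_apply_eq, heT, hT]
    simp
  · have h1 := (hT' (e.symm t)).of_local_left_inverse e.symm.continuous.continuousAt
      (inv_pos.2 (hpos _)).ne' (Eventually.of_forall fun y => e.apply_symm_apply y)
    rwa [inv_inv] at h1

namespace SphericalSurface.IsRound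

variable {S : SphericalSurface} {a b : ℝ}

/-- Orbits with nonzero angular momentum `σ L`, parametrized by the phase of the Runge–Lenz
vector. -/
noncomputable def orbit (S : SphericalSurface) (a b γ L D σ : ℝ) (z₀ : ℂ) (η₀ η : ℝ) : Phase :=
  (S.radius a (((γ - D * Real.cos η) / L ^ 2)⁻¹),
    -(D * Real.sin η / (L * √((γ - D * Real.cos η) / L ^ 2))),
    z₀ * Complex.exp (((σ * (η - η₀) / b : ℝ) : ℂ) * Complex.I),
    σ * (L * √(1 + ((γ - D * Real.cos η) / L ^ 2) ^ 2) / √((γ - D * Real.cos η) / L ^ 2)))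

theorem sqrt_one_add_inv_sq {ρ : ℝ} (hρ : 0 < ρ) : √(1 + ρ⁻¹ ^ 2) = √(1 + ρ ^ 2) / ρ := by
  rw [show 1 + ρ⁻¹ ^ 2 = (1 + ρ ^ 2) / ρ ^ 2 by field_simp; ring, Real.sqrt_div (by positivity),
    Real.sqrt_sq hρ.le]

theorem hasDerivAt_radius {E : ℝ → ℝ} {E' t : ℝ} (h : HasDerivAt E E' t) :
    HasDerivAt (fun t => S.radius a (E t)) (E' / (1 + E t ^ 2) / a) t := by
  have := ((h.arctan).div_const a).const_add S.rN
  refine this.congr_deriv ?_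
  ring

theorem hasDerivAt_rotate {θ : ℝ → ℝ} {θ' t : ℝ} (z₀ : ℂ) (h : HasDerivAt θ θ' t) :
    HasDerivAt (fun t => z₀ * Complex.exp ((θ t : ℂ) * Complex.I))
      (Complex.I * (θ' : ℂ) * (z₀ * Complex.exp ((θ t : ℂ) * Complex.I))) t := by
  refine (((h.ofReal_comp.mul_const Complex.I).cexp).const_mul z₀).congr_deriv ?_
  ring

/-- The prescribed phase speed is σbu, forced by θ = σ(η - η₀)/b and θ' = u. With s = √ρ and q = √(1
+ ρ²), every component is then a rational identity in s and q modulo q² = 1 + s⁴ and the conic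
equation. -/
theorem hasDerivAt_orbit (hS : S.IsRound a b) {β : ℝ} (hβ : β ^ 2 = b ^ 2) {γ L D σ : ℝ} {z₀ : ℂ}
    {η₀ : ℝ} (hL : 0 < L) (hσ : σ ^ 2 = 1) {η : ℝ → ℝ} {t : ℝ}
    (hρ : 0 < (γ - D * Real.cos (η t)) / L ^ 2)
    (hη : HasDerivAt η (b * L * √(1 + ((γ - D * Real.cos (η t)) / L ^ 2) ^ 2) /
      √((γ - D * Real.cos (η t)) / L ^ 2)) t) :
    HasDerivAt (fun t => orbit S a b γ L D σ z₀ η₀ (η t))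
      (S.vectorField γ β (orbit S a b γ L D σ z₀ η₀ (η t))) t := by
  have ha := hS.a_pos
  have hb := hS.b_pos
  set R : ℝ → ℝ := fun t => (γ - D * Real.cos (η t)) / L ^ 2 with hR
  set ρ := (γ - D * Real.cos (η t)) / L ^ 2 with hρ'
  have hRt : R t = ρ := rfl
  set s := √ρ with hs
  set q := √(1 + ρ ^ 2) with hq
  have hs0 : 0 < s := Real.sqrt_pos.2 hρ
  have hq0 : 0 < q := Real.sqrt_pos.2 (by positivity)
  have hss : ρ = s ^ 2 := (Real.sq_sqrt hρ.le).symm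
  have hqq : q ^ 2 = 1 + s ^ 4 := by rw [hq, Real.sq_sqrt (by positivity), hss]; ring
  have hcos : D * Real.cos (η t) = γ - L ^ 2 * s ^ 2 := by rw [← hss, hρ']; field_simp; ring
  set w := Real.sin (η t) with hw
  have hR' : HasDerivAt R (D * w * (b * L * q / s) / L ^ 2) t := by
    refine (((hη.cos.const_mul D).const_sub γ).div_const (L ^ 2)).congr_deriv ?_
    rw [hw]; ring
  have hs' : HasDerivAt (fun t => √(R t)) (D * w * (b * L * q / s) / L ^ 2 / (2 * s)) t :=
    hR'.sqrt hρ.ne'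
  have hq' : HasDerivAt (fun t => √(1 + R t ^ 2))
      (ρ * (D * w * (b * L * q / s) / L ^ 2) / q) t := by
    refine (((hR'.fun_pow 2).const_add 1).sqrt (by positivity)).congr_deriv ?_
    rw [hRt, ← hq]
    field_simp
    norm_num
    ring
  have hE := (hS.vectorField_radius hβ γ (inv_nonneg.2 hρ.le)
    (-(D * w / (L * s))) (z₀ * Complex.exp (((σ * (η t - η₀) / b : ℝ) : ℂ) * Complex.I))
    (σ * (L * q / s)))
  rw [sqrt_one_add_inv_sq hρ, ← hq] at hE
  change HasDerivAt (fun t => (S.radius a ((R t)⁻¹), -(D * Real.sin (η t) / (L * √(R t))),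
    z₀ * Complex.exp (((σ * (η t - η₀) / b : ℝ) : ℂ) * Complex.I),
    σ * (L * √(1 + R t ^ 2) / √(R t)))) (S.vectorField γ β (S.radius a ρ⁻¹, -(D * w / (L * s)),
    z₀ * Complex.exp (((σ * (η t - η₀) / b : ℝ) : ℂ) * Complex.I), σ * (L * q / s))) t
  rw [hE]
  refine HasDerivAt.prodMk ?_ (HasDerivAt.prodMk ?_ (HasDerivAt.prodMk ?_ ?_))
  · refine (hasDerivAt_radius (hR'.inv hρ.ne')).congr_deriv ?_
    simp only [Pi.inv_apply, hRt]
    rw [hss]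
    field_simp
    linear_combination -(D * w) * hqq
  · refine (((hη.sin.const_mul D).div (hs'.const_mul L) (by positivity)).neg).congr_deriv ?_
    simp only [hRt]
    rw [← hs, ← hw]
    have hc : D * (Real.cos (η t) * (b * L * q / s)) = (γ - L ^ 2 * s ^ 2) * (b * L * q / s) := by
      rw [← hcos]; ring
    have hσ' : (σ * (L * q / s)) ^ 2 = (L * q / s) ^ 2 := by rw [mul_pow, hσ, one_mul]
    rw [hc, hss, hσ']
    field_simp
    ring
  · refine hasDerivAt_rotate z₀ ((((hη.sub_const η₀).const_mul σ).div_const b).congr_deriv ?_)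
    field_simp
  · refine (((hq'.const_mul L).div hs' hs0.ne').const_mul σ).congr_deriv ?_
    simp only [hRt]
    rw [← hs, ← hq, hss]
    field_simp

end SphericalSurface.IsRound

/-- The range (0, 2π] replaces that of the principal argument because passages through the block are
phase intervals centred at π. -/
theorem exists_angle {X Y D : ℝ} (hD : 0 < D) (h : X ^ 2 + Y ^ 2 = D ^ 2) :
    ∃ η ∈ Ioc 0 (2 * Real.pi), D * Real.cos η = X ∧ D * Real.sin η = Y := by
  have hn : ‖(⟨X, Y⟩ : ℂ)‖ = D := by
    rw [← abs_of_pos hD, ← abs_of_nonneg (norm_nonneg _), ← sq_eq_sq_iff_abs_eq_abs,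
      ← Complex.normSq_eq_norm_sq, Complex.normSq_mk, ← h]
    ring
  have h0 : (⟨X, Y⟩ : ℂ) ≠ 0 := by
    rw [← norm_pos_iff, hn]; exact hD
  have hc : D * Real.cos (Complex.arg ⟨X, Y⟩) = X := by
    rw [Complex.cos_arg h0, hn]; field_simp
  have hs : D * Real.sin (Complex.arg ⟨X, Y⟩) = Y := by
    rw [Complex.sin_arg, hn]; field_simp
  have h1 := Complex.neg_pi_lt_arg (⟨X, Y⟩ : ℂ)
  have h2 := Complex.arg_le_pi (⟨X, Y⟩ : ℂ)
  rcases lt_or_ge 0 (Complex.arg ⟨X, Y⟩) with h3 | h3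
  · exact ⟨_, ⟨h3, by linarith⟩, hc, hs⟩
  · refine ⟨Complex.arg ⟨X, Y⟩ + 2 * Real.pi, ⟨by linarith, by linarith⟩, ?_, ?_⟩
    · rw [Real.cos_add_two_pi]; exact hc
    · rw [Real.sin_add_two_pi]; exact hs

theorem cos_le_cos_of_mem_Icc {α η : ℝ} (h0 : 0 ≤ α) (h : η ∈ Icc α (2 * Real.pi - α)) :
    Real.cos η ≤ Real.cos α := by
  rcases le_total η Real.pi with h1 | h1
  · exact Real.cos_le_cos_of_nonneg_of_le_pi h0 h1 h.1
  · rw [← Real.cos_two_pi_sub η]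
    exact Real.cos_le_cos_of_nonneg_of_le_pi h0 (by linarith) (by linarith [h.2])

/-! ### Small blocks and the passage of orbits through them. -/

namespace SphericalSurface

/-- The block `B(h, δ)` on a round surface, with `δ` small; `E₀` is the value of `tan (a (r - rN))`
on its boundary. -/
structure IsSmallBlock (S : SphericalSurface) (a b γ β h δ E₀ : ℝ) : Prop where
  round : S.IsRound a b
  β_sq : β ^ 2 = b ^ 2
  γ_pos : 0 < γ
  E_pos : 0 < E₀
  δ_eq : b ^ 2 / a * E₀ = δ
  -- One inequality serves three purposes: it excludes f' < 0, keeps the energy circles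
  -- nondegenerate up to 2E₀, and makes tangencies exterior.
  small : 2 * |h| * δ + γ * E₀ ^ 2 < γ

open IsRound

/-- Eliminating cos η by the conic equation and sin η by sin² + cos² = 1 turns the energy relation
into the stated formula for D², which does not involve the phase. -/
theorem orbit_mem_energyManifold {S : SphericalSurface} {a b : ℝ} (hS : S.IsRound a b) {β : ℝ}
    (hβ : β ^ 2 = b ^ 2) {γ h L D σ : ℝ} {z₀ : ℂ} {η₀ η : ℝ} (hL : 0 < L) (hσ : σ ^ 2 = 1)
    (hz : ‖z₀‖ = 1) (hD : D ^ 2 = γ ^ 2 + 2 * h * (b ^ 2 / a) * L ^ 2 - L ^ 4)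
    (hρ : 0 < (γ - D * Real.cos η) / L ^ 2) :
    orbit S a b γ L D σ z₀ η₀ η ∈ S.energyManifold γ β h := by
  rw [orbit, hS.mem_energyManifold_radius hβ (inv_nonneg.2 hρ.le)]
  set ρ := (γ - D * Real.cos η) / L ^ 2 with hρ'
  refine ⟨by rw [norm_mul, Complex.norm_exp_ofReal_mul_I, hz, one_mul], ?_⟩
  have hcos : D * Real.cos η = γ - L ^ 2 * ρ := by rw [hρ']; field_simp; ring
  have hsin : (D * Real.sin η) ^ 2 = D ^ 2 - (γ - L ^ 2 * ρ) ^ 2 := by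
    rw [← hcos, mul_pow, mul_pow, Real.sin_sq]; ring
  have h1 : (σ * (L * √(1 + ρ ^ 2) / √ρ)) ^ 2 = L ^ 2 * (1 + ρ ^ 2) / ρ := by
    rw [mul_pow, hσ, div_pow, mul_pow, Real.sq_sqrt hρ.le, Real.sq_sqrt (by positivity), one_mul]
  have h2 : (-(D * Real.sin η / (L * √ρ))) ^ 2 = (D ^ 2 - (γ - L ^ 2 * ρ) ^ 2) / (L ^ 2 * ρ) := by
    rw [neg_sq, div_pow, mul_pow L, Real.sq_sqrt hρ.le, hsin]
  rw [h1, h2, hD]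
  generalize b ^ 2 / a = lam
  field_simp
  ring

namespace IsSmallBlock

variable {S : SphericalSurface} {a b γ β h δ E₀ : ℝ}

theorem δ_pos (H : S.IsSmallBlock a b γ β h δ E₀) : 0 < δ := by
  have := H.E_pos
  have := H.round.a_pos
  have := H.round.b_pos
  rw [← H.δ_eq]; positivity

theorem neg_abs_mul_le (H : S.IsSmallBlock a b γ β h δ E₀) {E : ℝ} (hE : 0 ≤ E) (hE' : E ≤ E₀) :
    -(|h| * δ) ≤ h * (b ^ 2 / a * E) := by
  have := H.round.a_pos
  have := H.round.b_pos
  have h1 : b ^ 2 / a * E ≤ δ := by rw [← H.δ_eq]; gcongr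
  have h2 : |h * (b ^ 2 / a * E)| ≤ |h| * δ := by
    rw [abs_mul, abs_of_nonneg (show 0 ≤ b ^ 2 / a * E by positivity)]
    gcongr
  linarith [neg_abs_le (h * (b ^ 2 / a * E))]

theorem energy_pos (H : S.IsSmallBlock a b γ β h δ E₀) {E : ℝ} (hE : 0 ≤ E) (hE' : E ≤ E₀) :
    0 < γ + h * (b ^ 2 / a * E) := by
  have h1 := H.neg_abs_mul_le hE hE'
  have h2 := H.small
  have h3 : 0 ≤ |h| * δ := mul_nonneg (abs_nonneg _) H.δ_pos.le
  have h4 : 0 ≤ γ * E₀ ^ 2 := mul_nonneg H.γ_pos.le (sq_nonneg _)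
  linarith

/-- At a boundary point with v = 0 one has u² = 2γ + 2hδ, so this says u² > γ(1 + E₀²). That is
exactly positivity of v' there: tangent orbits turn outwards on both sides. -/
theorem tangency_pos (H : S.IsSmallBlock a b γ β h δ E₀) : γ * E₀ ^ 2 < γ + 2 * h * δ := by
  have h1 := H.neg_abs_mul_le H.E_pos.le le_rfl
  rw [H.δ_eq] at h1
  have := H.small
  linarith

theorem abs_mul_lt (H : S.IsSmallBlock a b γ β h δ E₀) : |h| * δ < γ := by
  have h2 := H.small
  have h3 : 0 ≤ |h| * δ := mul_nonneg (abs_nonneg _) H.δ_pos.le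
  have h4 : 0 ≤ γ * E₀ ^ 2 := mul_nonneg H.γ_pos.le (sq_nonneg _)
  linarith

theorem mem_block_radius_iff (H : S.IsSmallBlock a b γ β h δ E₀) {E : ℝ} (hE : 0 ≤ E) {v : ℝ}
    {z : ℂ} {u : ℝ} : (S.radius a E, v, z, u) ∈ S.block γ β h δ ↔
      (‖z‖ = 1 ∧ u ^ 2 + v ^ 2 = 2 * γ + 2 * h * (b ^ 2 / a * E)) ∧ E ≤ E₀ := by
  have := H.round.a_pos
  have := H.round.b_pos
  rw [H.round.mem_block_radius H.β_sq hE, ← H.δ_eq, mul_le_mul_iff_right₀ (by positivity)]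

/-- The condition E ≤ E₀ is a lower bound on 1/E, which the conic equation makes affine in cos η. -/
theorem orbit_mem_block_iff (H : S.IsSmallBlock a b γ β h δ E₀) {L D σ : ℝ} {z₀ : ℂ} {η₀ η : ℝ}
    (hL : 0 < L) (hM : orbit S a b γ L D σ z₀ η₀ η ∈ S.energyManifold γ β h)
    (hρ : 0 < (γ - D * Real.cos η) / L ^ 2) :
    orbit S a b γ L D σ z₀ η₀ η ∈ S.block γ β h δ ↔ D * Real.cos η ≤ γ - L ^ 2 / E₀ := by
  have hE := H.E_pos
  unfold orbit at *
  rw [H.mem_block_radius_iff (inv_nonneg.2 hρ.le)]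
  rw [H.round.mem_energyManifold_radius H.β_sq (inv_nonneg.2 hρ.le)] at hM
  rw [and_iff_right hM, inv_le_comm₀ hρ hE, le_div_iff₀ (by positivity)]
  constructor <;> intro hh
  · have : E₀⁻¹ * L ^ 2 = L ^ 2 / E₀ := by ring
    linarith
  · have : E₀⁻¹ * L ^ 2 = L ^ 2 / E₀ := by ring
    linarith

/-- The phase of the Runge–Lenz vector is not locked inside the block. -/
theorem lt_rungeLenz (H : S.IsSmallBlock a b γ β h δ E₀) {L D : ℝ} (hL : 0 < L) (hD0 : 0 ≤ D)
    (hD : D ^ 2 = γ ^ 2 + 2 * h * (b ^ 2 / a) * L ^ 2 - L ^ 4) : γ - L ^ 2 / E₀ < D := by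
  have hE₀ := H.E_pos
  have hγ := H.γ_pos
  rcases lt_or_ge (γ - L ^ 2 / E₀) 0 with hneg | hnn
  · exact hneg.trans_le hD0
  refine lt_of_pow_lt_pow_left₀ 2 hD0 ?_
  rw [hD]
  have h1 : L ^ 2 ≤ γ * E₀ := by rw [← div_le_iff₀ hE₀]; linarith
  have h2 := H.tangency_pos
  rw [← H.δ_eq] at h2
  have h3 : L ^ 2 * (1 + E₀ ^ 2) < 2 * γ * E₀ + 2 * h * (b ^ 2 / a) * E₀ ^ 2 := by
    calc L ^ 2 * (1 + E₀ ^ 2) ≤ γ * E₀ * (1 + E₀ ^ 2) := by gcongr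
      _ = E₀ * (γ + γ * E₀ ^ 2) := by ring
      _ < E₀ * (γ + (γ + 2 * h * (b ^ 2 / a * E₀))) := by gcongr
      _ = _ := by ring
  have h4 : 0 < L ^ 2 * (2 * γ * E₀ + 2 * h * (b ^ 2 / a) * E₀ ^ 2 - L ^ 2 * (1 + E₀ ^ 2)) :=
    mul_pos (by positivity) (by linarith)
  have h5 : γ ^ 2 + 2 * h * (b ^ 2 / a) * L ^ 2 - L ^ 4 - (γ - L ^ 2 / E₀) ^ 2 =
      L ^ 2 * (2 * γ * E₀ + 2 * h * (b ^ 2 / a) * E₀ ^ 2 - L ^ 2 * (1 + E₀ ^ 2)) / E₀ ^ 2 := by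
    generalize b ^ 2 / a = lam
    field_simp
    ring
  have h6 := div_pos h4 (pow_pos hE₀ 2)
  linarith

/-- The time parametrization of an orbit on a range of phases slightly larger than the one spent
in the block. -/
theorem exists_phase (H : S.IsSmallBlock a b γ β h δ E₀) {L D σ : ℝ} (hL : 0 < L) (hDpos : 0 < D)
    (hσ : σ ^ 2 = 1) (z : ℂ) (η₀ : ℝ) {ηb : ℝ} (hb0 : 0 < ηb)
    (hcb : D * Real.cos ηb = γ - L ^ 2 / E₀) :
    ∃ (y : ℝ ≃o ℝ) (ηa : ℝ), y 0 = η₀ ∧ 0 < ηa ∧ ηa < ηb ∧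
      (∀ η ∈ Icc ηa (2 * Real.pi - ηa), 0 < (γ - D * Real.cos η) / L ^ 2) ∧
      ∀ t, y t ∈ Icc ηa (2 * Real.pi - ηa) →
        HasDerivAt (fun t => orbit S a b γ L D σ z η₀ (y t))
          (S.vectorField γ β (orbit S a b γ L D σ z η₀ (y t))) t := by
  have hE₀ := H.E_pos
  have hb := H.round.b_pos
  have hκκ' : γ - L ^ 2 / E₀ < γ - L ^ 2 / (2 * E₀) := by
    have : L ^ 2 / (2 * E₀) < L ^ 2 / E₀ := by
      gcongr
      linarith
    linarith
  -- The level L²/(2E₀) corresponds to E = 2E₀. Stopping short of it leaves room outside the block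
  -- while keeping 1/E bounded away from 0.
  obtain ⟨ηa, ha0, hab, hca⟩ :
      ∃ ηa, 0 < ηa ∧ ηa < ηb ∧ D * Real.cos ηa < γ - L ^ 2 / (2 * E₀) := by
    have h2 : ∀ᶠ x in 𝓝[<] ηb, D * Real.cos x < γ - L ^ 2 / (2 * E₀) :=
      ((continuous_const.mul Real.continuous_cos).continuousAt.eventually_lt continuousAt_const
        (by dsimp only [Pi.mul_apply]; rwa [hcb])).filter_mono nhdsWithin_le_nhds
    have h3 : ∀ᶠ x in 𝓝[<] ηb, x ∈ Ioo 0 ηb := Ioo_mem_nhdsLT hb0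
    obtain ⟨x, hx1, hx2⟩ := (h2.and h3).exists
    exact ⟨x, hx2.1, hx2.2, hx1⟩
  -- Truncating 1/E from below makes the phase speed positive and bounded on the whole line; between
  -- ηa and 2π - ηa the truncation is inactive.
  set R : ℝ → ℝ := fun η => max ((γ - D * Real.cos η) / L ^ 2) (2 * E₀)⁻¹ with hR
  have hRle : ∀ η, R η ≤ max ((γ + D) / L ^ 2) (2 * E₀)⁻¹ := fun η => by
    have := Real.neg_one_le_cos η
    refine max_le_max_right _ ?_
    gcongr
    nlinarith
  have hRge : ∀ η, (2 * E₀)⁻¹ ≤ R η := fun η => le_max_right _ _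
  have hi0 : 0 < (2 * E₀)⁻¹ := by positivity
  have hRpos : ∀ η, 0 < R η := fun η => hi0.trans_le (hRge η)
  have hRc : Continuous R :=
    ((continuous_const.sub (continuous_const.mul Real.continuous_cos)).div_const _).max
      continuous_const
  have hGc : Continuous fun η => b * L * √(1 + R η ^ 2) / √(R η) :=
    (continuous_const.mul ((continuous_const.add (hRc.pow 2)).sqrt)).div hRc.sqrt
      fun η => (Real.sqrt_pos.2 (hRpos η)).ne'
  obtain ⟨y, hy0, hy⟩ := exists_orderIso_hasDerivAt hGc
    (C := b * L * √(1 + max ((γ + D) / L ^ 2) (2 * E₀)⁻¹ ^ 2) / √((2 * E₀)⁻¹))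
    (fun η => by
      have := hRpos η
      positivity)
    (fun η => by
      have := hRle η
      have := hRge η
      have := hRpos η
      gcongr) η₀
  have hρreg : ∀ η ∈ Icc ηa (2 * Real.pi - ηa), (2 * E₀)⁻¹ ≤ (γ - D * Real.cos η) / L ^ 2 := by
    intro η hη
    have h1 : D * Real.cos η ≤ D * Real.cos ηa :=
      mul_le_mul_of_nonneg_left (cos_le_cos_of_mem_Icc ha0.le hη) hDpos.le
    rw [le_div_iff₀ (by positivity), inv_mul_eq_div]
    linarith
  refine ⟨y, ηa, hy0, ha0, hab, fun η hη => hi0.trans_le (hρreg η hη), fun t ht => ?_⟩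
  refine hasDerivAt_orbit H.round H.β_sq hL hσ (hi0.trans_le (hρreg _ ht)) ?_
  have h1 := hy t
  have h2 : R (y t) = (γ - D * Real.cos (y t)) / L ^ 2 := max_eq_left (hρreg _ ht)
  rwa [h2] at h1

/-- With this L, the fibre over E has the prescribed u; only sin η, hence v, depends on which of the
two phases is taken. Used at both the entry and the exit of a passage. -/
theorem orbit_eq {L D σ u E : ℝ} {z : ℂ} {η₀ η : ℝ} (hu : u ≠ 0) (hE : 0 < E)
    (hσu : σ * |u| = u) (hL : L = |u| * √E / √(1 + E ^ 2))
    (hη : (γ - D * Real.cos η) / L ^ 2 = E⁻¹) :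
    orbit S a b γ L D σ z η₀ η = (S.radius a E, -(D * Real.sin η * √(1 + E ^ 2) / |u|),
        z * Complex.exp (((σ * (η - η₀) / b : ℝ) : ℂ) * Complex.I), u) := by
  have hsE : 0 < √E := Real.sqrt_pos.2 hE
  have hqs : 0 < √(1 + E ^ 2) := by positivity
  have hua : 0 < |u| := abs_pos.2 hu
  have hsEE : E = √E ^ 2 := (Real.sq_sqrt hE.le).symm
  rw [orbit, hη, inv_inv, Real.sqrt_inv, sqrt_one_add_inv_sq hE, hL]
  congr 1
  congr 1
  · field_simp
  congr 1
  calc σ * (|u| * √E / √(1 + E ^ 2) * (√(1 + E ^ 2) / E) / (√E)⁻¹)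
      = σ * |u| * (√E ^ 2 / E) := by field_simp
    _ = u := by rw [hσu, ← hsEE]; field_simp

set_option maxHeartbeats 1000000 in
/-- The passage through the block of an orbit with nonzero angular momentum. -/
theorem exists_transit (H : S.IsSmallBlock a b γ β h δ E₀) {E v u : ℝ} {z : ℂ} (hE : 0 < E)
    (hu : u ≠ 0) (hx : (S.radius a E, v, z, u) ∈ S.block γ β h δ) :
    ∃ (c : ℝ → Phase) (t₀ t₁ t₂ t₃ η : ℝ), t₀ < t₁ ∧ t₁ ≤ 0 ∧ 0 ≤ t₂ ∧ t₂ < t₃ ∧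
      IsIntegralCurveOn c (fun _ => S.vectorField γ β) (Icc t₀ t₃) ∧
      (∀ s ∈ Icc t₀ t₃, c s ∈ S.energyManifold γ β h) ∧ c 0 = (S.radius a E, v, z, u) ∧
      (∀ s ∈ Icc t₁ t₂, c s ∈ S.block γ β h δ) ∧
      (∀ s ∈ Ico t₀ t₁, c s ∉ S.block γ β h δ) ∧ (∀ s ∈ Ioc t₂ t₃, c s ∉ S.block γ β h δ) ∧
      (E = E₀ → v ≤ 0 → t₁ = 0 ∧ η ∈ Icc 0 Real.pi ∧
        √((γ - u ^ 2 / (1 + E ^ 2)) ^ 2 + u ^ 2 / (1 + E ^ 2) * v ^ 2) * Real.cos η =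
          γ - u ^ 2 / (1 + E ^ 2) ∧
        c t₂ = (S.radius a E, -v, z * Complex.exp
          (((SignType.sign u * (2 * Real.pi - 2 * η) / b : ℝ) : ℂ) * Complex.I), u)) ∧
      (E = E₀ → v < 0 → 0 < t₂) ∧ (E = E₀ → 0 ≤ v → t₂ = 0) ∧ (E = E₀ → 0 < v → t₁ < 0) := by
  have hγ := H.γ_pos
  have hE₀ := H.E_pos
  have hpi := Real.pi_pos
  obtain ⟨⟨hz, hen⟩, hEE⟩ := (H.mem_block_radius_iff hE.le).1 hx
  set σ : ℝ := (SignType.sign u : ℝ) with hσ'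
  have hσu : σ * |u| = u := sign_mul_abs u
  have hua : 0 < |u| := abs_pos.2 hu
  have hσ : σ ^ 2 = 1 := by
    have h2 : σ ^ 2 * |u| ^ 2 = 1 * |u| ^ 2 := by rw [← mul_pow, hσu, sq_abs, one_mul]
    exact mul_right_cancel₀ (pow_ne_zero 2 hua.ne') h2
  have hq : 0 < 1 + E ^ 2 := by positivity
  have hqs : 0 < √(1 + E ^ 2) := Real.sqrt_pos.2 hq
  obtain ⟨L, hLs⟩ : ∃ L, L = |u| * √E / √(1 + E ^ 2) := ⟨_, rfl⟩
  have hL : 0 < L := by rw [hLs]; positivity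
  have hL2 : L ^ 2 = u ^ 2 * E / (1 + E ^ 2) := by
    rw [hLs, div_pow, mul_pow, sq_abs, Real.sq_sqrt hE.le, Real.sq_sqrt hq.le]
  have hLE : L ^ 2 / E = u ^ 2 / (1 + E ^ 2) := by rw [hL2]; field_simp
  rw [← hLE]
  obtain ⟨D, hD'⟩ : ∃ D, D = √((γ - L ^ 2 / E) ^ 2 + L ^ 2 / E * v ^ 2) := ⟨_, rfl⟩
  rw [← hD']
  have hD2 : D ^ 2 = (γ - L ^ 2 / E) ^ 2 + L ^ 2 / E * v ^ 2 := by
    rw [hD', Real.sq_sqrt (by positivity)]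
  have hD0 : 0 ≤ D := by rw [hD']; exact Real.sqrt_nonneg _
  have hD : D ^ 2 = γ ^ 2 + 2 * h * (b ^ 2 / a) * L ^ 2 - L ^ 4 := by
    have hv : v ^ 2 = 2 * γ + 2 * h * (b ^ 2 / a * E) - u ^ 2 := by linarith
    rw [hD2, show L ^ 4 = (L ^ 2) ^ 2 by ring, hL2, hv]
    generalize b ^ 2 / a = lam
    field_simp
    ring
  have hκD := H.lt_rungeLenz hL hD0 hD
  have hκle : γ - L ^ 2 / E ≤ γ - L ^ 2 / E₀ := by gcongr
  -- If D = 0, both squares in its definition vanish, so γ = L²/E; but `lt_rungeLenz` gives γ -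
  -- L²/E₀ < 0, contradicting E ≤ E₀.
  have hDpos : 0 < D := by
    refine lt_of_le_of_ne hD0 fun h0 => ?_
    rw [← h0] at hκD hD2
    have h1 : 0 ≤ (γ - L ^ 2 / E) ^ 2 := sq_nonneg _
    have h2 : 0 ≤ L ^ 2 / E * v ^ 2 := by positivity
    have h3 : γ - L ^ 2 / E = 0 := pow_eq_zero_iff (two_ne_zero) |>.1 (by linarith)
    linarith
  obtain ⟨η₀, hη₀, hc₀, hs₀⟩ := exists_angle (X := γ - L ^ 2 / E)
    (Y := -(v * (|u| / √(1 + E ^ 2)))) hDpos (by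
      rw [hD2, neg_sq, mul_pow, div_pow, sq_abs, Real.sq_sqrt hq.le, hLE]; ring)
  -- ηb is the phase at which the orbit enters the block. Since η₀ lies in the block, cos η₀ ≤ cos
  -- ηb, which puts the cosine in the range of `Real.arccos`.
  obtain ⟨ηb, hb0, hbpi, hcb⟩ :
      ∃ ηb, 0 < ηb ∧ ηb ≤ Real.pi ∧ D * Real.cos ηb = γ - L ^ 2 / E₀ := by
    have h1 : (γ - L ^ 2 / E₀) / D < 1 := by rwa [div_lt_one hDpos]
    have h2 : Real.cos η₀ ≤ (γ - L ^ 2 / E₀) / D := by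
      rw [le_div_iff₀ hDpos, mul_comm, hc₀]; exact hκle
    refine ⟨Real.arccos ((γ - L ^ 2 / E₀) / D), Real.arccos_pos.2 h1, Real.arccos_le_pi _, ?_⟩
    rw [Real.cos_arccos ((Real.neg_one_le_cos _).trans h2) h1.le]
    field_simp
  have hcle : Real.cos η₀ ≤ Real.cos ηb := by
    rw [← mul_le_mul_iff_right₀ hDpos, hc₀, hcb]; exact hκle
  have hcb1 : Real.cos ηb < 1 := by
    rw [← mul_lt_mul_iff_right₀ hDpos, hcb, mul_one]; exact hκD
  have hη₀lt : η₀ < 2 * Real.pi := by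
    refine lt_of_le_of_ne hη₀.2 fun h0 => ?_
    rw [h0, Real.cos_two_pi] at hcle
    linarith
  have hη₀b : ηb ≤ η₀ ∧ η₀ ≤ 2 * Real.pi - ηb := by
    constructor
    · by_contra hlt
      have := Real.cos_lt_cos_of_nonneg_of_le_pi hη₀.1.le hbpi (not_le.1 hlt)
      linarith
    · by_contra hlt
      have := Real.cos_lt_cos_of_nonneg_of_le_pi (x := 2 * Real.pi - η₀) (y := ηb) (by linarith)
        hbpi (by linarith)
      rw [Real.cos_two_pi_sub] at this
      linarith
  obtain ⟨y, ηa, hy0, ha0, hab, hρpos, hy⟩ := H.exists_phase hL hDpos hσ z η₀ hb0 hcb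
  have hmem : ∀ η ∈ Icc ηa (2 * Real.pi - ηa),
      orbit S a b γ L D σ z η₀ η ∈ S.energyManifold γ β h := fun η hη =>
    orbit_mem_energyManifold H.round H.β_sq hL hσ hz hD (hρpos η hη)
  have hblock : ∀ η ∈ Icc ηa (2 * Real.pi - ηa),
      (orbit S a b γ L D σ z η₀ η ∈ S.block γ β h δ ↔ Real.cos η ≤ Real.cos ηb) := fun η hη => by
    rw [H.orbit_mem_block_iff hL (hmem η hη) (hρpos η hη), ← hcb, mul_le_mul_iff_right₀ hDpos]
  have hysym : y.symm η₀ = 0 := by rw [← hy0, y.symm_apply_apply]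
  -- A boundary point sits at an end of the phase interval. Since D sin η₀ is a negative multiple of
  -- v, the sign of v then tells entry from exit.
  have hsin : E = E₀ → η₀ = ηb ∨ η₀ = 2 * Real.pi - ηb := fun hEq => by
    have hc : Real.cos η₀ = Real.cos ηb := by
      refine mul_left_cancel₀ hDpos.ne' ?_
      rw [hc₀, hcb, hEq]
    rcases le_total η₀ Real.pi with h1 | h1
    · exact Or.inl (Real.injOn_cos ⟨hη₀.1.le, h1⟩ ⟨hb0.le, hbpi⟩ hc)
    · right
      have := Real.injOn_cos (x₁ := 2 * Real.pi - η₀) ⟨by linarith, by linarith⟩ ⟨hb0.le, hbpi⟩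
        (by rw [Real.cos_two_pi_sub]; exact hc)
      linarith
  have hfac : 0 < |u| / √(1 + E ^ 2) := by positivity
  have hvneg : v ≤ 0 → η₀ ≤ Real.pi := fun hv => by
    by_contra hlt
    have h1 := Real.sin_neg_of_neg_of_neg_pi_lt (x := η₀ - 2 * Real.pi) (by linarith)
      (by linarith)
    rw [Real.sin_sub_two_pi] at h1
    have h2 := mul_neg_of_pos_of_neg hDpos h1
    have h3 := mul_nonpos_of_nonpos_of_nonneg hv hfac.le
    linarith
  have hvneg' : v < 0 → η₀ < Real.pi := fun hv => by
    refine lt_of_le_of_ne (hvneg hv.le) fun h1 => ?_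
    rw [h1, Real.sin_pi, mul_zero] at hs₀
    have h3 := mul_neg_of_neg_of_pos hv hfac
    linarith
  have hvpos : 0 ≤ v → Real.pi ≤ η₀ := fun hv => by
    by_contra hlt
    have h1 := Real.sin_pos_of_pos_of_lt_pi hη₀.1 (not_le.1 hlt)
    have h2 := mul_pos hDpos h1
    have h3 := mul_nonneg hv hfac.le
    linarith
  have hvpos' : 0 < v → Real.pi < η₀ := fun hv => by
    refine lt_of_le_of_ne (hvpos hv.le) fun h1 => ?_
    rw [← h1, Real.sin_pi, mul_zero] at hs₀
    have h3 := mul_pos hv hfac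
    linarith
  refine ⟨fun t => orbit S a b γ L D σ z η₀ (y t), y.symm ηa, y.symm ηb,
    y.symm (2 * Real.pi - ηb), y.symm (2 * Real.pi - ηa), η₀, y.symm.strictMono hab,
    hysym ▸ y.symm.monotone hη₀b.1, hysym ▸ y.symm.monotone hη₀b.2,
    y.symm.strictMono (by linarith), fun s hs => (hy s ?_).hasDerivWithinAt,
    fun s hs => hmem _ ?_, ?_, fun s hs => ?_, fun s hs => ?_, fun s hs => ?_, fun hEq hv => ?_,
    fun hEq hv => ?_, fun hEq hv => ?_, fun hEq hv => ?_⟩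
  · exact ⟨y.symm_apply_le.1 hs.1, y.le_symm_apply.1 hs.2⟩
  · exact ⟨y.symm_apply_le.1 hs.1, y.le_symm_apply.1 hs.2⟩
  · have hη : (γ - D * Real.cos η₀) / L ^ 2 = E⁻¹ := by rw [hc₀]; field_simp; ring
    dsimp only
    rw [hy0, orbit_eq hu hE hσu hLs hη, hs₀]
    have h1 : -(-(v * (|u| / √(1 + E ^ 2))) * √(1 + E ^ 2) / |u|) = v := by field_simp
    rw [h1]
    simp
  · have h1 := y.symm_apply_le.1 hs.1
    have h2 := y.le_symm_apply.1 hs.2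
    exact (hblock _ ⟨by linarith, by linarith⟩).2 (cos_le_cos_of_mem_Icc hb0.le ⟨h1, h2⟩)
  · have h1 := y.symm_apply_le.1 hs.1
    have h2 := y.lt_symm_apply.1 hs.2
    rw [hblock _ ⟨by linarith, by linarith⟩, not_le]
    exact Real.cos_lt_cos_of_nonneg_of_le_pi (by linarith) hbpi h2
  · have h1 := y.symm_apply_lt.1 hs.1
    have h2 := y.le_symm_apply.1 hs.2
    rw [hblock _ ⟨by linarith, by linarith⟩, not_le, ← Real.cos_two_pi_sub (y s)]
    exact Real.cos_lt_cos_of_nonneg_of_le_pi (by linarith) hbpi (by linarith)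
  · have h1 : η₀ = ηb := by
      have := hvneg hv
      rcases hsin hEq with h | h
      · exact h
      · linarith
    refine ⟨h1 ▸ hysym, ⟨hη₀.1.le, hvneg hv⟩, hc₀, ?_⟩
    have hη : (γ - D * Real.cos (2 * Real.pi - η₀)) / L ^ 2 = E⁻¹ := by
      rw [Real.cos_two_pi_sub, hc₀]; field_simp; ring
    dsimp only
    rw [OrderIso.apply_symm_apply, ← h1, orbit_eq hu hE hσu hLs hη, Real.sin_two_pi_sub,
      mul_neg, hs₀]
    have h2 : -(- -(v * (|u| / √(1 + E ^ 2))) * √(1 + E ^ 2) / |u|) = -v := by field_simp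
    rw [h2, show 2 * Real.pi - η₀ - η₀ = 2 * Real.pi - 2 * η₀ by ring]
  · have := hvneg' hv
    rw [← hysym]
    exact y.symm.strictMono (by rcases hsin hEq with h | h <;> linarith)
  · have := hvpos hv
    rw [← hysym]
    congr 1
    rcases hsin hEq with h | h <;> linarith
  · have := hvpos' hv
    rw [← hysym]
    exact y.symm.strictMono (by rcases hsin hEq with h | h <;> linarith)

theorem two_mul_energy_pos (H : S.IsSmallBlock a b γ β h δ E₀) {E : ℝ} (hE : 0 ≤ E)
    (hE' : E ≤ 2 * E₀) : 0 < 2 * γ + 2 * h * (b ^ 2 / a * E) := by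
  have h1 := H.neg_abs_mul_le (E := E / 2) (by linarith) (by linarith)
  have h2 := H.small
  have h4 : 0 ≤ γ * E₀ ^ 2 := mul_nonneg H.γ_pos.le (sq_nonneg _)
  have h5 : h * (b ^ 2 / a * (E / 2)) * 2 = h * (b ^ 2 / a * E) := by ring
  nlinarith

/-- The orbits with zero angular momentum. -/
theorem exists_radial (H : S.IsSmallBlock a b γ β h δ E₀) {E v : ℝ} {z : ℂ} (hE : 0 < E)
    (hx : (S.radius a E, v, z, 0) ∈ S.block γ β h δ) :
    ∃ (c : ℝ → Phase) (t₁ t₂ : ℝ), 0 ≤ t₁ ∧ t₁ < t₂ ∧ (E = E₀ → t₁ = 0) ∧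
      c 0 = (S.radius a E, v, z, 0) ∧ v ≠ 0 ∧
      ∀ t : ℝ, SignType.sign v * t ≤ t₂ → HasDerivAt c (S.vectorField γ β (c t)) t ∧
        c t ∈ S.energyManifold γ β h ∧ (c t ∈ S.block γ β h δ ↔ SignType.sign v * t ≤ t₁) := by
  have ha := H.round.a_pos
  have hb := H.round.b_pos
  have hγ := H.γ_pos
  have hE₀ := H.E_pos
  obtain ⟨⟨hz, hen⟩, hEE⟩ := (H.mem_block_radius_iff hE.le).1 hx
  have hv : v ≠ 0 := by
    rintro rfl
    have := H.two_mul_energy_pos hE.le (by linarith)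
    rw [← hen] at this
    norm_num at this
  set σ : ℝ := (SignType.sign v : ℝ) with hσ'
  have hσv : σ * |v| = v := sign_mul_abs v
  have hσ : σ ^ 2 = 1 := by
    have h1 : |v| ≠ 0 := abs_ne_zero.2 hv
    have h2 : σ ^ 2 * |v| ^ 2 = 1 * |v| ^ 2 := by rw [← mul_pow, hσv, sq_abs, one_mul]
    exact mul_right_cancel₀ (pow_ne_zero 2 h1) h2
  -- The unknown is y = log E, so the pole is pushed to -∞ and takes infinite time to reach. The cut
  -- at 2E₀ keeps the speed bounded and positive, and is inactive up to time t₂.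
  set m : ℝ → ℝ := fun y => min (Real.exp y) (2 * E₀) with hm
  have hm0 : ∀ y, 0 < m y := fun y => lt_min (Real.exp_pos y) (by linarith)
  have hm1 : ∀ y, m y ≤ 2 * E₀ := fun y => min_le_right _ _
  have hmc : Continuous m := Real.continuous_exp.min continuous_const
  have hW : ∀ y, 0 < 2 * γ + 2 * h * (b ^ 2 / a * m y) := fun y =>
    H.two_mul_energy_pos (hm0 y).le (hm1 y)
  obtain ⟨y, hy0, hy⟩ := exists_orderIso_hasDerivAt
    (G := fun y => b * √(2 * γ + 2 * h * (b ^ 2 / a * m y)) * √(1 + m y ^ 2))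
    (C := b * √(2 * γ + 2 * |h| * (b ^ 2 / a * (2 * E₀))) * √(1 + (2 * E₀) ^ 2))
    ((continuous_const.mul (continuous_const.add (continuous_const.mul
      (continuous_const.mul hmc))).sqrt).mul (continuous_const.add (hmc.pow 2)).sqrt)
    (fun y => by
      have := hW y
      positivity)
    (fun y => by
      have := hm0 y
      have := hm1 y
      have := le_abs_self h
      gcongr) (Real.log E)
  have hsymm : y.symm (Real.log E) = 0 := by rw [← hy0, y.symm_apply_apply]
  -- Replacing t by σt lets one increasing solution serve outgoing and incoming orbits.
  refine ⟨fun t => (S.radius a (Real.exp (y (σ * t))),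
    σ * √(2 * γ + 2 * h * (b ^ 2 / a * Real.exp (y (σ * t)))), z, 0), y.symm (Real.log E₀),
    y.symm (Real.log (2 * E₀)), ?_, ?_, ?_, ?_, hv, fun t ht => ?_⟩
  · rw [← hsymm]
    exact y.symm.monotone (Real.log_le_log hE hEE)
  · exact y.symm.strictMono (Real.log_lt_log hE₀ (by linarith))
  · rintro rfl; exact hsymm
  · dsimp only
    rw [mul_zero, hy0, Real.exp_log hE, ← hen, zero_pow two_ne_zero, zero_add,
      Real.sqrt_sq_eq_abs, hσv]
  have h1 : Real.exp (y (σ * t)) ≤ 2 * E₀ := by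
    rw [← Real.le_log_iff_exp_le (by linarith)]
    exact y.le_symm_apply.1 ht
  have hmy : m (y (σ * t)) = Real.exp (y (σ * t)) := min_eq_left h1
  have hWt := hW (y (σ * t))
  have hyt := hy (σ * t)
  rw [hmy] at hWt hyt
  have hex := Real.exp_pos (y (σ * t))
  have hM : ‖z‖ = 1 ∧ (0 : ℝ) ^ 2 + (σ * √(2 * γ + 2 * h * (b ^ 2 / a * Real.exp (y (σ * t))))) ^ 2
      = 2 * γ + 2 * h * (b ^ 2 / a * Real.exp (y (σ * t))) := by
    refine ⟨hz, ?_⟩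
    rw [mul_pow, hσ, Real.sq_sqrt hWt.le]; ring
  refine ⟨?_, (H.round.mem_energyManifold_radius H.β_sq hex.le).2 hM, ?_⟩
  · rw [H.round.vectorField_radius H.β_sq γ hex.le]
    have hE' : HasDerivAt (fun t => Real.exp (y (σ * t))) (Real.exp (y (σ * t)) *
        (b * √(2 * γ + 2 * h * (b ^ 2 / a * Real.exp (y (σ * t)))) *
          √(1 + Real.exp (y (σ * t)) ^ 2) * σ)) t := by
      have h2 : HasDerivAt (fun t : ℝ => σ * t) σ t := by
        simpa using (hasDerivAt_id t).const_mul σ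
      exact (hyt.comp t h2).exp
    set Ef : ℝ → ℝ := fun t => Real.exp (y (σ * t)) with hEf
    have hEt : Real.exp (y (σ * t)) = Ef t := rfl
    rw [hEt] at hE' hWt hex ⊢
    set W := √(2 * γ + 2 * h * (b ^ 2 / a * Ef t)) with hW'
    set q := √(1 + Ef t ^ 2) with hq'
    have hW0 : 0 < W := Real.sqrt_pos.2 hWt
    have hq0 : 0 < q := Real.sqrt_pos.2 (by positivity)
    have hWW : W ^ 2 = 2 * γ + 2 * h * (b ^ 2 / a * Ef t) := Real.sq_sqrt hWt.le
    have hqq : 1 + Ef t ^ 2 = q ^ 2 := (Real.sq_sqrt (by positivity)).symm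
    refine HasDerivAt.prodMk ?_ (HasDerivAt.prodMk ?_ (HasDerivAt.prodMk ?_ ?_))
    · refine (hasDerivAt_radius hE').congr_deriv ?_
      rw [hqq]
      field_simp
    · refine (((((hE'.const_mul (b ^ 2 / a)).const_mul (2 * h)).const_add (2 * γ)).sqrt
        hWt.ne').const_mul σ).congr_deriv ?_
      rw [← hW', mul_pow, hσ, hWW]
      generalize b ^ 2 / a = lam
      field_simp
      linear_combination (h * lam * Ef t * q ^ 2) * hσ
    · simpa using hasDerivAt_const t z
    · simpa using hasDerivAt_const t (0 : ℝ)
  · rw [H.mem_block_radius_iff hex.le, and_iff_right hM, ← Real.le_log_iff_exp_le hE₀,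
      ← y.le_symm_apply]

end IsSmallBlock

/-- The flow on the collision manifold. -/
theorem exists_collision_curve {S : SphericalSurface} {a b γ β h : ℝ} (hS : S.IsRound a b)
    (hβ : β ^ 2 = b ^ 2) (hγ : 0 < γ) {x : Phase} (hx : x ∈ S.collisionManifold γ β h) :
    ∃ c : ℝ → Phase, c 0 = x ∧ ∀ t, HasDerivAt c (S.vectorField γ β (c t)) t ∧
      c t ∈ S.collisionManifold γ β h := by
  have hb := hS.b_pos
  obtain ⟨r, v, z, u⟩ := x
  obtain ⟨hM, hr⟩ := hx
  have hr : r = S.radius a 0 := by rw [radius_zero]; exact hr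
  subst hr
  obtain ⟨hz, hen⟩ := (hS.mem_energyManifold_radius hβ le_rfl).1 hM
  rw [mul_zero, mul_zero, add_zero] at hen
  -- On the collision manifold the points u = 0 are equilibria, with v = ±√(2γ).
  by_cases hu : u = 0
  · subst hu
    refine ⟨fun _ => (S.radius a 0, v, z, 0), rfl, fun t => ⟨?_, hM, radius_zero⟩⟩
    rw [hS.vectorField_radius hβ γ le_rfl]
    have hv : v ^ 2 / 2 - γ = 0 := by linarith
    exact (hasDerivAt_const t _).congr_deriv (by simp [hv]; rfl)
  set σ : ℝ := (SignType.sign u : ℝ) with hσ'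
  have hσu : σ * |u| = u := sign_mul_abs u
  have hua : 0 < |u| := abs_pos.2 hu
  have hσ : σ ^ 2 = 1 := by
    have h2 : σ ^ 2 * |u| ^ 2 = 1 * |u| ^ 2 := by rw [← mul_pow, hσu, sq_abs, one_mul]
    exact mul_right_cancel₀ (pow_ne_zero 2 hua.ne') h2
  -- Elsewhere v' = b(w² - v²)/2, so v = w tanh X and u = σw/cosh X with X affine of slope bw/2; θ
  -- is the integral of u.
  set w := √(2 * γ) with hw'
  have hw : 0 < w := Real.sqrt_pos.2 (by linarith)
  have hww : w ^ 2 = 2 * γ := Real.sq_sqrt (by linarith)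
  set x₀ := Real.arsinh (v / |u|) with hx₀
  have hsh : Real.sinh x₀ = v / |u| := Real.sinh_arsinh _
  have hch : Real.cosh x₀ = w / |u| := by
    have h1 : Real.cosh x₀ ^ 2 = (w / |u|) ^ 2 := by
      rw [Real.cosh_sq, hsh, div_pow, div_pow, hww, ← hen, sq_abs]
      field_simp
      ring
    exact (pow_left_inj₀ (Real.cosh_pos _).le (by positivity) two_ne_zero).1 h1
  set X : ℝ → ℝ := fun t => b * w / 2 * t + x₀ with hX
  have hX' : ∀ t, HasDerivAt X (b * w / 2) t := fun t => by
    exact (((hasDerivAt_id t).const_mul (b * w / 2)).add_const x₀).congr_deriv (mul_one _)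
  have hX0 : X 0 = x₀ := by simp [hX]
  refine ⟨fun t => (S.radius a 0, w * (Real.sinh (X t) / Real.cosh (X t)),
    z * Complex.exp (((σ * (2 / b) * (Real.arctan (Real.sinh (X t)) -
      Real.arctan (Real.sinh x₀)) : ℝ) : ℂ) * Complex.I), σ * (w / Real.cosh (X t))), ?_,
    fun t => ⟨?_, ?_, radius_zero⟩⟩
  · dsimp only
    rw [hX0, hsh, hch]
    congr 1
    congr 1
    · field_simp
    congr 1
    · simp
    · field_simp
      exact hσu
  · rw [hS.vectorField_radius hβ γ le_rfl]
    have hc : 0 < Real.cosh (X t) := Real.cosh_pos _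
    have hcs : Real.cosh (X t) ^ 2 = 1 + Real.sinh (X t) ^ 2 := by rw [Real.cosh_sq]; ring
    have hs' := (hX' t).sinh
    have hc' := (hX' t).cosh
    have hg : γ = w ^ 2 / 2 := by rw [hww]; ring
    rw [hg]
    refine HasDerivAt.prodMk ?_ (HasDerivAt.prodMk ?_ (HasDerivAt.prodMk ?_ ?_))
    · simpa using hasDerivAt_const t _
    · refine ((hs'.div hc' hc.ne').const_mul w).congr_deriv ?_
      simp only [ne_eq, OfNat.ofNat_ne_zero, not_false_eq_true, zero_pow, add_zero, Real.sqrt_one,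
        mul_pow, hσ]
      field_simp
      linear_combination 2 * hcs
    · refine hasDerivAt_rotate z (((hs'.arctan.sub_const _).const_mul (σ * (2 / b))).congr_deriv ?_)
      rw [← hcs]
      field_simp
    · refine (((hasDerivAt_const t w).div hc' hc.ne').const_mul σ).congr_deriv ?_
      simp only [ne_eq, OfNat.ofNat_ne_zero, not_false_eq_true, zero_pow, add_zero, Real.sqrt_one]
      field_simp
      ring
  · refine (hS.mem_energyManifold_radius hβ le_rfl).2 ⟨?_, ?_⟩
    · rw [norm_mul, Complex.norm_exp_ofReal_mul_I, hz, one_mul]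
    · have hc : 0 < Real.cosh (X t) := Real.cosh_pos _
      have hcs : Real.sinh (X t) ^ 2 = Real.cosh (X t) ^ 2 - 1 := by rw [Real.cosh_sq]; ring
      rw [mul_zero, mul_zero, add_zero, ← hww, mul_pow, hσ, mul_pow, div_pow, div_pow, hcs]
      field_simp
      ring

end SphericalSurface

/-! ### Relative interiors, and submanifolds cut out by quadratic equations. -/

section

variable {E : Type*} [NormedAddCommGroup E] {M B : Set E}

theorem exists_isOpen_relInterior (M B : Set E) : ∃ O : Set E, IsOpen O ∧ relInterior M B = M ∩ O := by
  obtain ⟨O, hO, h⟩ := isOpen_induced_iff.1 (isOpen_interior (s := ((↑) : M → E) ⁻¹' B))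
  refine ⟨O, hO, ?_⟩
  rw [relInterior, ← h, Subtype.image_preimage_coe]

theorem relInterior_subset (M B : Set E) : relInterior M B ⊆ B := by
  rintro _ ⟨x, hx, rfl⟩
  exact (interior_subset hx : x ∈ ((↑) : M → E) ⁻¹' B)

theorem mem_relInterior_of_isOpen {O : Set E} (hO : IsOpen O) (h : M ∩ O ⊆ B) {x : E}
    (hx : x ∈ M) (hxO : x ∈ O) : x ∈ relInterior M B :=
  ⟨⟨x, hx⟩, mem_interior.2 ⟨_, fun y hy => h ⟨y.2, hy⟩, hO.preimage continuous_subtype_val, hxO⟩, rfl⟩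

theorem mem_relBoundary_iff_of_isClosed (hB : IsClosed B) (hBM : B ⊆ M) {x : E} :
    x ∈ relBoundary M B ↔ x ∈ B ∧ x ∉ relInterior M B := by
  have hc : IsClosed (((↑) : M → E) ⁻¹' B) := hB.preimage continuous_subtype_val
  rw [relBoundary, relInterior, hc.frontier_eq]
  constructor
  · rintro ⟨y, ⟨hy, hy'⟩, rfl⟩
    refine ⟨hy, ?_⟩
    rintro ⟨w, hw, h⟩
    exact hy' (Subtype.ext h ▸ hw)
  · rintro ⟨h1, h2⟩
    exact ⟨⟨x, hBM h1⟩, ⟨h1, fun h => h2 ⟨_, h, rfl⟩⟩, rfl⟩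

/-- One line derivative per target vector suffices, so the Fréchet derivative never has to be
written out. -/
theorem surjective_fderiv_of_hasDerivAt [NormedSpace ℝ E] {F : Type*} [NormedAddCommGroup F] [NormedSpace ℝ F]
    {g : E → F} {y : E} (hg : DifferentiableAt ℝ g y)
    (h : ∀ w, ∃ d, HasDerivAt (fun t : ℝ => g (y + t • d)) w 0) :
    Function.Surjective (fderiv ℝ g y) := fun w => by
  obtain ⟨d, hd⟩ := h w
  exact ⟨d, (hg.hasFDerivAt.hasLineDerivAt d).unique hd⟩

end

theorem contDiff_normSq : ContDiff ℝ ∞ fun z : ℂ => Complex.normSq z := by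
  simp only [Complex.normSq_apply]
  have h1 : ContDiff ℝ ∞ fun z : ℂ => z.re := Complex.reCLM.contDiff
  have h2 : ContDiff ℝ ∞ fun z : ℂ => z.im := Complex.imCLM.contDiff
  exact (h1.mul h1).add (h2.mul h2)

theorem hasDerivAt_one_add_mul_sq (α : ℝ) :
    HasDerivAt (fun t : ℝ => (1 + t * α) ^ 2) (2 * α) 0 := by
  have := (((hasDerivAt_id (0 : ℝ)).mul_const α).const_add 1).fun_pow 2
  simpa using this

/-- A torus in phase space is a smooth submanifold of codimension three. -/
theorem isSmoothSubmanifold_torus {r₀ ρ : ℝ} (hρ : 0 < ρ) :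
    IsSmoothSubmanifold 3
      {x : Phase | x.1 = r₀ ∧ ‖x.2.2.1‖ = 1 ∧ x.2.2.2 ^ 2 + x.2.1 ^ 2 = ρ} := by
  intro x hx
  have hv : ContDiff ℝ ∞ fun x : Phase => x.2.1 := by fun_prop
  have hu : ContDiff ℝ ∞ fun x : Phase => x.2.2.2 := by fun_prop
  have hr : ContDiff ℝ ∞ fun x : Phase => x.1 := by fun_prop
  have hz : ContDiff ℝ ∞ fun x : Phase => Complex.normSq x.2.2.1 :=
    contDiff_normSq.comp (by fun_prop)
  have hq : ContDiff ℝ ∞ fun x : Phase => x.2.2.2 ^ 2 + x.2.1 ^ 2 := (hu.pow 2).add (hv.pow 2)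
  have hg : ContDiff ℝ ∞ fun x : Phase => (![x.1 - r₀, Complex.normSq x.2.2.1 - 1,
      x.2.2.2 ^ 2 + x.2.1 ^ 2 - ρ] : Fin 3 → ℝ) := by
    rw [contDiff_pi]
    intro i
    fin_cases i
    · exact hr.sub contDiff_const
    · exact hz.sub contDiff_const
    · exact hq.sub contDiff_const
  refine ⟨{x | Complex.normSq x.2.2.1 ≠ 0 ∧ x.2.2.2 ^ 2 + x.2.1 ^ 2 ≠ 0},
    (isOpen_ne.preimage hz.continuous).inter (isOpen_ne.preimage hq.continuous), ⟨?_, ?_⟩, _,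
    hg.contDiffOn, fun y hy => ?_, ?_⟩
  · rw [Complex.normSq_eq_norm_sq, hx.2.1]; norm_num
  · rw [hx.2.2]; exact hρ.ne'
  · refine surjective_fderiv_of_hasDerivAt (hg.differentiable (by simp) y) fun w => ?_
    obtain ⟨hy1, hy2⟩ := hy
    obtain ⟨r, v, z, u⟩ := y
    dsimp only at hy1 hy2
    -- Moving z and (v, u) radially multiplies |z|² and u² + v² by squares (1 + tα)², whose
    -- derivative 2α takes any prescribed value.
    refine ⟨(w 0, (w 2 / (2 * (u ^ 2 + v ^ 2))) * v,
      ((w 1 / (2 * Complex.normSq z) : ℝ) : ℂ) * z, (w 2 / (2 * (u ^ 2 + v ^ 2))) * u), ?_⟩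
    rw [hasDerivAt_pi]
    intro i
    fin_cases i
    · have := (((hasDerivAt_id (0 : ℝ)).mul_const (w 0)).const_add r).sub_const r₀
      simpa using this
    · have := ((hasDerivAt_one_add_mul_sq (w 1 / (2 * Complex.normSq z))).mul_const
        (Complex.normSq z)).sub_const 1
      convert this using 1
      · funext t
        have h1 : z + t • (((w 1 / (2 * Complex.normSq z) : ℝ) : ℂ) * z) =
            ((1 + t * (w 1 / (2 * Complex.normSq z)) : ℝ) : ℂ) * z := by
          rw [Complex.real_smul]; push_cast; ring
        change Complex.normSq (z + t • (((w 1 / (2 * Complex.normSq z) : ℝ) : ℂ) * z)) - 1 = _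
        rw [h1, Complex.normSq_mul, Complex.normSq_ofReal]
        ring
      · change w 1 = _
        field_simp
    · have := ((hasDerivAt_one_add_mul_sq (w 2 / (2 * (u ^ 2 + v ^ 2)))).mul_const
        (u ^ 2 + v ^ 2)).sub_const ρ
      convert this using 1
      · funext t
        change (u + t * (w 2 / (2 * (u ^ 2 + v ^ 2)) * u)) ^ 2 +
          (v + t * (w 2 / (2 * (u ^ 2 + v ^ 2)) * v)) ^ 2 - ρ = _
        ring
      · change w 2 = _
        field_simp
  · ext y
    have hn : Complex.normSq y.2.2.1 - 1 = 0 ↔ ‖y.2.2.1‖ = 1 := by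
      rw [Complex.normSq_eq_norm_sq, sub_eq_zero, pow_eq_one_iff_of_nonneg (norm_nonneg _) two_ne_zero]
    simp only [mem_inter_iff, mem_ofPred_eq, funext_iff, Fin.forall_fin_succ, Matrix.cons_val_zero,
      Matrix.cons_val_succ, Pi.zero_apply, sub_eq_zero (b := r₀), sub_eq_zero (b := ρ), hn,
      IsEmpty.forall_iff, and_true]
    tauto

/-- The two circles `u = ± √ρ`, `v = 0` in phase space. -/
theorem isSmoothSubmanifold_circles {r₀ ρ : ℝ} (hρ : 0 < ρ) :
    IsSmoothSubmanifold 4 {x : Phase | (x.1 = r₀ ∧ ‖x.2.2.1‖ = 1 ∧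
      x.2.2.2 ^ 2 + x.2.1 ^ 2 = ρ) ∧ x.2.1 = 0} := by
  intro x hx
  have hv : ContDiff ℝ ∞ fun x : Phase => x.2.1 := by fun_prop
  have hu : ContDiff ℝ ∞ fun x : Phase => x.2.2.2 := by fun_prop
  have hr : ContDiff ℝ ∞ fun x : Phase => x.1 := by fun_prop
  have hz : ContDiff ℝ ∞ fun x : Phase => Complex.normSq x.2.2.1 :=
    contDiff_normSq.comp (by fun_prop)
  have hq : ContDiff ℝ ∞ fun x : Phase => x.2.2.2 ^ 2 := hu.pow 2
  -- With v = 0 as an equation, u² + v² = ρ may be replaced by u² = ρ. The four functions then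
  -- involve separate coordinates.
  have hg : ContDiff ℝ ∞ fun x : Phase => (![x.1 - r₀, Complex.normSq x.2.2.1 - 1,
      x.2.2.2 ^ 2 - ρ, x.2.1] : Fin 4 → ℝ) := by
    rw [contDiff_pi]
    intro i
    fin_cases i
    · exact hr.sub contDiff_const
    · exact hz.sub contDiff_const
    · exact hq.sub contDiff_const
    · exact hv
  refine ⟨{x | Complex.normSq x.2.2.1 ≠ 0 ∧ x.2.2.2 ^ 2 ≠ 0},
    (isOpen_ne.preimage hz.continuous).inter (isOpen_ne.preimage hq.continuous), ⟨?_, ?_⟩, _,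
    hg.contDiffOn, fun y hy => ?_, ?_⟩
  · rw [Complex.normSq_eq_norm_sq, hx.1.2.1]; norm_num
  · have h1 := hx.1.2.2
    rw [hx.2] at h1
    have h2 : x.2.2.2 ^ 2 = ρ := by linarith
    rw [h2]; exact hρ.ne'
  · refine surjective_fderiv_of_hasDerivAt (hg.differentiable (by simp) y) fun w => ?_
    obtain ⟨hy1, hy2⟩ := hy
    obtain ⟨r, v, z, u⟩ := y
    dsimp only at hy1 hy2
    refine ⟨(w 0, w 3, ((w 1 / (2 * Complex.normSq z) : ℝ) : ℂ) * z, (w 2 / (2 * u ^ 2)) * u), ?_⟩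
    rw [hasDerivAt_pi]
    intro i
    fin_cases i
    · have := (((hasDerivAt_id (0 : ℝ)).mul_const (w 0)).const_add r).sub_const r₀
      simpa using this
    · have := ((hasDerivAt_one_add_mul_sq (w 1 / (2 * Complex.normSq z))).mul_const
        (Complex.normSq z)).sub_const 1
      convert this using 1
      · funext t
        have h1 : z + t • (((w 1 / (2 * Complex.normSq z) : ℝ) : ℂ) * z) =
            ((1 + t * (w 1 / (2 * Complex.normSq z)) : ℝ) : ℂ) * z := by
          rw [Complex.real_smul]; push_cast; ring
        change Complex.normSq (z + t • (((w 1 / (2 * Complex.normSq z) : ℝ) : ℂ) * z)) - 1 = _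
        rw [h1, Complex.normSq_mul, Complex.normSq_ofReal]
        ring
      · change w 1 = _
        field_simp
    · have := ((hasDerivAt_one_add_mul_sq (w 2 / (2 * u ^ 2))).mul_const (u ^ 2)).sub_const ρ
      convert this using 1
      · funext t
        change (u + t * (w 2 / (2 * u ^ 2) * u)) ^ 2 - ρ = _
        ring
      · change w 2 = _
        generalize u ^ 2 = q at *
        field_simp
    · have := ((hasDerivAt_id (0 : ℝ)).mul_const (w 3)).const_add v
      simpa using this
  · ext y
    have hn : Complex.normSq y.2.2.1 - 1 = 0 ↔ ‖y.2.2.1‖ = 1 := by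
      rw [Complex.normSq_eq_norm_sq, sub_eq_zero, pow_eq_one_iff_of_nonneg (norm_nonneg _) two_ne_zero]
    simp only [mem_inter_iff, mem_ofPred_eq, funext_iff, Fin.forall_fin_succ, Matrix.cons_val_zero,
      Matrix.cons_val_succ, Pi.zero_apply, sub_eq_zero (b := r₀), sub_eq_zero (b := ρ), hn,
      IsEmpty.forall_iff, and_true]
    constructor
    · rintro ⟨⟨⟨h1, h2, h3⟩, h4⟩, h5⟩
      rw [h4] at h3
      exact ⟨h5, h1, h2, by linarith, h4⟩
    · rintro ⟨h5, h1, h2, h3, h4⟩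
      refine ⟨⟨⟨h1, h2, ?_⟩, h4⟩, h5⟩
      rw [h3, h4]; ring

/-! ### Boundary, tangency, ingress and egress of the block. -/

namespace SphericalSurface

open IsRound

theorem IsRound.exists_radius_of_le {S : SphericalSurface} {a b : ℝ} (hS : S.IsRound a b) {r E : ℝ}
    (hr : r ∈ Icc S.rN S.rS) (h : r ≤ S.radius a E) : ∃ E', 0 ≤ E' ∧ r = S.radius a E' := by
  refine hS.exists_radius hr ?_
  have ha := hS.a_pos
  rw [hS.df_eq r hr]
  refine mul_pos hS.b_pos (Real.cos_pos_of_mem_Ioo ⟨?_, ?_⟩)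
  · have : 0 ≤ a * (r - S.rN) := mul_nonneg ha.le (by linarith [hr.1])
    linarith [Real.pi_pos]
  · calc a * (r - S.rN) ≤ a * (S.radius a E - S.rN) := by gcongr
      _ < Real.pi / 2 := by rw [hS.angle_radius]; exact Real.arctan_lt_pi_div_two E

/-- The part of the energy manifold with `tan (a (r - rN)) ≤ e` is compact. -/
theorem IsRound.isCompact_image {S : SphericalSurface} {a : ℝ} (b γ h e : ℝ) :
    IsCompact {x : Phase | ∃ (E v : ℝ) (z : ℂ) (u : ℝ), x = (S.radius a E, v, z, u) ∧ 0 ≤ E ∧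
      E ≤ e ∧ ‖z‖ = 1 ∧ u ^ 2 + v ^ 2 = 2 * γ + 2 * h * (b ^ 2 / a * E)} := by
  set A : Set Phase := {p | 0 ≤ p.1 ∧ p.1 ≤ e ∧ ‖p.2.2.1‖ = 1 ∧
    p.2.2.2 ^ 2 + p.2.1 ^ 2 = 2 * γ + 2 * h * (b ^ 2 / a * p.1)} with hA
  have hcl : IsClosed A := by
    have h1 : IsClosed {p : Phase | 0 ≤ p.1} := isClosed_le (by fun_prop) (by fun_prop)
    have h2 : IsClosed {p : Phase | p.1 ≤ e} := isClosed_le (by fun_prop) (by fun_prop)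
    have h3 : IsClosed {p : Phase | ‖p.2.2.1‖ = 1} := isClosed_eq (by fun_prop) (by fun_prop)
    have h4 : IsClosed {p : Phase | p.2.2.2 ^ 2 + p.2.1 ^ 2 =
        2 * γ + 2 * h * (b ^ 2 / a * p.1)} := isClosed_eq (by fun_prop) (by fun_prop)
    exact h1.inter (h2.inter (h3.inter h4))
  -- The added 1 turns a bound on w² into one on |w|, through 2|w| ≤ 1 + w².
  set R := 1 + 2 * |γ| + 2 * |h| * (|b ^ 2 / a| * e) with hR
  have hsub : A ⊆ Icc 0 e ×ˢ (Icc (-R) R ×ˢ (Metric.closedBall 0 1 ×ˢ Icc (-R) R)) := by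
    rintro ⟨E, v, z, u⟩ ⟨h1, h2, h3, h4⟩
    dsimp only at h1 h2 h3 h4
    have h5 : h * (b ^ 2 / a * E) ≤ |h| * (|b ^ 2 / a| * e) := by
      calc h * (b ^ 2 / a * E) ≤ |h * (b ^ 2 / a * E)| := le_abs_self _
        _ = |h| * (|b ^ 2 / a| * E) := by rw [abs_mul, abs_mul, abs_of_nonneg h1]
        _ ≤ |h| * (|b ^ 2 / a| * e) := by gcongr
    have h6 := le_abs_self γ
    have h7 : u ^ 2 + v ^ 2 ≤ R - 1 := by rw [h4, hR]; linarith
    have hb : ∀ w : ℝ, w ^ 2 ≤ R - 1 → w ∈ Icc (-R) R := fun w hw => by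
      constructor <;> nlinarith [sq_nonneg (w - 1), sq_nonneg (w + 1)]
    refine ⟨⟨h1, h2⟩, hb v (by nlinarith [sq_nonneg u]), ?_, hb u (by nlinarith [sq_nonneg v])⟩
    simp [h3]
  have hAc : IsCompact A :=
    (isCompact_Icc.prod (isCompact_Icc.prod ((isCompact_closedBall _ _).prod
      isCompact_Icc))).of_isClosed_subset hcl hsub
  have hc : Continuous fun p : Phase => ((S.radius a p.1, p.2.1, p.2.2.1, p.2.2.2) : Phase) := by
    have := continuous_radius (S := S) (a := a)
    fun_prop
  convert hAc.image hc using 1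
  ext x
  constructor
  · rintro ⟨E, v, z, u, rfl, h1, h2, h3, h4⟩
    exact ⟨(E, v, z, u), ⟨h1, h2, h3, h4⟩, rfl⟩
  · rintro ⟨⟨E, v, z, u⟩, ⟨h1, h2, h3, h4⟩, rfl⟩
    exact ⟨E, v, z, u, rfl, h1, h2, h3, h4⟩

theorem IsRound.isCompact_collisionManifold {S : SphericalSurface} {a b β : ℝ}
    (hS : S.IsRound a b) (hβ : β ^ 2 = b ^ 2) (γ h : ℝ) :
    IsCompact (S.collisionManifold γ β h) := by
  convert isCompact_image (S := S) (a := a) b γ h 0 using 1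
  ext x
  constructor
  · rintro ⟨hM, hr⟩
    obtain ⟨r, v, z, u⟩ := x
    obtain rfl : r = S.radius a 0 := by rw [radius_zero]; exact hr
    exact ⟨0, v, z, u, rfl, le_rfl, le_rfl, (hS.mem_energyManifold_radius hβ le_rfl).1 hM⟩
  · rintro ⟨E, v, z, u, rfl, h1, h2, h3⟩
    obtain rfl := le_antisymm h2 h1
    exact ⟨(hS.mem_energyManifold_radius hβ le_rfl).2 h3, radius_zero⟩

namespace IsSmallBlock

variable {S : SphericalSurface} {a b γ β h δ E₀ : ℝ}

theorem mem_block_iff (H : S.IsSmallBlock a b γ β h δ E₀) {x : Phase} : x ∈ S.block γ β h δ ↔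
    ∃ (E v : ℝ) (z : ℂ) (u : ℝ), x = (S.radius a E, v, z, u) ∧ 0 ≤ E ∧
      E ≤ E₀ ∧ ‖z‖ = 1 ∧ u ^ 2 + v ^ 2 = 2 * γ + 2 * h * (b ^ 2 / a * E) := by
  have hb := H.round.b_pos
  have hβ : β ≠ 0 := fun h0 => by
    have := H.β_sq
    rw [h0] at this
    nlinarith
  constructor
  · intro hx
    obtain ⟨E, v, z, u, hE, rfl⟩ := H.round.exists_radius_of_mem_block hβ H.abs_mul_lt hx
    obtain ⟨h1, h2⟩ := (H.mem_block_radius_iff hE).1 hx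
    exact ⟨E, v, z, u, rfl, hE, h2, h1⟩
  · rintro ⟨E, v, z, u, rfl, hE, h1, h2⟩
    exact (H.mem_block_radius_iff hE).2 ⟨h2, h1⟩

theorem isCompact_block (H : S.IsSmallBlock a b γ β h δ E₀) : IsCompact (S.block γ β h δ) := by
  convert isCompact_image (S := S) (a := a) b γ h E₀ using 1
  ext x
  exact H.mem_block_iff

theorem block_subset (S : SphericalSurface) (γ β h δ : ℝ) :
    S.block γ β h δ ⊆ S.energyManifold γ β h := fun _ hx => hx.1

theorem mem_relInterior (H : S.IsSmallBlock a b γ β h δ E₀) {x : Phase}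
    (hx : x ∈ S.energyManifold γ β h) (hr : x.1 < S.radius a E₀) :
    x ∈ relInterior (S.energyManifold γ β h) (S.block γ β h δ) := by
  refine mem_relInterior_of_isOpen (O := {x : Phase | x.1 < S.radius a E₀})
    (isOpen_lt (by fun_prop) (by fun_prop)) ?_ hx hr
  rintro ⟨r, v, z, u⟩ ⟨hy, hy'⟩
  obtain ⟨E, hE, rfl⟩ := H.round.exists_radius_of_le hy.1 (le_of_lt hy')
  exact (H.mem_block_radius_iff hE).2
    ⟨(H.round.mem_energyManifold_radius H.β_sq hE).1 hy,
      (H.round.radius_strictMono.lt_iff_lt.1 hy').le⟩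

theorem relBoundary_eq (H : S.IsSmallBlock a b γ β h δ E₀) :
    relBoundary (S.energyManifold γ β h) (S.block γ β h δ) =
      {x : Phase | x.1 = S.radius a E₀ ∧ ‖x.2.2.1‖ = 1 ∧
        x.2.2.2 ^ 2 + x.2.1 ^ 2 = 2 * γ + 2 * h * δ} := by
  have ha := H.round.a_pos
  have hb := H.round.b_pos
  ext x
  rw [mem_relBoundary_iff_of_isClosed H.isCompact_block.isClosed (block_subset S γ β h δ),
    mem_ofPred_eq, ← H.δ_eq]
  constructor
  · rintro ⟨hx, hx'⟩
    rw [H.δ_eq] at hx hx'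
    obtain ⟨E, v, z, u, rfl, hE, hE', hz, hen⟩ := H.mem_block_iff.1 hx
    have hEE : E = E₀ := by
      refine hE'.eq_of_not_lt fun hlt => hx' ?_
      exact H.mem_relInterior hx.1 (H.round.radius_strictMono hlt)
    subst hEE
    exact ⟨rfl, hz, hen⟩
  · obtain ⟨r, v, z, u⟩ := x
    rintro ⟨hr, hz, hen⟩
    dsimp only at hr hz hen
    subst hr
    rw [H.δ_eq]
    refine ⟨(H.mem_block_radius_iff H.E_pos.le).2 ⟨⟨hz, hen⟩, le_rfl⟩, fun hint => ?_⟩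
    obtain ⟨O, hO, hOeq⟩ := exists_isOpen_relInterior (S.energyManifold γ β h) (S.block γ β h δ)
    have hxO : ((S.radius a E₀, v, z, u) : Phase) ∈ O := (hOeq ▸ hint).2
    have hpos := H.energy_pos H.E_pos.le le_rfl
    -- Rescaling (v, u) by k(E) keeps the point on M(h) as E grows past E₀, so a point with E = E₀
    -- is a limit of points of M(h) outside the block.
    set k : ℝ → ℝ := fun E => √((γ + h * (b ^ 2 / a * E)) / (γ + h * (b ^ 2 / a * E₀))) with hk
    have hkc : Continuous k := by
      refine Continuous.sqrt (Continuous.div_const ?_ _)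
      fun_prop
    have hk1 : k E₀ = 1 := by rw [hk]; simp only; rw [div_self hpos.ne', Real.sqrt_one]
    have hcont : Continuous fun E => ((S.radius a E, k E * v, z, k E * u) : Phase) := by
      have := continuous_radius (S := S) (a := a)
      fun_prop
    have hev : ∀ᶠ E in 𝓝[>] E₀, ((S.radius a E, k E * v, z, k E * u) : Phase) ∈ O := by
      refine (hcont.continuousAt.eventually_mem (hO.mem_nhds ?_)).filter_mono nhdsWithin_le_nhds
      rw [hk1, one_mul, one_mul]; exact hxO
    have hev2 : ∀ᶠ E in 𝓝[>] E₀, E ∈ Ioo E₀ (2 * E₀) :=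
      Ioo_mem_nhdsGT (by linarith [H.E_pos])
    obtain ⟨E, hE1, hE2⟩ := (hev.and hev2).exists
    have hE0 : 0 ≤ E := H.E_pos.le.trans hE2.1.le
    have hEpos := H.two_mul_energy_pos hE0 hE2.2.le
    have hM : ((S.radius a E, k E * v, z, k E * u) : Phase) ∈ S.energyManifold γ β h := by
      refine (H.round.mem_energyManifold_radius H.β_sq hE0).2 ⟨hz, ?_⟩
      have h1 : k E ^ 2 = (γ + h * (b ^ 2 / a * E)) / (γ + h * (b ^ 2 / a * E₀)) :=
        Real.sq_sqrt (div_nonneg (by linarith) hpos.le)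
      rw [mul_pow, mul_pow, ← mul_add, hen, h1, div_mul_eq_mul_div, div_eq_iff hpos.ne']
      ring
    have hB := relInterior_subset _ _ (hOeq.symm ▸ ⟨hM, hE1⟩ :
      ((S.radius a E, k E * v, z, k E * u) : Phase) ∈
        relInterior (S.energyManifold γ β h) (S.block γ β h δ))
    have := ((H.mem_block_radius_iff hE0).1 hB).2
    linarith [hE2.1]

theorem tangency_eq (H : S.IsSmallBlock a b γ β h δ E₀) :
    tangency (S.vectorField γ β) (S.energyManifold γ β h) (S.block γ β h δ) =
      {x : Phase | (x.1 = S.radius a E₀ ∧ ‖x.2.2.1‖ = 1 ∧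
        x.2.2.2 ^ 2 + x.2.1 ^ 2 = 2 * γ + 2 * h * δ) ∧ x.2.1 = 0} := by
  have ha := H.round.a_pos
  have hb := H.round.b_pos
  have hE₀ := H.E_pos
  have hpos := H.energy_pos H.E_pos.le le_rfl
  rw [H.δ_eq] at hpos
  ext x
  rw [tangency, mem_ofPred_eq, H.relBoundary_eq, mem_ofPred_eq, mem_ofPred_eq]
  refine and_congr_right fun hx => ?_
  obtain ⟨r, v, z, u⟩ := x
  obtain ⟨hr, hz, hen⟩ := hx
  dsimp only at hr hz hen ⊢
  subst hr
  rw [H.round.vectorField_radius H.β_sq γ hE₀.le]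
  have hq : 0 < √(1 + E₀ ^ 2) := by positivity
  constructor
  · rintro ⟨c, hc0, hc, hd⟩
    have h1 : HasDerivAt (fun t => (c t).1) (v * (b / a * (E₀ / √(1 + E₀ ^ 2)))) 0 := hd.fst
    have h2 : HasDerivAt (fun t => (c t).1) 0 0 := by
      refine (hasDerivAt_const (0 : ℝ) (S.radius a E₀)).congr_of_eventuallyEq ?_
      filter_upwards [hc] with t ht
      exact ht.1
    have h3 := h1.unique h2
    have h4 : b / a * (E₀ / √(1 + E₀ ^ 2)) ≠ 0 := by positivity
    exact (mul_eq_zero.1 h3).resolve_right h4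
  · rintro rfl
    have hu : u ≠ 0 := by
      rintro rfl
      norm_num at hen
      linarith
    -- The curve turns (v, u) along its circle at the rate κ that reproduces v'. At v = 0 both r'
    -- and u' vanish, so the other components match as well.
    set κ := (u ^ 2 * (b / √(1 + E₀ ^ 2)) + (0 ^ 2 / 2 - γ) * (b * √(1 + E₀ ^ 2))) / u with hκ
    have hlin : HasDerivAt (fun t : ℝ => κ * t) κ 0 := by
      simpa using (hasDerivAt_id (0 : ℝ)).const_mul κ
    refine ⟨fun t => (S.radius a E₀, u * Real.sin (κ * t),
      z * Complex.exp (((u * t : ℝ) : ℂ) * Complex.I), u * Real.cos (κ * t)), ?_, ?_, ?_⟩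
    · simp
    · refine Eventually.of_forall fun t => ⟨rfl, ?_, ?_⟩
      · rw [norm_mul, Complex.norm_exp_ofReal_mul_I, hz, one_mul]
      · have h1 := Real.sin_sq_add_cos_sq (κ * t)
        dsimp only
        linear_combination u ^ 2 * h1 + hen
    · refine HasDerivAt.prodMk ?_ (HasDerivAt.prodMk ?_ (HasDerivAt.prodMk ?_ ?_))
      · simpa using hasDerivAt_const (0 : ℝ) (S.radius a E₀)
      · refine (hlin.sin.const_mul u).congr_deriv ?_
        rw [mul_zero, Real.cos_zero, one_mul, hκ]
        field_simp
      · have h2 : HasDerivAt (fun t : ℝ => u * t) u 0 := by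
          simpa using (hasDerivAt_id (0 : ℝ)).const_mul u
        refine (hasDerivAt_rotate z h2).congr_deriv ?_
        simp
      · refine (hlin.cos.const_mul u).congr_deriv ?_
        simp

theorem unique (H : S.IsSmallBlock a b γ β h δ E₀) {E v u : ℝ} {z : ℂ} (hE : 0 ≤ E) {t : ℝ}
    {y y' : Phase}
    (h₁ : FlowsTo (S.vectorField γ β) (S.energyManifold γ β h) (S.radius a E, v, z, u) t y)
    (h₂ : FlowsTo (S.vectorField γ β) (S.energyManifold γ β h) (S.radius a E, v, z, u) t y') :
    y = y' :=
  H.round.flowsTo_unique H.β_sq (H.round.df_radius_pos hE) h₁ h₂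

theorem mem_block_of_boundary (H : S.IsSmallBlock a b γ β h δ E₀) {v u : ℝ} {z : ℂ} (hz : ‖z‖ = 1)
    (hen : u ^ 2 + v ^ 2 = 2 * γ + 2 * h * δ) : (S.radius a E₀, v, z, u) ∈ S.block γ β h δ :=
  (H.mem_block_radius_iff H.E_pos.le).2 ⟨⟨hz, by rw [H.δ_eq]; exact hen⟩, le_rfl⟩

/-- The local behaviour of the flow near a point of the boundary of the block. -/
theorem exists_boundary_curve (H : S.IsSmallBlock a b γ β h δ E₀) {v u : ℝ} {z : ℂ} (hz : ‖z‖ = 1)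
    (hen : u ^ 2 + v ^ 2 = 2 * γ + 2 * h * δ) :
    ∃ (c : ℝ → Phase) (s : ℝ), 0 < s ∧ (∀ t ∈ Icc (-s) s, FlowsTo (S.vectorField γ β)
        (S.energyManifold γ β h) (S.radius a E₀, v, z, u) t (c t)) ∧
      (v ≤ 0 → ∀ t ∈ Ico (-s) 0, c t ∉ S.block γ β h δ) ∧
      (0 < v → ∀ t ∈ Ico (-s) 0, c t ∈ S.block γ β h δ) ∧
      (0 ≤ v → ∀ t ∈ Ioc 0 s, c t ∉ S.block γ β h δ) ∧
      (v < 0 → ∀ t ∈ Ioc 0 s, c t ∈ S.block γ β h δ) := by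
  have hB := H.mem_block_of_boundary hz hen
  by_cases hu : u = 0
  · subst hu
    obtain ⟨c, t₁, t₂, h01, h12, heq, hc0, hv, hc⟩ := H.exists_radial H.E_pos hB
    obtain rfl := heq rfl
    rcases hv.lt_or_gt with hv | hv
    · rw [sign_neg hv] at hc
      simp only [SignType.coe_neg, SignType.coe_one, neg_one_mul] at hc
      refine ⟨c, t₂, h12, fun t ht => ?_, fun _ t ht => ?_, fun h => absurd h hv.not_gt,
        fun h => absurd h hv.not_ge, fun _ t ht => ?_⟩
      · rw [← hc0]
        refine FlowsTo.of_isIntegralCurveOn (I := Icc (-t₂) t₂) ordConnected_Icc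
          (fun s hs => (hc s (by linarith [hs.1])).1.hasDerivWithinAt)
          (fun s hs => (hc s (by linarith [hs.1])).2.1) ⟨by linarith, h12.le⟩ ht
      · rw [(hc t (by linarith [ht.1])).2.2]
        linarith [ht.2]
      · rw [(hc t (by linarith [ht.1])).2.2]
        linarith [ht.1]
    · rw [sign_pos hv] at hc
      simp only [SignType.coe_one, one_mul] at hc
      refine ⟨c, t₂, h12, fun t ht => ?_, fun h => absurd h hv.not_ge, fun _ t ht => ?_,
        fun _ t ht => ?_, fun h => absurd h hv.not_gt⟩
      · rw [← hc0]
        refine FlowsTo.of_isIntegralCurveOn (I := Icc (-t₂) t₂) ordConnected_Icc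
          (fun s hs => (hc s hs.2).1.hasDerivWithinAt)
          (fun s hs => (hc s hs.2).2.1) ⟨by linarith, h12.le⟩ ht
      · rw [(hc t (by linarith [ht.2])).2.2]
        exact ht.2.le
      · rw [(hc t ht.2).2.2]
        linarith [ht.1]
  · obtain ⟨c, t₀, t₁, t₂, t₃, η, h01, h1, h2, h23, hc, hM, hc0, hin, hout₁, hout₂, hneg, hneg',
      hpos, hpos'⟩ := H.exists_transit H.E_pos hu hB
    have hflow : ∀ t ∈ Icc t₀ t₃, FlowsTo (S.vectorField γ β)
        (S.energyManifold γ β h) (S.radius a E₀, v, z, u) t (c t) := fun t ht => by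
      rw [← hc0]
      exact FlowsTo.of_isIntegralCurveOn ordConnected_Icc hc hM ⟨by linarith, by linarith⟩ ht
    rcases lt_trichotomy v 0 with hv | hv | hv
    · have e1 := (hneg rfl hv.le).1
      have e2 := hneg' rfl hv
      have m1 := min_le_left (-t₀) t₂
      have m2 := min_le_right (-t₀) t₂
      refine ⟨c, min (-t₀) t₂, lt_min (by linarith) e2,
        fun t ht => hflow t ⟨by linarith [ht.1], by linarith [ht.2]⟩,
        fun _ t ht => hout₁ t ⟨by linarith [ht.1], by linarith [ht.2]⟩,
        fun h => absurd h hv.not_gt, fun h => absurd h hv.not_ge,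
        fun _ t ht => hin t ⟨by linarith [ht.1], by linarith [ht.2]⟩⟩
    -- At a tangency the passage degenerates to the instant t₁ = t₂ = 0, and the orbit is outside on
    -- both sides.
    · have e1 := (hneg rfl hv.le).1
      have e2 := hpos rfl hv.ge
      have m1 := min_le_left (-t₀) t₃
      have m2 := min_le_right (-t₀) t₃
      refine ⟨c, min (-t₀) t₃, lt_min (by linarith) (by linarith),
        fun t ht => hflow t ⟨by linarith [ht.1], by linarith [ht.2]⟩,
        fun _ t ht => hout₁ t ⟨by linarith [ht.1], by linarith [ht.2]⟩,
        fun h => absurd h hv.not_gt,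
        fun _ t ht => hout₂ t ⟨by linarith [ht.1], by linarith [ht.2]⟩,
        fun h => absurd h hv.not_lt⟩
    · have e1 := hpos rfl hv.le
      have e2 := hpos' rfl hv
      have m1 := min_le_left (-t₁) t₃
      have m2 := min_le_right (-t₁) t₃
      refine ⟨c, min (-t₁) t₃, lt_min (by linarith) (by linarith),
        fun t ht => hflow t ⟨by linarith [ht.1], by linarith [ht.2]⟩,
        fun h => absurd h hv.not_ge,
        fun _ t ht => hin t ⟨by linarith [ht.1], by linarith [ht.2]⟩,
        fun _ t ht => hout₂ t ⟨by linarith [ht.1], by linarith [ht.2]⟩,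
        fun h => absurd h hv.not_gt⟩

/-- Just before time 0 the orbit of a boundary point is outside for v ≤ 0 and inside for v > 0; by
uniqueness no other trajectory can behave differently. Exterior tangency is why v = 0 is included.
-/
theorem ingress_eq (H : S.IsSmallBlock a b γ β h δ E₀) :
    ingress (S.vectorField γ β) (S.energyManifold γ β h) (S.block γ β h δ) =
      {x : Phase | (x.1 = S.radius a E₀ ∧ ‖x.2.2.1‖ = 1 ∧
        x.2.2.2 ^ 2 + x.2.1 ^ 2 = 2 * γ + 2 * h * δ) ∧ x.2.1 ≤ 0} := by
  ext x
  rw [ingress, mem_ofPred_eq, H.relBoundary_eq, mem_ofPred_eq, mem_ofPred_eq]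
  refine and_congr_right fun hx => ?_
  obtain ⟨r, v, z, u⟩ := x
  obtain ⟨hr, hz, hen⟩ := hx
  dsimp only at hr hz hen ⊢
  subst hr
  obtain ⟨c, s, hs, hflow, h1, h2, -, -⟩ := H.exists_boundary_curve hz hen
  constructor
  · rintro ⟨ε, hε, hin⟩
    by_contra hv
    have hm : 0 < min (ε / 2) s := lt_min (by linarith) hs
    have hm1 := min_le_left (ε / 2) s
    have hm2 := min_le_right (ε / 2) s
    obtain ⟨y, hy, hyB⟩ := hin (-min (ε / 2) s) ⟨by linarith, by linarith⟩
    rw [H.unique H.E_pos.le hy (hflow (-min (ε / 2) s) ⟨by linarith, by linarith⟩)] at hyB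
    exact hyB (h2 (not_le.1 hv) _ ⟨by linarith, by linarith⟩)
  · intro hv
    exact ⟨s, hs, fun t ht => ⟨c t, hflow t ⟨ht.1.le, by linarith [ht.2]⟩,
      h1 hv t ⟨ht.1.le, ht.2⟩⟩⟩

theorem egress_eq (H : S.IsSmallBlock a b γ β h δ E₀) :
    egress (S.vectorField γ β) (S.energyManifold γ β h) (S.block γ β h δ) =
      {x : Phase | (x.1 = S.radius a E₀ ∧ ‖x.2.2.1‖ = 1 ∧
        x.2.2.2 ^ 2 + x.2.1 ^ 2 = 2 * γ + 2 * h * δ) ∧ 0 ≤ x.2.1} := by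
  ext x
  rw [egress, mem_ofPred_eq, H.relBoundary_eq, mem_ofPred_eq, mem_ofPred_eq]
  refine and_congr_right fun hx => ?_
  obtain ⟨r, v, z, u⟩ := x
  obtain ⟨hr, hz, hen⟩ := hx
  dsimp only at hr hz hen ⊢
  subst hr
  obtain ⟨c, s, hs, hflow, -, -, h1, h2⟩ := H.exists_boundary_curve hz hen
  constructor
  · rintro ⟨ε, hε, hin⟩
    by_contra hv
    have hm : 0 < min (ε / 2) s := lt_min (by linarith) hs
    have hm1 := min_le_left (ε / 2) s
    have hm2 := min_le_right (ε / 2) s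
    obtain ⟨y, hy, hyB⟩ := hin (min (ε / 2) s) ⟨by linarith, by linarith⟩
    rw [H.unique H.E_pos.le hy (hflow (min (ε / 2) s) ⟨by linarith, by linarith⟩)] at hyB
    exact hyB (h2 (not_le.1 hv) _ ⟨by linarith, by linarith⟩)
  · intro hv
    exact ⟨s, hs, fun t ht => ⟨c t, hflow t ⟨by linarith [ht.1], ht.2.le⟩,
      h1 hv t ⟨ht.1, ht.2.le⟩⟩⟩

/-- Points outside the collision manifold leave the block. -/
theorem mem_collisionManifold_of_orbit (H : S.IsSmallBlock a b γ β h δ E₀) {x : Phase}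
    (hx : ∀ t : ℝ, ∃ y ∈ S.block γ β h δ,
      FlowsTo (S.vectorField γ β) (S.energyManifold γ β h) x t y) :
    x ∈ S.collisionManifold γ β h := by
  have hB : x ∈ S.block γ β h δ := by
    obtain ⟨y, hy, c, -, -, h0, h1⟩ := hx 0
    rwa [← h0, h1]
  obtain ⟨E, v, z, u, rfl, hE, hE', hz, hen⟩ := H.mem_block_iff.1 hB
  rcases hE.eq_or_lt with h0 | hE0
  · subst h0
    exact ⟨hB.1, radius_zero⟩
  exfalso
  by_cases hu : u = 0
  · subst hu
    obtain ⟨c, t₁, t₂, h01, h12, heq, hc0, hv, hc⟩ := H.exists_radial hE0 hB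
    have hσ : ((SignType.sign v : SignType) : ℝ) * (SignType.sign v : ℝ) = 1 := by
      rcases hv.lt_or_gt with hv | hv
      · simp [sign_neg hv]
      · simp [sign_pos hv]
    set σ : ℝ := (SignType.sign v : ℝ)
    have hσt : σ * (σ * t₂) = t₂ := by rw [← mul_assoc, hσ, one_mul]
    -- Along a radial orbit the exit occurs forwards or backwards according to the sign of v, so the
    -- whole orbit has to be tested.
    obtain ⟨y, hyB, hy⟩ := hx (σ * t₂)
    have hI : ∀ s ∈ uIcc 0 (σ * t₂), σ * s ≤ t₂ := by
      intro s hs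
      have h2 : σ * s ∈ (fun x => σ * x) '' uIcc 0 (σ * t₂) := mem_image_of_mem _ hs
      rw [image_const_mul_uIcc, mul_zero, hσt, uIcc_of_le (h01.trans h12.le)] at h2
      exact h2.2
    have hflow : FlowsTo (S.vectorField γ β) (S.energyManifold γ β h)
        (S.radius a E, v, z, 0) (σ * t₂) (c (σ * t₂)) := by
      rw [← hc0]
      exact FlowsTo.of_isIntegralCurveOn (I := uIcc 0 (σ * t₂)) ordConnected_uIcc
        (fun s hs => (hc s (hI s hs)).1.hasDerivWithinAt) (fun s hs => (hc s (hI s hs)).2.1)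
        left_mem_uIcc right_mem_uIcc
    rw [H.unique hE hy hflow, (hc _ hσt.le).2.2, hσt] at hyB
    linarith
  · obtain ⟨c, t₀, t₁, t₂, t₃, η, h01, h1, h2, h23, hc, hM, hc0, hin, hout₁, hout₂, -⟩ :=
      H.exists_transit hE0 hu hB
    obtain ⟨y, hyB, hy⟩ := hx t₃
    have hflow : FlowsTo (S.vectorField γ β) (S.energyManifold γ β h)
        (S.radius a E, v, z, u) t₃ (c t₃) := by
      rw [← hc0]
      exact FlowsTo.of_isIntegralCurveOn ordConnected_Icc hc hM ⟨by linarith, by linarith⟩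
        ⟨by linarith, le_rfl⟩
    rw [H.unique hE hy hflow] at hyB
    exact hout₂ t₃ ⟨h23, le_rfl⟩ hyB

/-- The asymptotic ingress points are those with zero angular momentum. -/
theorem mem_asympPlus_iff (H : S.IsSmallBlock a b γ β h δ E₀) {x : Phase}
    (hx : x ∈ ingress (S.vectorField γ β) (S.energyManifold γ β h) (S.block γ β h δ)) :
    x ∈ asympPlus (S.vectorField γ β) (S.energyManifold γ β h) (S.block γ β h δ) ↔
      x.2.2.2 = 0 := by
  rw [asympPlus, mem_ofPred_eq, and_iff_right hx]
  rw [H.ingress_eq] at hx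
  obtain ⟨r, v, z, u⟩ := x
  obtain ⟨⟨hr, hz, hen⟩, hv⟩ := hx
  dsimp only at hr hz hen hv ⊢
  subst hr
  have hB := H.mem_block_of_boundary hz hen
  constructor
  · intro hfwd
    by_contra hu
    obtain ⟨c, t₀, t₁, t₂, t₃, η, h01, h1, h2, h23, hc, hM, hc0, hin, hout₁, hout₂, -⟩ :=
      H.exists_transit H.E_pos hu hB
    obtain ⟨y, hyB, hy⟩ := hfwd t₃ (by linarith)
    have hflow : FlowsTo (S.vectorField γ β) (S.energyManifold γ β h)
        (S.radius a E₀, v, z, u) t₃ (c t₃) := by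
      rw [← hc0]
      exact FlowsTo.of_isIntegralCurveOn ordConnected_Icc hc hM ⟨by linarith, by linarith⟩
        ⟨by linarith, le_rfl⟩
    rw [H.unique H.E_pos.le hy hflow] at hyB
    exact hout₂ t₃ ⟨h23, le_rfl⟩ hyB
  · rintro rfl t ht
    obtain ⟨c, t₁, t₂, h01, h12, heq, hc0, hv0, hc⟩ := H.exists_radial H.E_pos hB
    rw [sign_neg (lt_of_le_of_ne hv hv0)] at hc
    simp only [SignType.coe_neg, SignType.coe_one, neg_one_mul] at hc
    refine ⟨c t, (hc t (by linarith)).2.2.2 (by linarith), ?_⟩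
    rw [← hc0]
    exact FlowsTo.of_isIntegralCurveOn (I := Ici 0) ordConnected_Ici
      (fun s hs => (hc s (by linarith [mem_Ici.1 hs])).1.hasDerivWithinAt)
      (fun s hs => (hc s (by linarith [mem_Ici.1 hs])).2.1) self_mem_Ici ht

/-- The map across the block in terms of the phase `η` of the Runge–Lenz vector. -/
theorem exists_crossesTo_iff (H : S.IsSmallBlock a b γ β h δ E₀) {v u : ℝ} {z : ℂ} (hz : ‖z‖ = 1)
    (hen : u ^ 2 + v ^ 2 = 2 * γ + 2 * h * δ) (hv : v ≤ 0) (hu : u ≠ 0) :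
    ∃ η ∈ Icc 0 Real.pi,
      √((γ - u ^ 2 / (1 + E₀ ^ 2)) ^ 2 + u ^ 2 / (1 + E₀ ^ 2) * v ^ 2) * Real.cos η =
        γ - u ^ 2 / (1 + E₀ ^ 2) ∧
      ∀ y, CrossesTo (S.vectorField γ β) (S.energyManifold γ β h) (S.block γ β h δ)
          (S.radius a E₀, v, z, u) y ↔
        y = (S.radius a E₀, -v, z * Complex.exp
          (((SignType.sign u * (2 * Real.pi - 2 * η) / b : ℝ) : ℂ) * Complex.I), u) := by
  obtain ⟨c, t₀, t₁, t₂, t₃, η, h01, h1, h2, h23, hc, hM, hc0, hin, hout₁, hout₂, hneg, -⟩ :=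
    H.exists_transit H.E_pos hu (H.mem_block_of_boundary hz hen)
  obtain ⟨ht₁, hη, hcos, hct⟩ := hneg rfl hv
  refine ⟨η, hη, hcos, fun y => ?_⟩
  have hflow : ∀ t ∈ Icc t₀ t₃, FlowsTo (S.vectorField γ β)
      (S.energyManifold γ β h) (S.radius a E₀, v, z, u) t (c t) := fun t ht => by
    rw [← hc0]
    exact FlowsTo.of_isIntegralCurveOn ordConnected_Icc hc hM ⟨by linarith, by linarith⟩ ht
  have hT : transitTime (S.vectorField γ β) (S.energyManifold γ β h) (S.block γ β h δ)
      (S.radius a E₀, v, z, u) = t₂ := by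
    refine IsGLB.csInf_eq ⟨?_, fun w hw => ?_⟩
      ⟨t₃, by linarith, c t₃, hflow t₃ ⟨by linarith, le_rfl⟩, hout₂ t₃ ⟨h23, le_rfl⟩⟩
    · rintro t ⟨ht0, y, hy, hyB⟩
      by_contra hlt
      rw [H.unique H.E_pos.le hy (hflow t ⟨by linarith, by linarith⟩)] at hyB
      exact hyB (hin t ⟨by linarith, by linarith⟩)
    -- At time t₂ the orbit is still in the block, so t₂ is an infimum that is not attained;
    -- arbitrarily close later times are exit times.
    · refine le_of_forall_gt_imp_ge_of_dense fun t ht => ?_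
      rcases le_or_gt t t₃ with htt | htt
      · exact hw ⟨by linarith, c t, hflow t ⟨by linarith, htt⟩, hout₂ t ⟨ht, htt⟩⟩
      · exact (hw ⟨by linarith, c t₃, hflow t₃ ⟨by linarith, le_rfl⟩,
          hout₂ t₃ ⟨h23, le_rfl⟩⟩).trans htt.le
  rw [CrossesTo, hT, ← hct]
  have hf := hflow t₂ ⟨by linarith, h23.le⟩
  exact ⟨fun hy => H.unique H.E_pos.le hy hf, fun hy => hy ▸ hf⟩

theorem isInvariantSet_collisionManifold (H : S.IsSmallBlock a b γ β h δ E₀) :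
    IsInvariantSet (S.vectorField γ β) (S.energyManifold γ β h) (S.collisionManifold γ β h) := by
  have hflow : ∀ x ∈ S.collisionManifold γ β h, ∀ t : ℝ, ∃ y ∈ S.collisionManifold γ β h,
      FlowsTo (S.vectorField γ β) (S.energyManifold γ β h) x t y := fun x hx t => by
    obtain ⟨c, hc0, hc⟩ := exists_collision_curve H.round H.β_sq H.γ_pos hx
    exact ⟨c t, (hc t).2, c, fun s _ => (hc s).1.hasDerivWithinAt, fun s _ => (hc s).2.1, hc0, rfl⟩
  refine ⟨fun x hx t => (hflow x hx t).imp fun y hy => hy.2, Subset.antisymm ?_ fun x hx => ?_⟩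
  · rintro y ⟨x, hx, t, hy⟩
    obtain ⟨y', hy', hxy⟩ := hflow x hx t
    have hd : 0 < S.df x.1 := by
      rw [hx.2, ← radius_zero (S := S) (a := a)]
      exact H.round.df_radius_pos le_rfl
    rwa [H.round.flowsTo_unique H.β_sq hd hy hxy]
  -- Any curve is an integral curve on the degenerate interval {0}, so the constant one serves for
  -- time 0.
  · exact ⟨x, hx, 0, fun _ => x, fun s hs => by
      rw [uIcc_self] at hs
      obtain rfl := hs
      exact hasDerivWithinAt_iff_hasFDerivWithinAt.2
        (.of_subsingleton (by rw [uIcc_self]; exact subsingleton_singleton)), fun _ _ => hx.1, rfl, rfl⟩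

theorem isIsolatingNeighborhood (H : S.IsSmallBlock a b γ β h δ E₀) :
    IsIsolatingNeighborhood (S.vectorField γ β) (S.energyManifold γ β h)
      (S.collisionManifold γ β h) (relInterior (S.energyManifold γ β h) (S.block γ β h δ)) := by
  refine ⟨exists_isOpen_relInterior _ _, fun x hx => H.mem_relInterior hx.1 ?_, fun x _ hx => ?_⟩
  · rw [hx.2]
    conv_lhs => rw [← radius_zero (S := S) (a := a)]
    exact H.round.radius_strictMono H.E_pos
  · refine H.mem_collisionManifold_of_orbit fun t => ?_
    obtain ⟨y, hy, hf⟩ := hx t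
    exact ⟨y, relInterior_subset _ _ hy, hf⟩

theorem isIsolatedInvariantSet (H : S.IsSmallBlock a b γ β h δ E₀) :
    IsIsolatedInvariantSet (S.vectorField γ β) (S.energyManifold γ β h)
      (S.collisionManifold γ β h) :=
  ⟨fun _ hx => hx.1, H.round.isCompact_collisionManifold H.β_sq γ h,
    H.isInvariantSet_collisionManifold, _, H.isIsolatingNeighborhood⟩

theorem isolates (H : S.IsSmallBlock a b γ β h δ E₀) :
    Isolates (S.vectorField γ β) (S.energyManifold γ β h) 2 (S.block γ β h δ)
      (S.collisionManifold γ β h) := by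
  have hpos : 0 < 2 * γ + 2 * h * δ := by
    have := H.energy_pos H.E_pos.le le_rfl
    rw [H.δ_eq] at this
    linarith
  refine ⟨H.isIsolatedInvariantSet, ⟨block_subset S γ β h δ, H.isCompact_block, ?_, ?_, ?_, ?_⟩,
    H.isIsolatingNeighborhood⟩
  · refine ⟨(S.radius a 0, √(2 * γ), 1, 0), H.isIsolatingNeighborhood.2.1 ⟨?_, radius_zero⟩⟩
    refine (H.round.mem_energyManifold_radius H.β_sq le_rfl).2 ⟨norm_one, ?_⟩
    rw [Real.sq_sqrt (by linarith [H.γ_pos])]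
    ring
  · rw [H.relBoundary_eq]
    exact isSmoothSubmanifold_torus hpos
  · rw [H.tangency_eq, H.ingress_eq, H.egress_eq]
    ext x
    simp only [mem_inter_iff, mem_ofPred_eq]
    constructor
    · rintro ⟨hx, h0⟩
      exact ⟨⟨hx, h0.le⟩, hx, h0.ge⟩
    · rintro ⟨⟨hx, h1⟩, -, h2⟩
      exact ⟨hx, le_antisymm h1 h2⟩
  · rw [H.tangency_eq]
    exact isSmoothSubmanifold_circles hpos

end IsSmallBlock

end SphericalSurface

theorem IsSmoothMap.continuous {E F : Type*} [NormedAddCommGroup E] [NormedSpace ℝ E]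
    [NormedAddCommGroup F] [NormedSpace ℝ F] {A : Set E} {A' : Set F} {φ : A → A'}
    (hφ : IsSmoothMap φ) : Continuous fun x => (φ x : F) := by
  refine continuous_iff_continuousAt.2 fun x => ?_
  obtain ⟨U, hU, hx, G, hG, hGe⟩ := hφ x
  have h1 : ContinuousAt (fun y : A => G y) x :=
    (hG.continuousOn.continuousAt (hU.mem_nhds hx)).comp continuous_subtype_val.continuousAt
  refine h1.congr ?_
  filter_upwards [(hU.preimage continuous_subtype_val).mem_nhds hx] with y hy
  exact (hGe y hy).symm

/-! ### Phase formulas and the smooth extension of the crossing map. -/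

namespace SphericalSurface

open IsRound

/-- First component of the Runge–Lenz vector in the rotating frame, on the boundary of a block. -/
noncomputable def lenzX (γ E₀ u : ℝ) : ℝ := γ - u ^ 2 / (1 + E₀ ^ 2)

/-- Second component of the Runge–Lenz vector in the rotating frame, on the boundary of a block. -/
noncomputable def lenzY (E₀ v u : ℝ) : ℝ := u * v / √(1 + E₀ ^ 2)

/-- Sign of the angular momentum, with value `-1` at zero. -/
noncomputable def side (u : ℝ) : ℝ := if u ≤ 0 then -1 else 1

theorem side_sq (u : ℝ) : side u ^ 2 = 1 := by
  unfold side; split_ifs <;> norm_num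

theorem side_mul_nonneg (u : ℝ) : 0 ≤ side u * u := by
  unfold side; split_ifs with h <;> linarith

theorem side_of_ne {u : ℝ} (hu : u ≠ 0) : (SignType.sign u : ℝ) = side u := by
  rcases hu.lt_or_gt with h | h
  · simp [side, h.le, sign_neg h]
  · simp [side, h.not_ge, sign_pos h]

theorem lenzY_sq (E₀ v u : ℝ) : lenzY E₀ v u ^ 2 = u ^ 2 / (1 + E₀ ^ 2) * v ^ 2 := by
  rw [lenzY, div_pow, mul_pow, Real.sq_sqrt (by positivity)]; ring

/-- The cosine determines `lenzY` up to sign, and v ≤ 0 makes that sign opposite to the sign of u.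
-/
theorem lenz_sin {γ E₀ v u η : ℝ} (hv : v ≤ 0) (hη : η ∈ Icc 0 Real.pi)
    (hcos : √(lenzX γ E₀ u ^ 2 + lenzY E₀ v u ^ 2) * Real.cos η = lenzX γ E₀ u) :
    lenzY E₀ v u = -(side u * (√(lenzX γ E₀ u ^ 2 + lenzY E₀ v u ^ 2) * Real.sin η)) := by
  set D := √(lenzX γ E₀ u ^ 2 + lenzY E₀ v u ^ 2) with hD
  have hD2 : D ^ 2 = lenzX γ E₀ u ^ 2 + lenzY E₀ v u ^ 2 := Real.sq_sqrt (by positivity)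
  have h1 : 0 ≤ D * Real.sin η :=
    mul_nonneg (Real.sqrt_nonneg _) (Real.sin_nonneg_of_nonneg_of_le_pi hη.1 hη.2)
  have h2 : 0 ≤ -(side u * lenzY E₀ v u) := by
    have h3 : side u * lenzY E₀ v u = side u * u * v / √(1 + E₀ ^ 2) := by rw [lenzY]; ring
    rw [h3, ← neg_div, ← mul_neg]
    exact div_nonneg (mul_nonneg (side_mul_nonneg u) (by linarith)) (Real.sqrt_nonneg _)
  have h3 : (-(side u * lenzY E₀ v u)) ^ 2 = (D * Real.sin η) ^ 2 := by
    rw [neg_sq, mul_pow, side_sq, mul_pow, Real.sin_sq]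
    have : (D * Real.cos η) ^ 2 = lenzX γ E₀ u ^ 2 := by rw [hcos]
    linear_combination this - hD2
  have h4 := (pow_left_inj₀ h2 h1 two_ne_zero).1 h3
  rw [← h4]
  linear_combination -lenzY E₀ v u * side_sq u

theorem exists_lenz_phase {γ E₀ v u : ℝ} (hpos : 0 < lenzX γ E₀ u ^ 2 + lenzY E₀ v u ^ 2) :
    ∃ η ∈ Icc 0 Real.pi,
      √(lenzX γ E₀ u ^ 2 + lenzY E₀ v u ^ 2) * Real.cos η = lenzX γ E₀ u := by
  have hD := Real.sqrt_pos.2 hpos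
  have h1 : |lenzX γ E₀ u| ≤ √(lenzX γ E₀ u ^ 2 + lenzY E₀ v u ^ 2) :=
    Real.abs_le_sqrt (by linarith [sq_nonneg (lenzY E₀ v u)])
  have h2 := abs_le.1 h1
  refine ⟨Real.arccos (lenzX γ E₀ u / √(lenzX γ E₀ u ^ 2 + lenzY E₀ v u ^ 2)),
    ⟨Real.arccos_nonneg _, Real.arccos_le_pi _⟩, ?_⟩
  rw [Real.cos_arccos (by rw [le_div_iff₀ hD]; linarith) (by rw [div_le_iff₀ hD]; linarith)]
  field_simp

/-- The energy relation turns 2γ + 2hδ - u² into v², after which numerator and denominator are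
`lenzX` and the norm of (`lenzX`, `lenzY`), both divided by b. -/
theorem sinPhase_eq {γ β h δ b E₀ v u η : ℝ} (hb : 0 < b) (hβ : |β| = b)
    (hen : u ^ 2 + v ^ 2 = 2 * γ + 2 * h * δ)
    (hpos : 0 < lenzX γ E₀ u ^ 2 + lenzY E₀ v u ^ 2)
    (hcos : √(lenzX γ E₀ u ^ 2 + lenzY E₀ v u ^ 2) * Real.cos η = lenzX γ E₀ u) :
    sinPhase γ β h δ (1 / (b * √(1 + E₀ ^ 2))) u = Real.cos η := by
  have hD := Real.sqrt_pos.2 hpos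
  have hk : (1 / (b * √(1 + E₀ ^ 2))) ^ 2 = 1 / (b ^ 2 * (1 + E₀ ^ 2)) := by
    rw [div_pow, mul_pow, Real.sq_sqrt (by positivity), one_pow]
  have hv : 2 * γ + 2 * h * δ - u ^ 2 = v ^ 2 := by linarith
  have h1 : γ / b - b * (1 / (b ^ 2 * (1 + E₀ ^ 2))) * u ^ 2 = lenzX γ E₀ u / b := by
    rw [lenzX]; field_simp
  have h2 : 1 / (b ^ 2 * (1 + E₀ ^ 2)) * v ^ 2 * u ^ 2 + (lenzX γ E₀ u / b) ^ 2 =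
      (lenzX γ E₀ u ^ 2 + lenzY E₀ v u ^ 2) / b ^ 2 := by
    rw [lenzY_sq]; field_simp; ring
  rw [sinPhase, hβ, hk, hv, h1, h2, Real.sqrt_div hpos.le, Real.sqrt_sq hb.le,
    div_div_div_cancel_right₀ hb.ne', div_eq_iff hD.ne', mul_comm]
  exact hcos.symm

theorem arcsin_cos {η : ℝ} (hη : η ∈ Icc 0 Real.pi) :
    Real.arcsin (Real.cos η) = Real.pi / 2 - η := by
  rw [Real.arcsin_eq_pi_div_two_sub_arccos, Real.arccos_cos hη.1 hη.2]

theorem zeta_eq {γ β h δ b k u η : ℝ} (hβ : |β| = b) (hη : η ∈ Icc 0 Real.pi)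
    (hs : sinPhase γ β h δ k u = Real.cos η) :
    zeta γ β h δ k u = (Real.pi / 2 + side u * η) / b := by
  rw [zeta, hs, arcsin_cos hη, hβ, side]
  split_ifs <;> ring

/-- The extra 4π/b for u > 0 makes the two branches odd reflections of each other, so the formula
agrees with the turning angle of the explicit orbit. -/
theorem GammaTilde_eq {γ β h δ b k u η : ℝ} (hβ : |β| = b) (hη : η ∈ Icc 0 Real.pi)
    (hs : sinPhase γ β h δ k u = Real.cos η) :
    GammaTilde γ β h δ k u = side u * (2 * Real.pi - 2 * η) / b := by
  rw [GammaTilde, zeta_eq hβ hη hs, hβ, side]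
  split_ifs <;> ring

/-- The extended map across the block. -/
noncomputable def blockMap (γ E₀ : ℝ) (m : ℕ) (x : Phase) : Phase :=
  (x.1, -x.2.1, x.2.2.1 * (-(((lenzX γ E₀ x.2.2.2 : ℝ) : ℂ) +
    ((lenzY E₀ x.2.1 x.2.2.2 : ℝ) : ℂ) * Complex.I) /
    ((√(lenzX γ E₀ x.2.2.2 ^ 2 + lenzY E₀ x.2.1 x.2.2.2 ^ 2) : ℝ) : ℂ)) ^ m, x.2.2.2)

/-- This is where b = 2/m enters: the angle is m times side(u)(π - η), and the rotation by side(u)(π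
- η) is -(X + iY)/D, an expression with no case distinction at u = 0. -/
theorem reflectRotate_eq_blockMap {γ β h δ b E₀ r v u : ℝ} {z : ℂ} {m : ℕ} (hm : 0 < m)
    (hb : 0 < b) (hβ : |β| = b) (hbm : b = 2 / m) (hv : v ≤ 0)
    (hen : u ^ 2 + v ^ 2 = 2 * γ + 2 * h * δ)
    (hpos : 0 < lenzX γ E₀ u ^ 2 + lenzY E₀ v u ^ 2) :
    reflectRotate (GammaTilde γ β h δ (1 / (b * √(1 + E₀ ^ 2)))) (r, v, z, u) =
      blockMap γ E₀ m (r, v, z, u) := by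
  obtain ⟨η, hη, hcos⟩ := exists_lenz_phase hpos
  have hD := Real.sqrt_pos.2 hpos
  have hsin := lenz_sin hv hη hcos
  have hG := GammaTilde_eq hβ hη (sinPhase_eq hb hβ hen hpos hcos)
  have hm' : (m : ℝ) ≠ 0 := by positivity
  simp only [reflectRotate, blockMap]
  rw [hG]
  congr 3
  set D := √(lenzX γ E₀ u ^ 2 + lenzY E₀ v u ^ 2) with hDdef
  have h1 : ((side u * (2 * Real.pi - 2 * η) / b : ℝ) : ℂ) * Complex.I =
      (m : ℂ) * (((side u * (Real.pi - η) : ℝ) : ℂ) * Complex.I) := by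
    rw [show side u * (2 * Real.pi - 2 * η) / b = m * (side u * (Real.pi - η)) by
      rw [hbm]; field_simp]
    push_cast; ring
  rw [h1, Complex.exp_nat_mul]
  congr 2
  have h2 : Real.cos (side u * (Real.pi - η)) = -Real.cos η ∧
      Real.sin (side u * (Real.pi - η)) = side u * Real.sin η := by
    unfold side
    split_ifs
    · rw [neg_one_mul, neg_one_mul, Real.cos_neg, Real.sin_neg, Real.cos_pi_sub, Real.sin_pi_sub]
      exact ⟨rfl, rfl⟩
    · rw [one_mul, one_mul, Real.cos_pi_sub, Real.sin_pi_sub]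
      exact ⟨rfl, rfl⟩
  rw [Complex.exp_mul_I, ← Complex.ofReal_cos, ← Complex.ofReal_sin, h2.1, h2.2, hsin, ← hcos]
  have hDc : (D : ℂ) ≠ 0 := Complex.ofReal_ne_zero.2 hD.ne'
  rw [eq_div_iff hDc]
  push_cast
  ring

theorem contDiffAt_blockMap {γ E₀ : ℝ} {m : ℕ} {x : Phase}
    (hx : lenzX γ E₀ x.2.2.2 ^ 2 + lenzY E₀ x.2.1 x.2.2.2 ^ 2 ≠ 0) :
    ContDiffAt ℝ ∞ (blockMap γ E₀ m) x := by
  have hr : ContDiffAt ℝ ∞ (fun x : Phase => x.1) x := by fun_prop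
  have hv : ContDiffAt ℝ ∞ (fun x : Phase => x.2.1) x := by fun_prop
  have hu : ContDiffAt ℝ ∞ (fun x : Phase => x.2.2.2) x := by fun_prop
  have hz : ContDiffAt ℝ ∞ (fun x : Phase => x.2.2.1) x := by fun_prop
  have hX : ContDiffAt ℝ ∞ (fun x : Phase => lenzX γ E₀ x.2.2.2) x :=
    contDiffAt_const.sub ((hu.pow 2).div_const _)
  have hY : ContDiffAt ℝ ∞ (fun x : Phase => lenzY E₀ x.2.1 x.2.2.2) x := (hu.mul hv).div_const _
  have hD := ((hX.pow 2).add (hY.pow 2)).sqrt hx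
  have hc : ∀ {g : Phase → ℝ}, ContDiffAt ℝ ∞ g x → ContDiffAt ℝ ∞ (fun x => (g x : ℂ)) x :=
    fun hg => Complex.ofRealCLM.contDiff.contDiffAt.comp x hg
  have hD0 : ((√(lenzX γ E₀ x.2.2.2 ^ 2 + lenzY E₀ x.2.1 x.2.2.2 ^ 2) : ℝ) : ℂ) ≠ 0 := by
    rw [Complex.ofReal_ne_zero, Real.sqrt_ne_zero']
    exact lt_of_le_of_ne (by positivity) hx.symm
  have hfac : ContDiffAt ℝ ∞ (fun x : Phase => -(((lenzX γ E₀ x.2.2.2 : ℝ) : ℂ) +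
      ((lenzY E₀ x.2.1 x.2.2.2 : ℝ) : ℂ) * Complex.I) /
      ((√(lenzX γ E₀ x.2.2.2 ^ 2 + lenzY E₀ x.2.1 x.2.2.2 ^ 2) : ℝ) : ℂ)) x := by
    simp only [div_eq_mul_inv]
    exact ((hc hX).add ((hc hY).mul contDiffAt_const)).neg.mul ((hc hD).inv hD0)
  exact hr.prodMk (hv.neg.prodMk ((hz.mul (hfac.pow m)).prodMk hu))

theorem isOpen_lenz_ne_zero (γ E₀ : ℝ) :
    IsOpen {x : Phase | lenzX γ E₀ x.2.2.2 ^ 2 + lenzY E₀ x.2.1 x.2.2.2 ^ 2 ≠ 0} := by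
  refine isOpen_ne.preimage (f := fun x : Phase =>
    lenzX γ E₀ x.2.2.2 ^ 2 + lenzY E₀ x.2.1 x.2.2.2 ^ 2) ?_
  have h1 : Continuous fun x : Phase => x.2.2.2 ^ 2 / (1 + E₀ ^ 2) :=
    Continuous.div_const (by fun_prop) _
  have h2 : Continuous fun x : Phase => x.2.2.2 * x.2.1 / √(1 + E₀ ^ 2) :=
    Continuous.div_const (by fun_prop) _
  exact ((continuous_const.sub h1).pow 2).add (h2.pow 2)

theorem lenz_factor_mul {p q D : ℝ} (hD : 0 < D) (h : D ^ 2 = q ^ 2 + p ^ 2) :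
    (-((q : ℂ) + (p : ℂ) * Complex.I) / (D : ℂ)) *
      (-((q : ℂ) + ((-p : ℝ) : ℂ) * Complex.I) / (D : ℂ)) = 1 := by
  have hD' : (D : ℂ) ≠ 0 := Complex.ofReal_ne_zero.2 hD.ne'
  have h' : (D : ℂ) ^ 2 = (q : ℂ) ^ 2 + (p : ℂ) ^ 2 := by exact_mod_cast congrArg Complex.ofReal h
  rw [div_mul_div_comm, div_eq_one_iff_eq (mul_ne_zero hD' hD')]
  push_cast
  linear_combination -(p : ℂ) ^ 2 * Complex.I_sq - h'

theorem norm_lenz_factor {p q D : ℝ} (hD : 0 < D) (h : D ^ 2 = q ^ 2 + p ^ 2) :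
    ‖-((q : ℂ) + (p : ℂ) * Complex.I) / (D : ℂ)‖ = 1 := by
  rw [norm_div, norm_neg, Complex.norm_add_mul_I, ← h, Real.sqrt_sq hD.le, Complex.norm_real,
    Real.norm_eq_abs, abs_of_pos hD, div_self hD.ne']

/-- Reversing v changes the sign of `lenzY`, hence conjugates the unit factor and inverts it. The
inverse of the crossing map is therefore given by the same smooth formula. -/
theorem blockMap_blockMap {γ E₀ : ℝ} {m : ℕ} {x : Phase}
    (hx : 0 < lenzX γ E₀ x.2.2.2 ^ 2 + lenzY E₀ x.2.1 x.2.2.2 ^ 2) :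
    blockMap γ E₀ m (blockMap γ E₀ m x) = x := by
  obtain ⟨r, v, z, u⟩ := x
  have hY : lenzY E₀ (-v) u = -lenzY E₀ v u := by unfold lenzY; ring
  simp only [blockMap] at hx ⊢
  rw [hY, neg_sq, mul_assoc, ← mul_pow,
    lenz_factor_mul (Real.sqrt_pos.2 hx) (Real.sq_sqrt hx.le), one_pow, mul_one, neg_neg]

/-- The Runge–Lenz vector on the boundary of a block, in polar form. -/
theorem rungeLenz_polar {S : SphericalSurface} {γ β h δ b E₀ r v u : ℝ} (θ : ℝ)
    (hb : 0 < b) (hβ : |β| = b) (hv : v ≤ 0) (hen : u ^ 2 + v ^ 2 = 2 * γ + 2 * h * δ)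
    (hpos : 0 < lenzX γ E₀ u ^ 2 + lenzY E₀ v u ^ 2) (hΘ : S.Theta β r < 0)
    (hk : |S.Theta β r| * S.f r = 1 / (b * √(1 + E₀ ^ 2))) :
    0 < S.rungeLenzNorm γ β r v θ u ∧
    S.rungeLenz₁ γ β r v θ u = S.rungeLenzNorm γ β r v θ u *
      Real.sin (β * (θ - zeta γ β h δ (|S.Theta β r| * S.f r) u)) ∧
    S.rungeLenz₂ γ β r v θ u = -(S.rungeLenzNorm γ β r v θ u *
      Real.cos (β * (θ - zeta γ β h δ (|S.Theta β r| * S.f r) u))) := by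
  obtain ⟨η, hη, hcos⟩ := exists_lenz_phase hpos
  have hD := Real.sqrt_pos.2 hpos
  have hsin := lenz_sin hv hη hcos
  have hζ := zeta_eq hβ hη (sinPhase_eq hb hβ hen hpos hcos)
  rw [hk, hζ]
  set D := √(lenzX γ E₀ u ^ 2 + lenzY E₀ v u ^ 2) with hDdef
  have hD2 : D ^ 2 = lenzX γ E₀ u ^ 2 + lenzY E₀ v u ^ 2 := Real.sq_sqrt hpos.le
  -- The integrals involve β while ζ involves |β|; the sign ε is carried along so that both cases
  -- are treated at once.
  obtain ⟨ε, hε, hβε⟩ : ∃ ε : ℝ, (ε = 1 ∨ ε = -1) ∧ β = ε * b := by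
    rcases abs_choice β with h | h
    · exact ⟨1, Or.inl rfl, by rw [← hβ, h, one_mul]⟩
    · exact ⟨-1, Or.inr rfl, by rw [← hβ, h]; ring⟩
  have hε2 : ε ^ 2 = 1 := by rcases hε with h | h <;> rw [h] <;> norm_num
  have hεi : ε ≠ 0 := by rintro rfl; norm_num at hε2
  have hang : β * (θ - (Real.pi / 2 + side u * η) / b) =
      β * θ - ε * (Real.pi / 2 + side u * η) := by rw [hβε]; field_simp
  have hside : Real.cos (side u * η) = Real.cos η ∧
      Real.sin (side u * η) = side u * Real.sin η := by
    unfold side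
    split_ifs
    · rw [neg_one_mul, neg_one_mul, Real.cos_neg, Real.sin_neg]
      exact ⟨rfl, rfl⟩
    · rw [one_mul, one_mul]
      exact ⟨rfl, rfl⟩
  have h1 : D * Real.sin (ε * (Real.pi / 2 + side u * η)) = ε * lenzX γ E₀ u := by
    have : Real.sin (ε * (Real.pi / 2 + side u * η)) = ε * Real.cos η := by
      rcases hε with h | h <;> rw [h]
      · rw [one_mul, one_mul, add_comm, Real.sin_add_pi_div_two, hside.1]
      · rw [neg_one_mul, neg_one_mul, Real.sin_neg, add_comm, Real.sin_add_pi_div_two, hside.1]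
    rw [this, ← hcos]; ring
  have h2 : D * Real.cos (ε * (Real.pi / 2 + side u * η)) = lenzY E₀ v u := by
    have : Real.cos (ε * (Real.pi / 2 + side u * η)) = -(side u * Real.sin η) := by
      rcases hε with h | h <;> rw [h]
      · rw [one_mul, add_comm, Real.cos_add_pi_div_two, hside.2]
      · rw [neg_one_mul, Real.cos_neg, add_comm, Real.cos_add_pi_div_two, hside.2]
    rw [this, hsin]; ring
  have hq : 0 < √(1 + E₀ ^ 2) := by positivity
  have hqq : √(1 + E₀ ^ 2) ^ 2 = 1 + E₀ ^ 2 := Real.sq_sqrt (by positivity)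
  have hΘf : S.Theta β r * S.f r = -(1 / (b * √(1 + E₀ ^ 2))) := by
    rw [← hk, abs_of_neg hΘ]; ring
  have hP : |S.Theta β r| * S.f r * u * v = lenzY E₀ v u / b := by
    rw [hk, lenzY]; field_simp
  have hQ : β * S.Theta β r * |S.Theta β r| * S.f r ^ 2 * u ^ 2 + γ / β =
      ε * lenzX γ E₀ u / b := by
    have h3 : β * S.Theta β r * |S.Theta β r| * S.f r ^ 2 * u ^ 2 =
        β * (S.Theta β r * S.f r) * (|S.Theta β r| * S.f r) * u ^ 2 := by ring
    have h4 : γ / β = ε * γ / b := by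
      rw [hβε, div_eq_div_iff (by positivity) hb.ne']
      linear_combination -γ * b * hε2
    have h5 : β * -(1 / (b * √(1 + E₀ ^ 2))) * (1 / (b * √(1 + E₀ ^ 2))) * u ^ 2 =
        -(ε * (u ^ 2 / (1 + E₀ ^ 2)) / b) := by
      generalize √(1 + E₀ ^ 2) = q at hq hqq ⊢
      rw [hβε, ← hqq]
      field_simp
    rw [h3, hΘf, hk, h4, h5, lenzX]; ring
  have hR1 : S.rungeLenz₁ γ β r v θ u =
      D / b * Real.sin (β * θ - ε * (Real.pi / 2 + side u * η)) := by
    rw [rungeLenz₁, Real.sin_sub]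
    linear_combination Real.sin (β * θ) * hP - Real.cos (β * θ) * hQ -
      Real.sin (β * θ) / b * h2 + Real.cos (β * θ) / b * h1
  have hR2 : S.rungeLenz₂ γ β r v θ u =
      -(D / b * Real.cos (β * θ - ε * (Real.pi / 2 + side u * η))) := by
    rw [rungeLenz₂, Real.cos_sub]
    linear_combination -Real.cos (β * θ) * hP - Real.sin (β * θ) * hQ +
      Real.cos (β * θ) / b * h2 + Real.sin (β * θ) / b * h1
  have hN : S.rungeLenzNorm γ β r v θ u = D / b := by
    rw [rungeLenzNorm, hR1, hR2, neg_sq, mul_pow, mul_pow, ← mul_add, Real.sin_sq_add_cos_sq,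
      mul_one, Real.sqrt_sq (by positivity)]
  rw [hN, hang]
  exact ⟨by positivity, hR1, hR2⟩

namespace IsSmallBlock

variable {S : SphericalSurface} {a b γ β h δ E₀ : ℝ}

/-- Vanishing of both components would force v = 0 and u² = γ(1 + E₀²), which `tangency_pos` forbids
on the boundary. -/
theorem lenz_pos (H : S.IsSmallBlock a b γ β h δ E₀) {v u : ℝ}
    (hen : u ^ 2 + v ^ 2 = 2 * γ + 2 * h * δ) :
    0 < lenzX γ E₀ u ^ 2 + lenzY E₀ v u ^ 2 := by
  refine lt_of_le_of_ne (by positivity) fun h0 => ?_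
  have hγ := H.γ_pos
  have h1 : lenzX γ E₀ u = 0 := by nlinarith [sq_nonneg (lenzX γ E₀ u), sq_nonneg (lenzY E₀ v u)]
  have h2 : lenzY E₀ v u = 0 := by nlinarith [sq_nonneg (lenzX γ E₀ u), sq_nonneg (lenzY E₀ v u)]
  rw [lenzX, sub_eq_zero, eq_div_iff (by positivity)] at h1
  have hu : u ≠ 0 := by
    rintro rfl
    have : 0 < γ * (1 + E₀ ^ 2) := by positivity
    norm_num [h1] at this
  have hv : v = 0 := by
    rw [lenzY, div_eq_zero_iff] at h2
    have hq : √(1 + E₀ ^ 2) ≠ 0 := by positivity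
    exact (mul_eq_zero.1 (h2.resolve_right hq)).resolve_left hu
  have h3 := H.tangency_pos
  rw [hv] at hen
  linarith

theorem abs_Theta_mul_f (H : S.IsSmallBlock a b γ β h δ E₀) :
    S.Theta β (S.radius a E₀) < 0 ∧
    |S.Theta β (S.radius a E₀)| * S.f (S.radius a E₀) = 1 / (b * √(1 + E₀ ^ 2)) := by
  have hb := H.round.b_pos
  have hI := H.round.radius_mem_Ioo H.E_pos
  have hf : 0 < S.f (S.radius a E₀) :=
    lt_of_le_of_ne (S.nonneg _ (Ioo_subset_Icc_self hI)) (S.f_ne_zero hI).symm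
  have h1 := S.fTheta_eq (β := β) hI
  rw [H.round.fTheta_radius H.β_sq H.E_pos.le] at h1
  have h2 : 0 < 1 / (b * √(1 + E₀ ^ 2)) := by positivity
  have h3 : S.Theta β (S.radius a E₀) < 0 := by
    by_contra hn
    have := mul_nonneg hf.le (not_lt.1 hn)
    linarith
  refine ⟨h3, ?_⟩
  rw [abs_of_neg h3]
  linarith

theorem abs_Theta_inv (H : S.IsSmallBlock a b γ β h δ E₀) :
    |S.Theta β (S.radius a E₀)|⁻¹ = δ := by
  rw [← abs_inv, ← S.invTheta_eq, H.round.invTheta_radius H.β_sq H.E_pos.le, abs_neg, H.δ_eq,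
    abs_of_pos H.δ_pos]

theorem crossesTo_iff (H : S.IsSmallBlock a b γ β h δ E₀) (hβ : |β| = b) {x : Phase}
    (hx : x ∈ ingress (S.vectorField γ β) (S.energyManifold γ β h) (S.block γ β h δ))
    (hxa : x ∉ asympPlus (S.vectorField γ β) (S.energyManifold γ β h) (S.block γ β h δ))
    (y : Phase) :
    CrossesTo (S.vectorField γ β) (S.energyManifold γ β h) (S.block γ β h δ) x y ↔
      y = reflectRotate (GammaTilde γ β h δ (1 / (b * √(1 + E₀ ^ 2)))) x := by
  rw [H.mem_asympPlus_iff hx] at hxa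
  rw [H.ingress_eq] at hx
  obtain ⟨r, v, z, u⟩ := x
  obtain ⟨⟨hr, hz, hen⟩, hv⟩ := hx
  dsimp only at hr hz hen hv hxa
  subst hr
  obtain ⟨η, hη, hcos, hc⟩ := H.exists_crossesTo_iff hz hen hv hxa
  rw [← lenzY_sq] at hcos
  rw [hc, side_of_ne hxa, ← GammaTilde_eq hβ hη
    (sinPhase_eq H.round.b_pos hβ hen (H.lenz_pos hen) hcos)]
  rfl

theorem mapsTo_blockMap (H : S.IsSmallBlock a b γ β h δ E₀) (m : ℕ) {x : Phase}
    (hx : x.1 = S.radius a E₀ ∧ ‖x.2.2.1‖ = 1 ∧ x.2.2.2 ^ 2 + x.2.1 ^ 2 = 2 * γ + 2 * h * δ) :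
    (blockMap γ E₀ m x).1 = S.radius a E₀ ∧ ‖(blockMap γ E₀ m x).2.2.1‖ = 1 ∧
      (blockMap γ E₀ m x).2.2.2 ^ 2 + (blockMap γ E₀ m x).2.1 ^ 2 = 2 * γ + 2 * h * δ := by
  have hpos := H.lenz_pos hx.2.2
  refine ⟨hx.1, ?_, ?_⟩
  · simp only [blockMap]
    rw [norm_mul, hx.2.1, norm_pow,
      norm_lenz_factor (Real.sqrt_pos.2 hpos) (Real.sq_sqrt hpos.le), one_pow, one_mul]
  · simp only [blockMap, neg_sq]
    exact hx.2.2

/-- The extended map across the block as a bijection from ingress to egress points. -/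
noncomputable def blockEquiv (H : S.IsSmallBlock a b γ β h δ E₀) (m : ℕ) :
    ingress (S.vectorField γ β) (S.energyManifold γ β h) (S.block γ β h δ) ≃
      egress (S.vectorField γ β) (S.energyManifold γ β h) (S.block γ β h δ) where
  toFun x := ⟨blockMap γ E₀ m x, by
    have hx := H.ingress_eq.subset x.2
    rw [H.egress_eq]
    exact ⟨H.mapsTo_blockMap m hx.1, neg_nonneg.2 hx.2⟩⟩
  invFun x := ⟨blockMap γ E₀ m x, by
    have hx := H.egress_eq.subset x.2
    rw [H.ingress_eq]
    exact ⟨H.mapsTo_blockMap m hx.1, neg_nonpos.2 hx.2⟩⟩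
  left_inv x := by
    have hx := H.ingress_eq.subset x.2
    exact Subtype.ext (blockMap_blockMap (H.lenz_pos hx.1.2.2))
  right_inv x := by
    have hx := H.egress_eq.subset x.2
    exact Subtype.ext (blockMap_blockMap (H.lenz_pos hx.1.2.2))

theorem isDiffeo_blockEquiv (H : S.IsSmallBlock a b γ β h δ E₀) (m : ℕ) :
    IsDiffeo (H.blockEquiv m) := by
  have hsm : ContDiffOn ℝ ∞ (blockMap γ E₀ m)
      {x : Phase | lenzX γ E₀ x.2.2.2 ^ 2 + lenzY E₀ x.2.1 x.2.2.2 ^ 2 ≠ 0} :=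
    fun x hx => (contDiffAt_blockMap hx).contDiffWithinAt
  refine ⟨fun x => ⟨_, isOpen_lenz_ne_zero γ E₀, ?_, _, hsm, fun y _ => rfl⟩,
    fun x => ⟨_, isOpen_lenz_ne_zero γ E₀, ?_, _, hsm, fun y _ => rfl⟩⟩
  · have hx := H.ingress_eq.subset x.2
    exact (H.lenz_pos hx.1.2.2).ne'
  · have hx := H.egress_eq.subset x.2
    exact (H.lenz_pos hx.1.2.2).ne'

theorem blockEquiv_eq_reflectRotate (H : S.IsSmallBlock a b γ β h δ E₀) {m : ℕ} (hm : 0 < m)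
    (hβ : |β| = b) (hbm : b = 2 / m)
    (x : ingress (S.vectorField γ β) (S.energyManifold γ β h) (S.block γ β h δ)) :
    (H.blockEquiv m x : Phase) =
      reflectRotate (GammaTilde γ β h δ (1 / (b * √(1 + E₀ ^ 2)))) x := by
  obtain ⟨⟨r, v, z, u⟩, hx⟩ := x
  have hx' := hx
  rw [H.ingress_eq] at hx'
  exact (reflectRotate_eq_blockMap hm H.round.b_pos hβ hbm hx'.2 hx'.1.2.2
    (H.lenz_pos hx'.1.2.2)).symm

theorem isDiffeoExtension_blockEquiv (H : S.IsSmallBlock a b γ β h δ E₀) {m : ℕ} (hm : 0 < m)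
    (hβ : |β| = b) (hbm : b = 2 / m) :
    IsDiffeoExtension (S.vectorField γ β) (S.energyManifold γ β h) (S.block γ β h δ)
      (H.blockEquiv m) := by
  refine ⟨H.isDiffeo_blockEquiv m, fun x hx y => ?_⟩
  rw [H.crossesTo_iff hβ x.2 hx, H.blockEquiv_eq_reflectRotate hm hβ hbm]

/-- A diffeomorphism extending the map across the block is unique, since the points with nonzero
angular momentum are dense among the ingress points. -/
theorem isDiffeoExtension_unique (H : S.IsSmallBlock a b γ β h δ E₀)
    {e e' : ingress (S.vectorField γ β) (S.energyManifold γ β h) (S.block γ β h δ) ≃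
      egress (S.vectorField γ β) (S.energyManifold γ β h) (S.block γ β h δ)}
    (he : IsDiffeoExtension (S.vectorField γ β) (S.energyManifold γ β h) (S.block γ β h δ) e)
    (he' : IsDiffeoExtension (S.vectorField γ β) (S.energyManifold γ β h) (S.block γ β h δ) e') :
    e = e' := by
  have hne : ∀ x : ingress (S.vectorField γ β) (S.energyManifold γ β h) (S.block γ β h δ),
      (x : Phase).2.2.2 ≠ 0 → (e x : Phase) = e' x := fun x hx => by
    have hxa := mt (H.mem_asympPlus_iff x.2).1 hx
    exact (he'.2 x hxa _).1 ((he.2 x hxa _).2 rfl)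
  refine Equiv.ext fun x => Subtype.ext ?_
  by_cases hu : (x : Phase).2.2.2 = 0
  swap
  · exact hne x hu
  obtain ⟨⟨r, v, z, u⟩, hx⟩ := x
  have hx' := hx
  rw [H.ingress_eq] at hx'
  obtain ⟨⟨hr, hz, hen⟩, hv⟩ := hx'
  dsimp only at hr hz hen hv hu
  subst hu
  have hv0 : v ≠ 0 := by
    rintro rfl
    have := H.energy_pos H.E_pos.le le_rfl
    rw [H.δ_eq] at this
    norm_num at hen
    linarith
  -- A path in b⁺ through the given point on which u ≠ 0 for 0 < s < π. The absolute value keeps the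
  -- second coordinate nonpositive for every real s, so continuity is that of a map on the line.
  have hmem : ∀ s : ℝ, ((r, v * |Real.cos s|, z, v * Real.sin s) : Phase) ∈
      ingress (S.vectorField γ β) (S.energyManifold γ β h) (S.block γ β h δ) := fun s => by
    rw [H.ingress_eq]
    refine ⟨⟨hr, hz, ?_⟩, mul_nonpos_of_nonpos_of_nonneg hv (abs_nonneg _)⟩
    dsimp only
    rw [mul_pow, mul_pow, sq_abs, ← mul_add, Real.sin_sq_add_cos_sq, ← hen]
    ring
  set c : ℝ → ingress (S.vectorField γ β) (S.energyManifold γ β h) (S.block γ β h δ) :=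
    fun s => ⟨(r, v * |Real.cos s|, z, v * Real.sin s), hmem s⟩ with hc
  have hcc : Continuous c := by
    refine Continuous.subtype_mk ?_ _
    have h1 : Continuous fun s : ℝ => v * |Real.cos s| :=
      continuous_const.mul Real.continuous_cos.abs
    have h2 : Continuous fun s : ℝ => v * Real.sin s := continuous_const.mul Real.continuous_sin
    exact continuous_const.prodMk (h1.prodMk (continuous_const.prodMk h2))
  have hc0 : c 0 = ⟨(r, v, z, 0), hx⟩ := Subtype.ext (by simp [hc])
  rw [← hc0]
  have h1 := ((he.1.1.continuous.comp hcc).tendsto 0).mono_left (nhdsWithin_le_nhds (s := Ioi 0))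
  have h2 := ((he'.1.1.continuous.comp hcc).tendsto 0).mono_left (nhdsWithin_le_nhds (s := Ioi 0))
  refine tendsto_nhds_unique h1 (h2.congr' ?_)
  filter_upwards [Ioo_mem_nhdsGT Real.pi_pos] with s hs
  refine (hne (c s) ?_).symm
  exact mul_ne_zero hv0 (Real.sin_pos_of_pos_of_lt_pi hs.1 hs.2).ne'

end IsSmallBlock

end SphericalSurface

end KeplerBlock

theorem theorem4 (S : SphericalSurface) (K γ β h : ℝ) (hK : 0 < K)
    (hcurv : S.HasConstantCurvature K) (hpar : S.HasParameter β) (hγ : 0 < γ)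
    (m : ℕ) (hm : 0 < m) (hβ : |β| = 2 / (m : ℝ)) :
    IsTrivializableInvariantSet (S.vectorField γ β) (S.energyManifold γ β h) 2
      (S.collisionManifold γ β h) ∧
    ∃ δ₀ > 0, ∀ δ, 0 < δ → δ ≤ δ₀ →
      Isolates (S.vectorField γ β) (S.energyManifold γ β h) 2
        (S.block γ β h δ) (S.collisionManifold γ β h) ∧
      IsTrivializableBlock (S.vectorField γ β) (S.energyManifold γ β h) (S.block γ β h δ) ∧
      ∃ r₀ ∈ Ioo S.rN S.rS, S.Theta β r₀ < 0 ∧ |S.Theta β r₀|⁻¹ = δ ∧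
        (∀ x ∈ relBoundary (S.energyManifold γ β h) (S.block γ β h δ), x.1 = r₀) ∧
        (∀ v θ u : ℝ, ((r₀, v, Complex.exp ((θ : ℂ) * Complex.I), u) : Phase) ∈
            ingress (S.vectorField γ β) (S.energyManifold γ β h) (S.block γ β h δ) →
          0 < S.rungeLenzNorm γ β r₀ v θ u ∧
          S.rungeLenz₁ γ β r₀ v θ u = S.rungeLenzNorm γ β r₀ v θ u *
            Real.sin (β * (θ - zeta γ β h δ (|S.Theta β r₀| * S.f r₀) u)) ∧
          S.rungeLenz₂ γ β r₀ v θ u = -(S.rungeLenzNorm γ β r₀ v θ u *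
            Real.cos (β * (θ - zeta γ β h δ (|S.Theta β r₀| * S.f r₀) u)))) ∧
        (∀ x ∈ ingress (S.vectorField γ β) (S.energyManifold γ β h) (S.block γ β h δ),
          x ∉ asympPlus (S.vectorField γ β) (S.energyManifold γ β h) (S.block γ β h δ) →
          ∀ y : Phase,
            CrossesTo (S.vectorField γ β) (S.energyManifold γ β h) (S.block γ β h δ) x y ↔
              y = reflectRotate (GammaTilde γ β h δ (|S.Theta β r₀| * S.f r₀)) x) ∧
        ∃ e : ingress (S.vectorField γ β) (S.energyManifold γ β h) (S.block γ β h δ) ≃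
            egress (S.vectorField γ β) (S.energyManifold γ β h) (S.block γ β h δ),
          IsDiffeoExtension (S.vectorField γ β) (S.energyManifold γ β h) (S.block γ β h δ) e ∧
          ∀ x, (e x : Phase) =
            reflectRotate (GammaTilde γ β h δ (|S.Theta β r₀| * S.f r₀)) x := by
  have hm' : (0 : ℝ) < m := Nat.cast_pos.2 hm
  have hb : 0 < |β| := by rw [hβ]; positivity
  have hS := SphericalSurface.isRound_of_constantCurvature hK hcurv hpar (abs_pos.1 hb)
  set a := √K
  have ha := hS.a_pos
  have key : ∃ δ₀ > 0, ∀ δ, 0 < δ → δ ≤ δ₀ →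
      S.IsSmallBlock a |β| γ β h δ (δ * a / |β| ^ 2) := by
    -- The first bound gives 2|h|δ < γ/2 and the second E₀ ≤ 1/2, so the smallness condition holds
    -- with γ/4 to spare.
    refine ⟨min (γ / (4 * |h| + 4)) (|β| ^ 2 / (2 * a)), lt_min (by positivity) (by positivity),
      fun δ hδ hle => ⟨hS, (sq_abs β).symm, hγ, by positivity, by field_simp, ?_⟩⟩
    have h1 : 2 * |h| * δ < γ / 2 := by
      have h2 := hle.trans (min_le_left _ _)
      rw [le_div_iff₀ (by positivity)] at h2
      linarith
    have h2 : δ * a / |β| ^ 2 ≤ 1 / 2 := by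
      have h3 := hle.trans (min_le_right _ _)
      rw [le_div_iff₀ (by positivity)] at h3
      rw [div_le_iff₀ (by positivity)]
      linarith
    have h3 : (δ * a / |β| ^ 2) ^ 2 ≤ (1 / 2) ^ 2 := by gcongr
    have h4 : γ * (δ * a / |β| ^ 2) ^ 2 ≤ γ * (1 / 2) ^ 2 := by gcongr
    linarith
  have main : ∀ {δ E₀ : ℝ}, S.IsSmallBlock a |β| γ β h δ E₀ →
      IsTrivializableBlock (S.vectorField γ β) (S.energyManifold γ β h) (S.block γ β h δ) :=
    fun H => ⟨H.blockEquiv m, H.isDiffeoExtension_blockEquiv hm rfl hβ,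
      fun e' he' => H.isDiffeoExtension_unique he' (H.isDiffeoExtension_blockEquiv hm rfl hβ)⟩
  obtain ⟨δ₀, hδ₀, hsmall⟩ := key
  refine ⟨?_, δ₀, hδ₀, fun δ hδ hle => ?_⟩
  · have H := hsmall δ₀ hδ₀ le_rfl
    exact ⟨H.isIsolatedInvariantSet, _, H.isolates, main H⟩
  · have H := hsmall δ hδ hle
    generalize δ * a / |β| ^ 2 = E₀ at H
    obtain ⟨hΘ, hk⟩ := H.abs_Theta_mul_f
    refine ⟨H.isolates, main H, S.radius a E₀, hS.radius_mem_Ioo H.E_pos, hΘ, H.abs_Theta_inv,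
      fun x hx => ?_, fun v θ u hx => ?_, ?_, H.blockEquiv m,
      H.isDiffeoExtension_blockEquiv hm rfl hβ, ?_⟩
    · rw [H.relBoundary_eq] at hx
      exact hx.1
    · rw [H.ingress_eq] at hx
      exact SphericalSurface.rungeLenz_polar θ hb rfl hx.2 hx.1.2.2 (H.lenz_pos hx.1.2.2) hΘ hk
    · rw [hk]
      exact fun x hx hxa y => H.crossesTo_iff rfl hx hxa y
    · rw [hk]
      exact H.blockEquiv_eq_reflectRotate hm rfl hβ
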